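/- Let $n\ge 1$, let $\mathcal M$ be a nonempty oriented compact smooth $n$-dimensional manifold without boundary and let $F_0:\mathcal M\to\mathbb R^{n+1}$ be a smooth embedding such that $F_0(\mathcal M)$ is strictly convex (all principal curvatures with respect to the outer normal are positive). Let $\phi:[0,\infty)\to\mathbb R$ be continuous, of class $C^2$ on $(0,\infty)$, and such that (i) $\phi(0)=0$ and $\lim_{\alpha\to\infty}\phi(\alpha)=\infty$; (ii) $\phi'(\alpha)>0$ for all $\alpha>0$; (iii) $\lim_{\alpha\to0}\phi'(\alpha)\alpha^2/\phi(\alpha)=0$ and $\lim_{\alpha\to\infty}\phi'(\alpha)\alpha^2/\phi(\alpha)=\infty$; (iv) $\lim_{\alpha\to0}\phi'(\alpha)\alpha=0$; (v) $\phi''(\alpha)\alpha\ge-2\phi'(\alpha)$ for all $\alpha>0$. Let $0<T\le\infty$ and let $F:\mathcal M\times[0,T)\to\mathbb R^{n+1}$ be a solution of $$\partial_tF(x,t)=[-\phi(H(x,t))+h(t)]\,\nu(x,t),\qquad F(x,0)=F_0(x),$$ which is smooth (class $C^2$ jointly in $x$ and $t$ is enough) and such that each $F_t=F(\cdot,t)$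 is an embedding. Here $\mathcal M_t=F_t(\mathcal M)$, $\Omega_t$ is the compact region enclosed by $\mathcal M_t$ (the union of $\mathcal M_t$ and the bounded components of its complement), $\nu$ is the unit normal of $\mathcal M_t$ pointing out of $\Omega_t$, and $H$ is the mean curvature (the sum of the principal curvatures with respect to $\nu$, positive on round spheres), which is assumed to be nonnegative, as is needed for $\phi(H)$ to be defined. Let $d\mu$ be the measure of the metric induced on $\mathcal M$ by $F_t$, let $|\mathcal M_t|$ be the area, $|\Omega_t|$ the Lebesgue measure of $\Omega_t$, and $\mathcal I(\Omega_t)=|\mathcal M_t|^{n+1}/|\Omega_t|^n$ the isoperimetric ratio. (a) Volume preserving case: if $h(t)=\frac1{|\mathcal M_t|}\int_{\mathcal M_t}\phi(H)\,d\mu$ for all $t\in[0,T)$, then $t\mapsto|\mathcal M_t|$ is differentiable on $[0,T)$ and $\frac{d}{dt}|\mathcal M_t|\le0$. (b) Area preserving case: if $h(t)=\int_{\mathcal M_t}H\phi(H)\,d\mu\Big/\int_{\mathcal M_t}H\,d\mu$ for all $t\in[0,T)$, then $t\mapsto|\Omega_t|$ is differentiable on $[0,T)$ and $\frac{d}{dt}|\Omega_t|\ge0$.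 In both cases $t\mapsto\mathcal I(\Omega_t)$ is nonincreasing on $[0,T)$. (Derivatives at $t=0$ are one-sided.) -/

import Mathlib

open Set Filter Topology MeasureTheory
open scoped Manifold ContDiff

noncomputable section

namespace ConstrainedFlow

/-- The admissible speed functions `φ : [0, ∞) → ℝ`, extended to `ℝ` in an arbitrary way
(only the values on `[0, ∞)` occur below). -/
structure IsSpeed (φ : ℝ → ℝ) : Prop where
  continuousOn : ContinuousOn φ (Ici 0)
  contDiffOn : ContDiffOn ℝ 2 φ (Ioi 0)
  map_zero : φ 0 = 0
  tendsto_atTop : Tendsto φ atTop atTop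
  deriv_pos : ∀ a, 0 < a → 0 < deriv φ a
  limit_zero : Tendsto (fun a => deriv φ a * a ^ 2 / φ a) (𝓝[>] 0) (𝓝 0)
  limit_atTop : Tendsto (fun a => deriv φ a * a ^ 2 / φ a) atTop atTop
  deriv_mul_limit : Tendsto (fun a => deriv φ a * a) (𝓝[>] 0) (𝓝 0)
  second_deriv : ∀ a, 0 < a → -2 * deriv φ a ≤ deriv (deriv φ) a * a

/-- The interval `[0, T)`, where `T` may be `∞`. -/
def timeInterval (T : EReal) : Set ℝ := {t | 0 ≤ t ∧ (t : EReal) < T}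

section Geometry

variable {n : ℕ} {M : Type*} [TopologicalSpace M] [ChartedSpace (EuclideanSpace ℝ (Fin n)) M]

/-- A `C^k` embedding of the `n`-manifold `M` into `ℝ^{n+1}`: a `C^k` map which is a homeomorphism
onto its image and whose differential is injective at each point. -/
structure IsEmbeddedHypersurface (k : ℕ∞ω) (F : M → EuclideanSpace ℝ (Fin (n + 1))) : Prop where
  contMDiff : ContMDiff (𝓡 n) 𝓘(ℝ, EuclideanSpace ℝ (Fin (n + 1))) k F
  isEmbedding : Topology.IsEmbedding F
  injective_mfderiv : ∀ x, Function.Injective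
    (mfderiv (𝓡 n) 𝓘(ℝ, EuclideanSpace ℝ (Fin (n + 1))) F x)

/-- The compact region `Ω` enclosed by the hypersurface `F(M)`: the points of `F(M)`, together with
the bounded connected components of its complement. (For `p ∈ F(M)` the set
`connectedComponentIn (F(M))ᶜ p` is empty, hence bounded.) -/
def enclosedRegion (F : M → EuclideanSpace ℝ (Fin (n + 1))) :
    Set (EuclideanSpace ℝ (Fin (n + 1))) :=
  {p | Bornology.IsBounded (connectedComponentIn (range F)ᶜ p)}

/-- `ν` is the outer unit normal field of the embedded hypersurface `F`. -/
structure IsOuterUnitNormal (F ν : M → EuclideanSpace ℝ (Fin (n + 1))) : Prop where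
  continuous : Continuous ν
  norm_eq_one : ∀ x, ‖ν x‖ = 1
  orthogonal : ∀ (x : M) (v : TangentSpace (𝓡 n) x),
    inner ℝ (ν x) (mfderiv (𝓡 n) 𝓘(ℝ, EuclideanSpace ℝ (Fin (n + 1))) F x v) = 0
  outward : ∀ x, ∀ᶠ s : ℝ in 𝓝[>] 0,
    F x + s • ν x ∉ enclosedRegion F ∧ F x - s • ν x ∈ enclosedRegion F

/-- The map `F` in the coordinates `u = (u¹, …, uⁿ)` of the preferred chart at `c`. -/
def coordMap (F : M → EuclideanSpace ℝ (Fin (n + 1))) (c : M) (u : EuclideanSpace ℝ (Fin n)) :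
    EuclideanSpace ℝ (Fin (n + 1)) :=
  F ((chartAt (EuclideanSpace ℝ (Fin n)) c).symm u)

/-- The partial derivative `∂F/∂uⁱ` in the preferred chart at `c`. -/
def coordDeriv (F : M → EuclideanSpace ℝ (Fin (n + 1))) (c : M) (i : Fin n)
    (u : EuclideanSpace ℝ (Fin n)) : EuclideanSpace ℝ (Fin (n + 1)) :=
  fderiv ℝ (coordMap F c) u (EuclideanSpace.single i 1)

/-- The induced metric `g_{ij} = (∂F/∂uⁱ, ∂F/∂uʲ)` in the preferred chart at `c`. -/
def metric (F : M → EuclideanSpace ℝ (Fin (n + 1))) (c : M) (u : EuclideanSpace ℝ (Fin n)) :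
    Matrix (Fin n) (Fin n) ℝ :=
  Matrix.of fun i j => inner ℝ (coordDeriv F c i u) (coordDeriv F c j u)

/-- The second fundamental form `h_{ij} = -(∂²F/∂uⁱ∂uʲ, ν)` in the preferred chart at `c`
(nonnegative for convex hypersurfaces with outer normal `ν`). -/
def secondForm (F ν : M → EuclideanSpace ℝ (Fin (n + 1))) (c : M)
    (u : EuclideanSpace ℝ (Fin n)) : Matrix (Fin n) (Fin n) ℝ :=
  Matrix.of fun i j => -inner ℝ
    (fderiv ℝ (coordDeriv F c j) u (EuclideanSpace.single i 1))
    (ν ((chartAt (EuclideanSpace ℝ (Fin n)) c).symm u))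

/-- The matrix `hⁱ_j = g^{ik} h_{kj}` of the Weingarten operator at the point `x`, in the preferred
chart at `x`. -/
def weingarten (F ν : M → EuclideanSpace ℝ (Fin (n + 1))) (x : M) : Matrix (Fin n) (Fin n) ℝ :=
  (metric F x (chartAt (EuclideanSpace ℝ (Fin n)) x x))⁻¹ *
    secondForm F ν x (chartAt (EuclideanSpace ℝ (Fin n)) x x)

/-- The mean curvature `H = λ₁ + ⋯ + λₙ`, i.e. the trace of the Weingarten operator. -/
def meanCurvature (F ν : M → EuclideanSpace ℝ (Fin (n + 1))) (x : M) : ℝ :=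
  (weingarten F ν x).trace

/-- Strict convexity: all principal curvatures (the eigenvalues of the Weingarten operator) are
positive at each point. -/
def IsStrictlyConvex (F ν : M → EuclideanSpace ℝ (Fin (n + 1))) : Prop :=
  ∀ (x : M) (κ : ℝ), Module.End.HasEigenvalue (Matrix.toLin' (weingarten F ν x)) κ → 0 < κ

section Integration

variable [IsManifold (𝓡 n) ∞ M] [T2Space M] [CompactSpace M]

/-- A smooth partition of unity on `M`, subordinate to the domains of the preferred charts. -/
def chartPartition (n : ℕ) (M : Type*) [TopologicalSpace M]
    [ChartedSpace (EuclideanSpace ℝ (Fin n)) M] [IsManifold (𝓡 n) ∞ M] [T2Space M]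
    [CompactSpace M] : SmoothPartitionOfUnity M (𝓡 n) M univ :=
  Classical.choose (SmoothPartitionOfUnity.exists_isSubordinate_chartAt_source (𝓡 n) M)

variable [MeasurableSpace M]

/-- The measure `dμ = √(det g_{ij}) du` of the induced metric on `M`, patched together from the
charts by a partition of unity `ρ`:
`∫ f dμ = ∑_c ∫ ρ_c f √(det g_{ij}) du¹ ⋯ duⁿ`, where the `c`-th integral is taken over the
range of the chart at `c`. It does not depend on `ρ` by the change of variables formula. -/
def areaMeasure (F : M → EuclideanSpace ℝ (Fin (n + 1))) : Measure M :=
  Measure.sum fun c : M =>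
    ((volume.restrict (chartAt (EuclideanSpace ℝ (Fin n)) c).target).withDensity fun u =>
      ENNReal.ofReal (chartPartition n M c ((chartAt (EuclideanSpace ℝ (Fin n)) c).symm u) *
        √(metric F c u).det)).map (chartAt (EuclideanSpace ℝ (Fin n)) c).symm

/-- The area `|F(M)|`. -/
def area (F : M → EuclideanSpace ℝ (Fin (n + 1))) : ℝ := (areaMeasure F).real univ

/-- The volume `|Ω|` of the enclosed region, that is, its Lebesgue measure in `ℝ^{n+1}`. -/
def enclosedVolume (F : M → EuclideanSpace ℝ (Fin (n + 1))) : ℝ :=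
  volume.real (enclosedRegion F)

/-- The isoperimetric ratio `|∂Ω|^{n+1} / |Ω|^n` of the enclosed region. -/
def isoperimetricRatio (F : M → EuclideanSpace ℝ (Fin (n + 1))) : ℝ :=
  area F ^ (n + 1) / enclosedVolume F ^ n

/-- The choice of `h` for the volume preserving flow: the mean value of `φ(H)`. -/
def volumePreservingTerm (φ : ℝ → ℝ) (F ν : M → EuclideanSpace ℝ (Fin (n + 1))) : ℝ :=
  (1 / area F) * ∫ x, φ (meanCurvature F ν x) ∂areaMeasure F

/-- The choice of `h` for the area preserving flow: the mean value of `φ(H)` with weight `H`. -/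
def areaPreservingTerm (φ : ℝ → ℝ) (F ν : M → EuclideanSpace ℝ (Fin (n + 1))) : ℝ :=
  (∫ x, meanCurvature F ν x * φ (meanCurvature F ν x) ∂areaMeasure F) /
    ∫ x, meanCurvature F ν x ∂areaMeasure F

end Integration

/-- `F : [0, T) × M → ℝ^{n+1}` is a solution of `∂F/∂t = [-φ(H) + h(t)] ν` with `F(0, ·) = F₀`,
consisting of embedded hypersurfaces, where `ν(t, ·)` is the outer unit normal of `F(t, ·)`.
The function `φ` is only defined on `[0, ∞)`, so the equation requires `H ≥ 0`.
The solution is only required to be of class `C²` jointly in space and time. -/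
structure IsFlow (φ h : ℝ → ℝ) (T : EReal) (F₀ : M → EuclideanSpace ℝ (Fin (n + 1)))
    (F ν : ℝ → M → EuclideanSpace ℝ (Fin (n + 1))) : Prop where
  contMDiffOn : ContMDiffOn (𝓘(ℝ, ℝ).prod (𝓡 n)) 𝓘(ℝ, EuclideanSpace ℝ (Fin (n + 1))) 2
    (fun p : ℝ × M => F p.1 p.2) (timeInterval T ×ˢ univ)
  embedded : ∀ t ∈ timeInterval T, IsEmbeddedHypersurface 2 (F t)
  outerNormal : ∀ t ∈ timeInterval T, IsOuterUnitNormal (F t) (ν t)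
  meanCurvature_nonneg : ∀ t ∈ timeInterval T, ∀ x, 0 ≤ meanCurvature (F t) (ν t) x
  equation : ∀ t ∈ timeInterval T, ∀ x,
    HasDerivWithinAt (fun s => F s x) ((-φ (meanCurvature (F t) (ν t) x) + h t) • ν t x)
      (timeInterval T) t
  initial : ∀ x, F 0 x = F₀ x

end Geometry

end ConstrainedFlow

end

/-!
The time derivatives of area and volume under a motion with normal velocity `f ν` are `∫ f H dμ` and
`∫ f dμ`. Here `f = h - φ(H)`. Let `c ≥ 0` be the number with `φ(c) = h`. As `φ` is increasing,
`(h - φ(H)) (H - c) ≤ 0` pointwise, hence `∫ f H dμ ≤ c ∫ f dμ` (`IsSpeed.integral_mul_le`). In the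
volume preserving case `∫ f dμ = 0`, so the area does not increase; in the area preserving case
`∫ f H dμ = 0`, so the volume does not decrease (if `c = 0`, then `H = 0` almost everywhere and both
integrals vanish). The enclosed volume is positive, and the isoperimetric ratio is nonincreasing
because the area is nonincreasing and the volume is nondecreasing in both cases.

The formula for the area (`hasDerivWithinAt_area`) is a computation in the preferred charts: the
metric evolves by `∂g/∂t = 2 f b` with the second fundamental form `b`, and Jacobi's formula turns
this into `∂√g/∂t = f H √g`. The joint regularity `C²` lets time and space derivatives commute.

The formula for the volume (`hasDerivWithinAt_enclosedVolume`) has to follow a region that is defined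
by the components of the complement. The displacement `F_t - F_{t₀}`, viewed as a field on the
hypersurface `F_{t₀}(M)`, is Lipschitz with constant `O(|t - t₀|)`
(`exists_displacement_lipschitz`). Its Lipschitz extension `η` to the ambient space makes `id + η` a
homeomorphism, which carries the enclosed region at time `t₀` to the one at time `t`. Expanding the
Jacobian, the change of the volume is `∫ div η` over the fixed region up to `o(|t - t₀|)`, and the
divergence theorem for Lipschitz fields (`integral_trace_fderiv_enclosedRegion`) converts this into
the flux `∫ (F_t - F_{t₀}, ν) dμ`. The divergence theorem is local; near the hypersurface it is the
fundamental theorem of calculus along transversal lines, and an arbitrary direction is the difference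
of two transversal ones.
-/

noncomputable section

set_option linter.unusedSectionVars false

namespace ConstrainedFlow

/-! ### Determinants and Gram determinants -/

section LinearAlgebra

theorem contDiff_matrix_det {m : ℕ} {k : ℕ∞ω} :
    ContDiff ℝ k (fun A : Fin m → Fin m → ℝ => (Matrix.of A).det) := by
  simp only [Matrix.det_apply]
  refine ContDiff.sum fun σ _ => ?_
  refine ContDiff.const_smul _ (contDiff_prod fun i _ => ?_)
  simp only [Matrix.of_apply]
  fun_prop

/-- The derivative of the determinant at the identity is the trace. -/
theorem hasDerivAt_matrix_det_line {m : ℕ} (B : Matrix (Fin m) (Fin m) ℝ) :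
    HasDerivAt (fun r : ℝ => (1 + r • B).det) B.trace 0 := by
  have h : (fun r : ℝ => (1 + r • B).det) = fun r : ℝ => 1 + B.trace * r +
      (Polynomial.eval r (Matrix.det (1 + (Polynomial.X : Polynomial ℝ) •
        B.map Polynomial.C)).divX.divX) * r ^ 2 := by
    funext r
    exact Matrix.det_one_add_smul r B
  rw [h]
  have h1 := ((hasDerivAt_id (0 : ℝ)).const_mul B.trace).const_add 1
  have h2 := ((Polynomial.hasDerivAt (Matrix.det (1 + (Polynomial.X : Polynomial ℝ) •
        B.map Polynomial.C)).divX.divX (0 : ℝ)).mul (hasDerivAt_pow 2 (0 : ℝ)))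
  convert! h1.add h2 using 1
  simp

/-- Jacobi's formula `(det A)' = det A · tr (A⁻¹ A')` for a curve with differentiable entries. -/
theorem hasDerivWithinAt_matrix_det {m : ℕ} {A : ℝ → Matrix (Fin m) (Fin m) ℝ}
    {A' : Matrix (Fin m) (Fin m) ℝ} {s : Set ℝ} {t : ℝ} (ht : IsUnit (A t).det)
    (hA : ∀ i j, HasDerivWithinAt (fun r => A r i j) (A' i j) s t) :
    HasDerivWithinAt (fun r => (A r).det) ((A t).det * ((A t)⁻¹ * A').trace) s t := by
  have hdiff : DifferentiableAt ℝ (fun B : Fin m → Fin m → ℝ => (Matrix.of B).det)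
      (fun i j => A t i j) := (contDiff_matrix_det (k := 1)).differentiable (by norm_num) _
  set D := fderiv ℝ (fun B : Fin m → Fin m → ℝ => (Matrix.of B).det) (fun i j => A t i j) with hD
  have hcurve : HasDerivWithinAt (fun r => (fun i j => A r i j : Fin m → Fin m → ℝ))
      (fun i j => A' i j) s t := by
    rw [hasDerivWithinAt_pi]
    intro i
    rw [hasDerivWithinAt_pi]
    exact fun j => hA i j
  have h1 : HasDerivWithinAt (fun r => (A r).det) (D (fun i j => A' i j)) s t :=
    hdiff.hasFDerivAt.comp_hasDerivWithinAt (f := fun r => (fun i j => A r i j)) t hcurve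
  -- The value of `D` in the direction `A'` is computed along the straight line
  have h2 : HasDerivAt (fun r : ℝ => (A t + r • A').det) (D (fun i j => A' i j)) 0 := by
    have hl : HasDerivAt (fun r : ℝ => (fun i j => A t i j + r * A' i j : Fin m → Fin m → ℝ))
        (fun i j => A' i j) 0 := by
      rw [hasDerivAt_pi]
      intro i
      rw [hasDerivAt_pi]
      intro j
      simpa using ((hasDerivAt_id (0 : ℝ)).mul_const (A' i j)).const_add (A t i j)
    refine HasFDerivAt.comp_hasDerivAt
      (l := fun B : Fin m → Fin m → ℝ => (Matrix.of B).det)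
      (f := fun r : ℝ => (fun i j => A t i j + r * A' i j : Fin m → Fin m → ℝ)) 0 ?_ hl
    simpa using hdiff.hasFDerivAt
  have h3 : HasDerivAt (fun r : ℝ => (A t + r • A').det)
      ((A t).det * ((A t)⁻¹ * A').trace) 0 := by
    have := (hasDerivAt_matrix_det_line ((A t)⁻¹ * A')).const_mul (A t).det
    refine this.congr_of_eventuallyEq (Eventually.of_forall fun r => ?_)
    simp only
    rw [← Matrix.det_mul, mul_add, mul_one, Matrix.mul_smul, ← mul_assoc,
      Matrix.mul_nonsing_inv _ ht, one_mul]
  rw [← h2.unique h3]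
  exact h1

variable {n : ℕ}

/-- The trace of an endomorphism of `ℝ^m`, as a continuous linear functional. -/
def traceCLM (m : ℕ) :
    (EuclideanSpace ℝ (Fin m) →L[ℝ] EuclideanSpace ℝ (Fin m)) →L[ℝ] ℝ :=
  ∑ a, (EuclideanSpace.proj a : EuclideanSpace ℝ (Fin m) →L[ℝ] ℝ).comp
    (ContinuousLinearMap.apply ℝ (EuclideanSpace ℝ (Fin m)) (EuclideanSpace.single a (1 : ℝ)))

theorem traceCLM_apply {m : ℕ} (A : EuclideanSpace ℝ (Fin m) →L[ℝ] EuclideanSpace ℝ (Fin m)) :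
    traceCLM m A = ∑ a, (A (EuclideanSpace.single a 1)) a := by
  simp [traceCLM, sum_apply]

theorem det_eq_det_of_entries {m : ℕ}
    (B : EuclideanSpace ℝ (Fin m) →L[ℝ] EuclideanSpace ℝ (Fin m)) :
    B.det = (Matrix.of fun i j => (B (EuclideanSpace.single j 1)) i).det := by
  rw [ContinuousLinearMap.det,
    ← LinearMap.det_toMatrix (EuclideanSpace.basisFun (Fin m) ℝ).toBasis]
  congr 1

theorem hasFDerivAt_det_one {m : ℕ} :
    HasFDerivAt (fun A : EuclideanSpace ℝ (Fin m) →L[ℝ] EuclideanSpace ℝ (Fin m) => A.det)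
      (traceCLM m)
      (1 : EuclideanSpace ℝ (Fin m) →L[ℝ] EuclideanSpace ℝ (Fin m)) := by
  set b := (EuclideanSpace.basisFun (Fin m) ℝ).toBasis
  have hdiff : DifferentiableAt ℝ
      (fun A : EuclideanSpace ℝ (Fin m) →L[ℝ] EuclideanSpace ℝ (Fin m) => A.det) 1 := by
    have h1 : Differentiable ℝ
        (fun A : EuclideanSpace ℝ (Fin m) →L[ℝ] EuclideanSpace ℝ (Fin m) =>
        (fun i j => (A (EuclideanSpace.single j 1)) i : Fin m → Fin m → ℝ)) := by
      fun_prop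
    have h2 := ((contDiff_matrix_det (m := m) (k := 1)).differentiable (by norm_num)).comp h1
    rw [show (fun A : EuclideanSpace ℝ (Fin m) →L[ℝ] EuclideanSpace ℝ (Fin m) => A.det) = _ from
      funext det_eq_det_of_entries]
    exact h2 1
  convert hdiff.hasFDerivAt using 1
  ext B
  have h1 : HasDerivAt (fun r : ℝ =>
      ((1 : EuclideanSpace ℝ (Fin m) →L[ℝ] EuclideanSpace ℝ (Fin m)) + r • B).det)
      (fderiv ℝ (fun A : EuclideanSpace ℝ (Fin m) →L[ℝ] EuclideanSpace ℝ (Fin m) => A.det) 1 B)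
      0 := by
    refine HasFDerivAt.comp_hasDerivAt
      (l := fun A : EuclideanSpace ℝ (Fin m) →L[ℝ] EuclideanSpace ℝ (Fin m) => A.det)
      (f := fun r : ℝ =>
        ((1 : EuclideanSpace ℝ (Fin m) →L[ℝ] EuclideanSpace ℝ (Fin m)) + r • B)) 0 ?_ ?_
    · have h0 : (1 : EuclideanSpace ℝ (Fin m) →L[ℝ] EuclideanSpace ℝ (Fin m)) + (0 : ℝ) • B = 1 := by
        ext v i
        simp
      simp only [h0]
      exact hdiff.hasFDerivAt
    · simpa using ((hasDerivAt_id (0 : ℝ)).smul_const B).const_add 1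
  have h2 := hasDerivAt_matrix_det_line
    (LinearMap.toMatrix b b (B : EuclideanSpace ℝ (Fin m) →ₗ[ℝ] EuclideanSpace ℝ (Fin m)))
  have h3 : (fun r : ℝ => (1 + r • LinearMap.toMatrix b b
      (B : EuclideanSpace ℝ (Fin m) →ₗ[ℝ] EuclideanSpace ℝ (Fin m))).det) = fun r : ℝ =>
      ((1 : EuclideanSpace ℝ (Fin m) →L[ℝ] EuclideanSpace ℝ (Fin m)) + r • B).det := by
    funext r
    rw [ContinuousLinearMap.det, ← LinearMap.det_toMatrix b]
    congr 1
    rw [ContinuousLinearMap.toLinearMap_add, map_add, ContinuousLinearMap.toLinearMap_smul, map_smul]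
    congr 1
    exact (LinearMap.toMatrix_one b).symm
  rw [h3] at h2
  rw [h1.unique h2]
  rw [traceCLM_apply, Matrix.trace]
  refine Finset.sum_congr rfl fun a _ => ?_
  simp [LinearMap.toMatrix_apply, b]

/-- The Gram determinant `det (A eᵢ, A eⱼ)` of a linear map `A : ℝⁿ → ℝⁿ⁺¹`; the square root of it
is the factor by which `A` multiplies `n`-dimensional volumes. -/
def gramDet (A : EuclideanSpace ℝ (Fin n) →L[ℝ] EuclideanSpace ℝ (Fin (n + 1))) : ℝ :=
  (Matrix.gram ℝ fun i => A (EuclideanSpace.single i 1)).det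

theorem eq_sum_smul_single {m : ℕ} (v : EuclideanSpace ℝ (Fin m)) :
    v = ∑ k, v k • EuclideanSpace.single k (1 : ℝ) := by
  simpa using ((EuclideanSpace.basisFun (Fin m) ℝ).sum_repr v).symm

theorem gramDet_comp (A : EuclideanSpace ℝ (Fin n) →L[ℝ] EuclideanSpace ℝ (Fin (n + 1)))
    (B : EuclideanSpace ℝ (Fin n) →L[ℝ] EuclideanSpace ℝ (Fin n)) :
    gramDet (A.comp B) = gramDet A * B.det ^ 2 := by
  set J : Matrix (Fin n) (Fin n) ℝ := Matrix.of fun i j => (B (EuclideanSpace.single j 1)) i with hJ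
  have hB : ∀ j, A (B (EuclideanSpace.single j 1)) =
      ∑ k, J k j • A (EuclideanSpace.single k 1) := by
    intro j
    conv_lhs => rw [eq_sum_smul_single (B (EuclideanSpace.single j 1))]
    simp [J]
  have h : (Matrix.gram ℝ fun i => (A.comp B) (EuclideanSpace.single i 1)) =
      J.transpose * (Matrix.gram ℝ fun i => A (EuclideanSpace.single i 1)) * J := by
    ext i j
    simp only [Matrix.gram_apply, ContinuousLinearMap.comp_apply, hB, Matrix.mul_apply,
      Matrix.transpose_apply, sum_inner, inner_sum, inner_smul_left, inner_smul_right,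
      Finset.sum_mul, RCLike.conj_to_real]
    refine Finset.sum_congr rfl fun k _ => ?_
    rw [Finset.mul_sum]
    refine Finset.sum_congr rfl fun l _ => ?_
    rw [real_inner_comm]
    ring
  rw [gramDet, gramDet, h, Matrix.det_mul, Matrix.det_mul, Matrix.det_transpose,
    det_eq_det_of_entries B]
  ring

theorem gramDet_nonneg (A : EuclideanSpace ℝ (Fin n) →L[ℝ] EuclideanSpace ℝ (Fin (n + 1))) :
    0 ≤ gramDet A :=
  (Matrix.posSemidef_gram ℝ _).det_nonneg

theorem gramDet_pos {A : EuclideanSpace ℝ (Fin n) →L[ℝ] EuclideanSpace ℝ (Fin (n + 1))}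
    (hA : Function.Injective A) : 0 < gramDet A := by
  refine (Matrix.posDef_gram_of_linearIndependent ?_).det_pos
  have h := (EuclideanSpace.basisFun (Fin n) ℝ).toBasis.linearIndependent.map'
    (A : EuclideanSpace ℝ (Fin n) →ₗ[ℝ] EuclideanSpace ℝ (Fin (n + 1)))
    (LinearMap.ker_eq_bot.2 hA)
  have he : (fun i => A (EuclideanSpace.single i 1)) =
      A ∘ (EuclideanSpace.basisFun (Fin n) ℝ).toBasis := by
    ext i
    simp
  rw [he]
  exact h

theorem contDiff_gramDet {k : ℕ∞ω} : ContDiff ℝ k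
    (gramDet : (EuclideanSpace ℝ (Fin n) →L[ℝ] EuclideanSpace ℝ (Fin (n + 1))) → ℝ) := by
  refine (contDiff_matrix_det (m := n)).comp
    (f := fun A : EuclideanSpace ℝ (Fin n) →L[ℝ] EuclideanSpace ℝ (Fin (n + 1)) =>
      (fun i j => inner ℝ (A (EuclideanSpace.single i 1)) (A (EuclideanSpace.single j 1)))) ?_
  refine contDiff_pi.2 fun i => contDiff_pi.2 fun j => ?_
  exact ContDiff.inner ℝ (by fun_prop) (by fun_prop)

/-- The coordinates `p ↦ (p₀, (p₁, …, pₙ))`. -/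
def splitCoord (n : ℕ) : EuclideanSpace ℝ (Fin (n + 1)) ≃L[ℝ] ℝ × EuclideanSpace ℝ (Fin n) :=
  LinearEquiv.toContinuousLinearEquiv
    { toFun := fun p => (p 0, WithLp.toLp 2 fun i => p i.succ)
      invFun := fun q => WithLp.toLp 2 (Fin.cons q.1 fun i => q.2 i)
      map_add' := fun p q => rfl
      map_smul' := fun r p => rfl
      left_inv := fun p => by
        ext i
        refine Fin.cases ?_ (fun j => ?_) i <;> simp
      right_inv := fun q => by
        ext <;> simp }

theorem splitCoord_apply (p : EuclideanSpace ℝ (Fin (n + 1))) :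
    splitCoord n p = (p 0, WithLp.toLp 2 fun i => p i.succ) := rfl

theorem measurePreserving_splitCoord :
    MeasurePreserving (splitCoord n) (volume : Measure (EuclideanSpace ℝ (Fin (n + 1))))
      (volume : Measure (ℝ × EuclideanSpace ℝ (Fin n))) := by
  have h1 := EuclideanSpace.volume_preserving_symm_measurableEquiv_toLp (Fin (n + 1))
  have h2 := volume_preserving_piFinSuccAbove (fun _ : Fin (n + 1) => ℝ) 0
  have h3 := (MeasurePreserving.id (volume : Measure ℝ)).prod
    (EuclideanSpace.volume_preserving_symm_measurableEquiv_toLp (Fin n)).symm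
  exact (h3.comp (h2.comp h1))

/-- If the unit vector `ν` is orthogonal to the range of `A : ℝⁿ → ℝⁿ⁺¹`, then the determinant of
`(r, u) ↦ r e + A u` is, up to sign, `√(gramDet A) (e, ν)`. Indeed, the product of the matrices
`(e, A)ᵀ` and `(ν, A)` is block triangular with determinant `(e, ν) gramDet A`, and the case
`e = ν` gives the determinant of `(ν, A)`. -/
theorem abs_det_transversal (A : EuclideanSpace ℝ (Fin n) →L[ℝ] EuclideanSpace ℝ (Fin (n + 1)))
    (hA : Function.Injective A) (e ν : EuclideanSpace ℝ (Fin (n + 1))) (hν : ‖ν‖ = 1)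
    (hort : ∀ v, inner ℝ ν (A v) = 0) :
    |(((ContinuousLinearMap.toSpanSingleton ℝ e).coprod A).comp
      (splitCoord n : EuclideanSpace ℝ (Fin (n + 1)) →L[ℝ] ℝ × EuclideanSpace ℝ (Fin n))).det| =
      √(gramDet A) * |inner ℝ e ν| := by
  set col : EuclideanSpace ℝ (Fin (n + 1)) → Fin (n + 1) → EuclideanSpace ℝ (Fin (n + 1)) :=
    fun w => Fin.cons w fun i => A (EuclideanSpace.single i 1) with hcol
  set B : EuclideanSpace ℝ (Fin (n + 1)) → Matrix (Fin (n + 1)) (Fin (n + 1)) ℝ :=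
    fun w => Matrix.of fun i j => col w j i with hB
  have hmul : ∀ w z, (B w).transpose * B z = Matrix.of fun i j => inner ℝ (col w i) (col z j) := by
    intro w z
    ext i j
    simp [B, Matrix.mul_apply, PiLp.inner_apply, mul_comm]
  have hdet : ∀ w, (B w).det * (B ν).det = gramDet A * inner ℝ w ν := by
    intro w
    rw [← Matrix.det_transpose (B w), ← Matrix.det_mul, hmul, Matrix.det_succ_column_zero,
      Fin.sum_univ_succ]
    rw [Finset.sum_eq_zero]
    · simp only [col, Matrix.of_apply, Fin.cons_zero, Fin.val_zero, pow_zero, one_mul, add_zero]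
      rw [mul_comm]
      congr 1
    · intro i _
      simp only [col, Matrix.of_apply, Fin.cons_zero, Fin.cons_succ]
      rw [real_inner_comm, hort]
      simp
  have hν' : (B ν).det ^ 2 = gramDet A := by
    rw [sq, hdet, real_inner_self_eq_norm_sq, hν]; norm_num
  have hpos := gramDet_pos hA
  have hsq : |(B ν).det| = √(gramDet A) := by
    rw [← hν', Real.sqrt_sq_eq_abs]
  have hne : √(gramDet A) ≠ 0 := (Real.sqrt_pos.2 hpos).ne'
  have he : |(B e).det| = √(gramDet A) * |inner ℝ e ν| := by
    have h := congrArg abs (hdet e)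
    rw [abs_mul, abs_mul, hsq, abs_of_pos hpos] at h
    apply mul_right_cancel₀ hne
    rw [h]
    conv_lhs => rw [← Real.mul_self_sqrt hpos.le]
    ring
  rw [← he, det_eq_det_of_entries]
  congr 3
  ext i j
  refine Fin.cases ?_ (fun k => ?_) j
  · have : splitCoord n (EuclideanSpace.single 0 1) = (1, 0) := by
      rw [splitCoord_apply]; ext <;> simp
    simp [this, col]
  · have : splitCoord n (EuclideanSpace.single k.succ 1) = (0, EuclideanSpace.single k 1) := by
      rw [splitCoord_apply]; ext <;> simp
    simp [this, col]

end LinearAlgebra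

/-! ### Changes of charts -/

section Charts

variable {n : ℕ} {M : Type*} [TopologicalSpace M] [ChartedSpace (EuclideanSpace ℝ (Fin n)) M]
  {F ν : M → EuclideanSpace ℝ (Fin (n + 1))}

theorem det_metric (F : M → EuclideanSpace ℝ (Fin (n + 1))) (c : M)
    (u : EuclideanSpace ℝ (Fin n)) :
    (metric F c u).det = gramDet (fderiv ℝ (coordMap F c) u) := rfl

/-- The coordinate change from the preferred chart at `c` to the preferred chart at `d`. -/
def chartChange (c d : M) (u : EuclideanSpace ℝ (Fin n)) : EuclideanSpace ℝ (Fin n) :=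
  chartAt (EuclideanSpace ℝ (Fin n)) d ((chartAt (EuclideanSpace ℝ (Fin n)) c).symm u)

/-- The domain of the coordinate change from the chart at `c` to the chart at `d`. -/
def chartOverlap (n : ℕ) [ChartedSpace (EuclideanSpace ℝ (Fin n)) M] (c d : M) :
    Set (EuclideanSpace ℝ (Fin n)) :=
  (chartAt (EuclideanSpace ℝ (Fin n)) c).target ∩
    (chartAt (EuclideanSpace ℝ (Fin n)) c).symm ⁻¹' (chartAt (EuclideanSpace ℝ (Fin n)) d).source

theorem isOpen_chartOverlap (c d : M) : IsOpen (chartOverlap n c d) :=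
  (chartAt (EuclideanSpace ℝ (Fin n)) c).isOpen_inter_preimage_symm
    (chartAt (EuclideanSpace ℝ (Fin n)) d).open_source

theorem symm_chartChange {c d : M} {u : EuclideanSpace ℝ (Fin n)} (hu : u ∈ chartOverlap n c d) :
    (chartAt (EuclideanSpace ℝ (Fin n)) d).symm (chartChange c d u) =
      (chartAt (EuclideanSpace ℝ (Fin n)) c).symm u :=
  (chartAt (EuclideanSpace ℝ (Fin n)) d).left_inv hu.2

theorem chartChange_mem {c d : M} {u : EuclideanSpace ℝ (Fin n)} (hu : u ∈ chartOverlap n c d) :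
    chartChange c d u ∈ chartOverlap n d c := by
  refine ⟨(chartAt (EuclideanSpace ℝ (Fin n)) d).map_source hu.2, ?_⟩
  rw [mem_preimage, symm_chartChange hu]
  exact (chartAt (EuclideanSpace ℝ (Fin n)) c).map_target hu.1

theorem chartChange_chartChange {c d : M} {u : EuclideanSpace ℝ (Fin n)}
    (hu : u ∈ chartOverlap n c d) : chartChange d c (chartChange c d u) = u := by
  rw [chartChange, symm_chartChange hu]
  exact (chartAt (EuclideanSpace ℝ (Fin n)) c).right_inv hu.1

theorem chartChange_injOn (c d : M) : InjOn (chartChange c d) (chartOverlap n c d) :=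
  fun u hu v hv h => by
    rw [← chartChange_chartChange hu, h, chartChange_chartChange hv]

theorem coordMap_chartChange (F : M → EuclideanSpace ℝ (Fin (n + 1))) {c d : M}
    {u : EuclideanSpace ℝ (Fin n)} (hu : u ∈ chartOverlap n c d) :
    coordMap F d (chartChange c d u) = coordMap F c u := by
  rw [coordMap, symm_chartChange hu, coordMap]

variable [IsManifold (𝓡 n) ∞ M]

theorem contDiffOn_chartChange (c d : M) : ContDiffOn ℝ ∞ (chartChange c d)
    (chartOverlap n c d) := by
  rw [← contMDiffOn_iff_contDiffOn]
  exact (contMDiffOn_chart (I := 𝓡 n) (n := ∞) (x := d)).comp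
    ((contMDiffOn_chart_symm (I := 𝓡 n) (n := ∞) (x := c)).mono inter_subset_left)
    fun u hu => hu.2

theorem differentiableAt_chartChange {c d : M} {u : EuclideanSpace ℝ (Fin n)}
    (hu : u ∈ chartOverlap n c d) : DifferentiableAt ℝ (chartChange c d) u :=
  ((contDiffOn_chartChange c d).contDiffAt
    ((isOpen_chartOverlap c d).mem_nhds hu)).differentiableAt (by simp)

theorem contDiffOn_coordMap {k : ℕ∞ω} (hk : k ≤ ∞)
    (hF : ContMDiff (𝓡 n) 𝓘(ℝ, EuclideanSpace ℝ (Fin (n + 1))) k F) (c : M) :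
    ContDiffOn ℝ k (coordMap F c) (chartAt (EuclideanSpace ℝ (Fin n)) c).target := by
  rw [← contMDiffOn_iff_contDiffOn]
  exact hF.comp_contMDiffOn ((contMDiffOn_chart_symm (I := 𝓡 n) (n := ∞) (x := c)).of_le hk)

theorem contDiffAt_coordMap {k : ℕ∞ω} (hk : k ≤ ∞)
    (hF : ContMDiff (𝓡 n) 𝓘(ℝ, EuclideanSpace ℝ (Fin (n + 1))) k F) {c : M}
    {u : EuclideanSpace ℝ (Fin n)} (hu : u ∈ (chartAt (EuclideanSpace ℝ (Fin n)) c).target) :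
    ContDiffAt ℝ k (coordMap F c) u :=
  (contDiffOn_coordMap hk hF c).contDiffAt
    ((chartAt (EuclideanSpace ℝ (Fin n)) c).open_target.mem_nhds hu)

theorem fderiv_coordMap_chartChange
    (hF : ContMDiff (𝓡 n) 𝓘(ℝ, EuclideanSpace ℝ (Fin (n + 1))) 2 F) {c d : M}
    {u : EuclideanSpace ℝ (Fin n)} (hu : u ∈ chartOverlap n c d) :
    fderiv ℝ (coordMap F c) u =
      (fderiv ℝ (coordMap F d) (chartChange c d u)).comp (fderiv ℝ (chartChange c d) u) := by
  have h1 : DifferentiableAt ℝ (coordMap F d) (chartChange c d u) :=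
    (contDiffAt_coordMap (by norm_cast) hF (chartChange_mem hu).1).differentiableAt
      (by norm_num)
  rw [← fderiv_comp u h1 (differentiableAt_chartChange hu)]
  refine Filter.EventuallyEq.fderiv_eq ?_
  filter_upwards [(isOpen_chartOverlap c d).mem_nhds hu] with v hv
  exact (coordMap_chartChange F hv).symm

/-- The transformation law of the area density under a change of charts. -/
theorem gramDet_chartChange
    (hF : ContMDiff (𝓡 n) 𝓘(ℝ, EuclideanSpace ℝ (Fin (n + 1))) 2 F) {c d : M}
    {u : EuclideanSpace ℝ (Fin n)} (hu : u ∈ chartOverlap n c d) :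
    √(gramDet (fderiv ℝ (coordMap F c) u)) =
      √(gramDet (fderiv ℝ (coordMap F d) (chartChange c d u))) *
        |(fderiv ℝ (chartChange c d) u).det| := by
  rw [fderiv_coordMap_chartChange hF hu, gramDet_comp, Real.sqrt_mul (gramDet_nonneg _),
    Real.sqrt_sq_eq_abs]

theorem mfderiv_comp_symm_chart
    (hF : ContMDiff (𝓡 n) 𝓘(ℝ, EuclideanSpace ℝ (Fin (n + 1))) 2 F) {c : M}
    {u : EuclideanSpace ℝ (Fin n)} (hu : u ∈ (chartAt (EuclideanSpace ℝ (Fin n)) c).target)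
    (v : EuclideanSpace ℝ (Fin n)) :
    fderiv ℝ (coordMap F c) u v =
      mfderiv (𝓡 n) 𝓘(ℝ, EuclideanSpace ℝ (Fin (n + 1))) F
        ((chartAt (EuclideanSpace ℝ (Fin n)) c).symm u)
        (mfderiv (𝓡 n) (𝓡 n) (chartAt (EuclideanSpace ℝ (Fin n)) c).symm u v) := by
  have h1 := (mdifferentiable_chart (I := 𝓡 n) c).mdifferentiableAt_symm hu
  have h2 : MDifferentiableAt (𝓡 n) 𝓘(ℝ, EuclideanSpace ℝ (Fin (n + 1))) F
      ((chartAt (EuclideanSpace ℝ (Fin n)) c).symm u) :=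
    hF.mdifferentiableAt (by norm_num)
  have h3 := mfderiv_comp u h2 h1
  rw [← mfderiv_eq_fderiv]
  exact congrArg (fun L => L v) h3

theorem IsEmbeddedHypersurface.injective_fderiv (hF : IsEmbeddedHypersurface 2 F) {c : M}
    {u : EuclideanSpace ℝ (Fin n)} (hu : u ∈ (chartAt (EuclideanSpace ℝ (Fin n)) c).target) :
    Function.Injective (fderiv ℝ (coordMap F c) u) := by
  have h := (hF.injective_mfderiv ((chartAt (EuclideanSpace ℝ (Fin n)) c).symm u)).comp
    ((mdifferentiable_chart (I := 𝓡 n) c).symm.mfderiv_injective hu)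
  intro v w hvw
  rw [mfderiv_comp_symm_chart hF.contMDiff hu, mfderiv_comp_symm_chart hF.contMDiff hu] at hvw
  exact h hvw

theorem IsOuterUnitNormal.inner_fderiv (hν : IsOuterUnitNormal F ν)
    (hF : IsEmbeddedHypersurface 2 F) {c : M}
    {u : EuclideanSpace ℝ (Fin n)} (hu : u ∈ (chartAt (EuclideanSpace ℝ (Fin n)) c).target)
    (v : EuclideanSpace ℝ (Fin n)) :
    inner ℝ (ν ((chartAt (EuclideanSpace ℝ (Fin n)) c).symm u)) (fderiv ℝ (coordMap F c) u v) = 0 := by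
  rw [mfderiv_comp_symm_chart hF.contMDiff hu]
  exact hν.orthogonal _ _

theorem continuousOn_gramDet
    (hF : ContMDiff (𝓡 n) 𝓘(ℝ, EuclideanSpace ℝ (Fin (n + 1))) 2 F) (c : M) :
    ContinuousOn (fun u => gramDet (fderiv ℝ (coordMap F c) u))
      (chartAt (EuclideanSpace ℝ (Fin n)) c).target := by
  refine (contDiff_gramDet (k := 0)).continuous.comp_continuousOn ?_
  exact (contDiffOn_coordMap (by norm_cast) hF c).continuousOn_fderiv_of_isOpen
    (chartAt (EuclideanSpace ℝ (Fin n)) c).open_target (by norm_num)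

end Charts

/-! ### The area measure in charts -/

section AreaMeasure

variable {n : ℕ} {M : Type*} [TopologicalSpace M] [ChartedSpace (EuclideanSpace ℝ (Fin n)) M]
  {F ν : M → EuclideanSpace ℝ (Fin (n + 1))}
  [IsManifold (𝓡 n) ∞ M] [T2Space M] [CompactSpace M]

theorem chartPartition_isSubordinate :
    (chartPartition n M).IsSubordinate fun x => (chartAt (EuclideanSpace ℝ (Fin n)) x).source :=
  Classical.choose_spec (SmoothPartitionOfUnity.exists_isSubordinate_chartAt_source (𝓡 n) M)

theorem finite_chartPartition : {c : M | Function.support (chartPartition n M c) ≠ ∅}.Finite := by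
  have h := (chartPartition n M).locallyFinite.finite_nonempty_of_compact
  refine h.subset fun c hc => ?_
  exact nonempty_iff_ne_empty.2 hc

/-- The finitely many charts which contribute to `chartPartition`. -/
def activeCharts (n : ℕ) (M : Type*) [TopologicalSpace M]
    [ChartedSpace (EuclideanSpace ℝ (Fin n)) M] [IsManifold (𝓡 n) ∞ M] [T2Space M]
    [CompactSpace M] : Finset M :=
  (finite_chartPartition (n := n) (M := M)).toFinset

theorem chartPartition_eq_zero {c : M} (hc : c ∉ activeCharts n M) (x : M) :
    chartPartition n M c x = 0 := by
  by_contra h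
  exact hc ((Set.Finite.mem_toFinset _).2 (nonempty_iff_ne_empty.1 ⟨x, h⟩))

theorem sum_chartPartition (x : M) : ∑ c ∈ activeCharts n M, chartPartition n M c x = 1 := by
  rw [← (chartPartition n M).sum_eq_one (mem_univ x)]
  refine (finsum_eq_sum_of_support_subset _ fun c hc => ?_).symm
  by_contra h
  exact hc (chartPartition_eq_zero h x)

/-- The density of `dμ` in the chart at `c`, weighted by the partition function of this chart. -/
def chartDensity (F : M → EuclideanSpace ℝ (Fin (n + 1))) (c : M)
    (u : EuclideanSpace ℝ (Fin n)) : ℝ :=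
  chartPartition n M c ((chartAt (EuclideanSpace ℝ (Fin n)) c).symm u) *
    √(gramDet (fderiv ℝ (coordMap F c) u))

theorem chartDensity_nonneg (F : M → EuclideanSpace ℝ (Fin (n + 1))) (c : M)
    (u : EuclideanSpace ℝ (Fin n)) : 0 ≤ chartDensity F c u :=
  mul_nonneg ((chartPartition n M).nonneg c _) (Real.sqrt_nonneg _)

theorem continuousOn_chartPartition_symm (c d : M) :
    ContinuousOn (fun u => chartPartition n M d ((chartAt (EuclideanSpace ℝ (Fin n)) c).symm u))
      (chartAt (EuclideanSpace ℝ (Fin n)) c).target :=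
  ((chartPartition n M d).contMDiff.continuous).comp_continuousOn
    (chartAt (EuclideanSpace ℝ (Fin n)) c).continuousOn_symm

theorem continuousOn_chartDensity
    (hF : ContMDiff (𝓡 n) 𝓘(ℝ, EuclideanSpace ℝ (Fin (n + 1))) 2 F) (c : M) :
    ContinuousOn (chartDensity F c) (chartAt (EuclideanSpace ℝ (Fin n)) c).target :=
  (continuousOn_chartPartition_symm c c).mul (continuousOn_gramDet hF c).sqrt

/-- The compact set of coordinates of the support of the partition function at `c`. -/
def chartSupport (n : ℕ) {M : Type*} [TopologicalSpace M]
    [ChartedSpace (EuclideanSpace ℝ (Fin n)) M] [IsManifold (𝓡 n) ∞ M] [T2Space M]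
    [CompactSpace M] (c : M) : Set (EuclideanSpace ℝ (Fin n)) :=
  chartAt (EuclideanSpace ℝ (Fin n)) c '' tsupport (chartPartition n M c)

theorem isCompact_chartSupport (c : M) : IsCompact (chartSupport n c) :=
  (isClosed_tsupport _).isCompact.image_of_continuousOn
    ((chartAt (EuclideanSpace ℝ (Fin n)) c).continuousOn.mono (chartPartition_isSubordinate c))

theorem chartSupport_subset (c : M) :
    chartSupport n c ⊆ (chartAt (EuclideanSpace ℝ (Fin n)) c).target := by
  rintro _ ⟨x, hx, rfl⟩
  exact (chartAt (EuclideanSpace ℝ (Fin n)) c).map_source (chartPartition_isSubordinate c hx)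

theorem chartPartition_symm_eq_zero {c : M} {u : EuclideanSpace ℝ (Fin n)}
    (hu : u ∈ (chartAt (EuclideanSpace ℝ (Fin n)) c).target) (hu' : u ∉ chartSupport n c) :
    chartPartition n M c ((chartAt (EuclideanSpace ℝ (Fin n)) c).symm u) = 0 := by
  by_contra h
  exact hu' ⟨_, subset_tsupport _ h, (chartAt (EuclideanSpace ℝ (Fin n)) c).right_inv hu⟩

theorem chartDensity_eq_zero {c : M} {u : EuclideanSpace ℝ (Fin n)}
    (hu : u ∈ (chartAt (EuclideanSpace ℝ (Fin n)) c).target) (hu' : u ∉ chartSupport n c) :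
    chartDensity F c u = 0 := by
  rw [chartDensity, chartPartition_symm_eq_zero hu hu', zero_mul]

variable [MeasurableSpace M]

/-- The part of the area measure which comes from the chart at `c`. -/
def chartMeasure (F : M → EuclideanSpace ℝ (Fin (n + 1))) (c : M) : Measure M :=
  ((volume.restrict (chartAt (EuclideanSpace ℝ (Fin n)) c).target).withDensity fun u =>
    ENNReal.ofReal (chartDensity F c u)).map (chartAt (EuclideanSpace ℝ (Fin n)) c).symm

theorem areaMeasure_eq_sum (F : M → EuclideanSpace ℝ (Fin (n + 1))) :
    areaMeasure F = ∑ c ∈ activeCharts n M, chartMeasure F c := by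
  have h0 : areaMeasure F = Measure.sum fun c : M => chartMeasure F c := rfl
  rw [h0]
  ext A hA
  rw [Measure.sum_apply _ hA, Measure.finsetSum_apply]
  refine tsum_eq_sum fun c hc => ?_
  have : (fun u => ENNReal.ofReal (chartDensity F c u)) = 0 := by
    funext u
    simp [chartDensity, chartPartition_eq_zero hc]
  rw [chartMeasure, this]
  simp

variable [BorelSpace M]

theorem aemeasurable_symm_chart (c : M) (f : EuclideanSpace ℝ (Fin n) → ENNReal) :
    AEMeasurable (chartAt (EuclideanSpace ℝ (Fin n)) c).symm
      ((volume.restrict (chartAt (EuclideanSpace ℝ (Fin n)) c).target).withDensity f) :=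
  ((chartAt (EuclideanSpace ℝ (Fin n)) c).continuousOn_symm.aemeasurable
    (chartAt (EuclideanSpace ℝ (Fin n)) c).open_target.measurableSet).mono_ac
    (withDensity_absolutelyContinuous _ _)

theorem integral_chartMeasure
    (hF : ContMDiff (𝓡 n) 𝓘(ℝ, EuclideanSpace ℝ (Fin (n + 1))) 2 F) (c : M) {k : M → ℝ}
    (hk : Continuous k) :
    ∫ x, k x ∂chartMeasure F c = ∫ u in (chartAt (EuclideanSpace ℝ (Fin n)) c).target,
      chartDensity F c u * k ((chartAt (EuclideanSpace ℝ (Fin n)) c).symm u) := by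
  have hm : AEMeasurable (fun u => ENNReal.ofReal (chartDensity F c u))
      (volume.restrict (chartAt (EuclideanSpace ℝ (Fin n)) c).target) :=
    ((continuousOn_chartDensity hF c).aemeasurable
      (chartAt (EuclideanSpace ℝ (Fin n)) c).open_target.measurableSet).ennreal_ofReal
  rw [chartMeasure, integral_map (aemeasurable_symm_chart c _) hk.aestronglyMeasurable,
    integral_withDensity_eq_integral_toReal_smul₀ hm (ae_of_all _ fun u => ENNReal.ofReal_lt_top)]
  refine integral_congr_ae (ae_of_all _ fun u => ?_)
  simp [ENNReal.toReal_ofReal (chartDensity_nonneg F c u)]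

theorem integrableOn_chartDensity_mul
    (hF : ContMDiff (𝓡 n) 𝓘(ℝ, EuclideanSpace ℝ (Fin (n + 1))) 2 F) (c : M)
    {k : EuclideanSpace ℝ (Fin n) → ℝ}
    (hk : ContinuousOn k (chartAt (EuclideanSpace ℝ (Fin n)) c).target) :
    IntegrableOn (fun u => chartDensity F c u * k u)
      (chartAt (EuclideanSpace ℝ (Fin n)) c).target := by
  have h1 : IntegrableOn (fun u => chartDensity F c u * k u) (chartSupport n c) :=
    (((continuousOn_chartDensity hF c).mul hk).mono (chartSupport_subset c)).integrableOn_compact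
      (isCompact_chartSupport c)
  refine h1.of_forall_sdiff_eq_zero
    (chartAt (EuclideanSpace ℝ (Fin n)) c).open_target.measurableSet fun u hu => ?_
  rw [chartDensity_eq_zero hu.1 hu.2, zero_mul]

theorem isFiniteMeasure_chartMeasure
    (hF : ContMDiff (𝓡 n) 𝓘(ℝ, EuclideanSpace ℝ (Fin (n + 1))) 2 F) (c : M) :
    IsFiniteMeasure (chartMeasure F c) := by
  have h := integrableOn_chartDensity_mul hF c (k := fun _ => 1) continuousOn_const
  simp only [mul_one] at h
  have h2 := isFiniteMeasure_withDensity_ofReal h.2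
  rw [chartMeasure]
  infer_instance

theorem isFiniteMeasure_areaMeasure
    (hF : ContMDiff (𝓡 n) 𝓘(ℝ, EuclideanSpace ℝ (Fin (n + 1))) 2 F) :
    IsFiniteMeasure (areaMeasure F) := by
  have := fun c => isFiniteMeasure_chartMeasure hF c
  rw [areaMeasure_eq_sum]
  infer_instance

theorem integrable_areaMeasure
    (hF : ContMDiff (𝓡 n) 𝓘(ℝ, EuclideanSpace ℝ (Fin (n + 1))) 2 F) {k : M → ℝ}
    (hk : Continuous k) : Integrable k (areaMeasure F) := by
  have := isFiniteMeasure_areaMeasure hF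
  obtain ⟨C, hC⟩ := isCompact_univ.exists_bound_of_continuousOn hk.continuousOn
  exact Integrable.of_bound hk.aestronglyMeasurable C (ae_of_all _ fun x => hC x (mem_univ x))

/-- Integration against the area measure is a finite sum of integrals over charts. In contrast to
`areaMeasure`, whose definition sums over all points of `M`, only the active charts occur. -/
theorem integral_areaMeasure
    (hF : ContMDiff (𝓡 n) 𝓘(ℝ, EuclideanSpace ℝ (Fin (n + 1))) 2 F) {k : M → ℝ}
    (hk : Continuous k) :
    ∫ x, k x ∂areaMeasure F = ∑ c ∈ activeCharts n M,
      ∫ u in (chartAt (EuclideanSpace ℝ (Fin n)) c).target,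
        chartDensity F c u * k ((chartAt (EuclideanSpace ℝ (Fin n)) c).symm u) := by
  have := fun c => isFiniteMeasure_chartMeasure hF c
  rw [areaMeasure_eq_sum, integral_finsetSum_measure]
  · exact Finset.sum_congr rfl fun c _ => integral_chartMeasure hF c hk
  · intro c _
    obtain ⟨C, hC⟩ := isCompact_univ.exists_bound_of_continuousOn hk.continuousOn
    exact Integrable.of_bound hk.aestronglyMeasurable C (ae_of_all _ fun x => hC x (mem_univ x))

end AreaMeasure

/-! ### Independence of the partition of unity -/

section AreaMeasureInChart

variable {n : ℕ} {M : Type*} [TopologicalSpace M] [ChartedSpace (EuclideanSpace ℝ (Fin n)) M]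
  {F ν : M → EuclideanSpace ℝ (Fin (n + 1))}
  [IsManifold (𝓡 n) ∞ M] [T2Space M] [CompactSpace M] [MeasurableSpace M] [BorelSpace M]

theorem image_chartChange (c d : M) :
    chartChange c d '' chartOverlap n c d = chartOverlap n d c := by
  refine Subset.antisymm (image_subset_iff.2 fun u hu => chartChange_mem hu) fun u hu => ?_
  exact ⟨chartChange d c u, chartChange_mem hu, chartChange_chartChange hu⟩

/-- Integrals of functions supported in the domain of a chart may be computed in this chart. -/
theorem integral_areaMeasure_of_support_subset
    (hF : ContMDiff (𝓡 n) 𝓘(ℝ, EuclideanSpace ℝ (Fin (n + 1))) 2 F) (d : M) {k : M → ℝ}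
    (hk : Continuous k) (hsupp : tsupport k ⊆ (chartAt (EuclideanSpace ℝ (Fin n)) d).source) :
    ∫ x, k x ∂areaMeasure F = ∫ u in (chartAt (EuclideanSpace ℝ (Fin n)) d).target,
      √(gramDet (fderiv ℝ (coordMap F d) u)) *
        k ((chartAt (EuclideanSpace ℝ (Fin n)) d).symm u) := by
  set G : M → EuclideanSpace ℝ (Fin n) → ℝ := fun c u =>
    chartPartition n M c ((chartAt (EuclideanSpace ℝ (Fin n)) d).symm u) *
      (√(gramDet (fderiv ℝ (coordMap F d) u)) *
        k ((chartAt (EuclideanSpace ℝ (Fin n)) d).symm u)) with hG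
  have hkd : ContinuousOn (fun u => k ((chartAt (EuclideanSpace ℝ (Fin n)) d).symm u))
      (chartAt (EuclideanSpace ℝ (Fin n)) d).target :=
    hk.comp_continuousOn (chartAt (EuclideanSpace ℝ (Fin n)) d).continuousOn_symm
  have hGint : ∀ c, IntegrableOn (G c) (chartAt (EuclideanSpace ℝ (Fin n)) d).target := by
    intro c
    set K := chartAt (EuclideanSpace ℝ (Fin n)) d '' tsupport k with hK
    have hKc : IsCompact K := (isClosed_tsupport _).isCompact.image_of_continuousOn
      ((chartAt (EuclideanSpace ℝ (Fin n)) d).continuousOn.mono hsupp)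
    have hKs : K ⊆ (chartAt (EuclideanSpace ℝ (Fin n)) d).target := by
      rintro _ ⟨x, hx, rfl⟩
      exact (chartAt (EuclideanSpace ℝ (Fin n)) d).map_source (hsupp hx)
    have h1 : IntegrableOn (G c) K :=
      (((continuousOn_chartPartition_symm d c).mul
        ((continuousOn_gramDet hF d).sqrt.mul hkd)).mono hKs).integrableOn_compact hKc
    refine h1.of_forall_sdiff_eq_zero
      (chartAt (EuclideanSpace ℝ (Fin n)) d).open_target.measurableSet fun u hu => ?_
    have : k ((chartAt (EuclideanSpace ℝ (Fin n)) d).symm u) = 0 := by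
      by_contra h
      exact hu.2 ⟨_, subset_tsupport _ h, (chartAt (EuclideanSpace ℝ (Fin n)) d).right_inv hu.1⟩
    simp [hG, this]
  have hterm : ∀ c, ∫ u in (chartAt (EuclideanSpace ℝ (Fin n)) c).target,
        chartDensity F c u * k ((chartAt (EuclideanSpace ℝ (Fin n)) c).symm u) =
      ∫ u in (chartAt (EuclideanSpace ℝ (Fin n)) d).target, G c u := by
    intro c
    have hm := (isOpen_chartOverlap (n := n) c d).measurableSet
    have e1 : ∫ u in (chartAt (EuclideanSpace ℝ (Fin n)) c).target,
        chartDensity F c u * k ((chartAt (EuclideanSpace ℝ (Fin n)) c).symm u) =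
        ∫ u in chartOverlap n c d,
          chartDensity F c u * k ((chartAt (EuclideanSpace ℝ (Fin n)) c).symm u) := by
      refine setIntegral_eq_of_subset_of_forall_sdiff_eq_zero
        (chartAt (EuclideanSpace ℝ (Fin n)) c).open_target.measurableSet inter_subset_left
        fun u hu => ?_
      have : k ((chartAt (EuclideanSpace ℝ (Fin n)) c).symm u) = 0 := by
        by_contra h
        exact hu.2 ⟨hu.1, hsupp (subset_tsupport _ h)⟩
      rw [this, mul_zero]
    have e2 : ∫ u in (chartAt (EuclideanSpace ℝ (Fin n)) d).target, G c u =
        ∫ u in chartOverlap n d c, G c u := by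
      refine setIntegral_eq_of_subset_of_forall_sdiff_eq_zero
        (chartAt (EuclideanSpace ℝ (Fin n)) d).open_target.measurableSet inter_subset_left
        fun u hu => ?_
      have : chartPartition n M c ((chartAt (EuclideanSpace ℝ (Fin n)) d).symm u) = 0 := by
        by_contra h
        exact hu.2 ⟨hu.1, chartPartition_isSubordinate c (subset_tsupport _ h)⟩
      simp [hG, this]
    rw [e1, e2, ← image_chartChange c d, integral_image_eq_integral_abs_det_fderiv_smul volume hm
      (fun u hu => (differentiableAt_chartChange hu).hasFDerivAt.hasFDerivWithinAt)
      (chartChange_injOn c d)]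
    refine setIntegral_congr_fun hm fun u hu => ?_
    simp only [hG, chartDensity, symm_chartChange hu, gramDet_chartChange hF hu, smul_eq_mul]
    ring
  rw [integral_areaMeasure hF hk, Finset.sum_congr rfl fun c _ => hterm c,
    ← integral_finsetSum _ fun c _ => hGint c]
  refine integral_congr_ae (ae_of_all _ fun u => ?_)
  simp only [hG]
  rw [← Finset.sum_mul, sum_chartPartition, one_mul]

end AreaMeasureInChart

/-! ### The enclosed region -/

section EnclosedRegion

variable {n : ℕ} {M : Type*} [TopologicalSpace M] {F ν : M → EuclideanSpace ℝ (Fin (n + 1))}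

theorem mem_enclosedRegion_iff {p : EuclideanSpace ℝ (Fin (n + 1))} : p ∈ enclosedRegion F ↔
    Bornology.IsBounded (connectedComponentIn (range F)ᶜ p) := Iff.rfl

theorem range_subset_enclosedRegion : range F ⊆ enclosedRegion F := by
  intro p hp
  have : connectedComponentIn (range F)ᶜ p = ∅ := connectedComponentIn_eq_empty (by simpa using hp)
  simp [mem_enclosedRegion_iff, this]

/-- A connected set which does not meet the hypersurface lies inside or outside of it. -/
theorem mem_enclosedRegion_iff_of_isPreconnected {S : Set (EuclideanSpace ℝ (Fin (n + 1)))}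
    (hS : IsPreconnected S) (hSF : S ⊆ (range F)ᶜ) {p q : EuclideanSpace ℝ (Fin (n + 1))}
    (hp : p ∈ S) (hq : q ∈ S) : p ∈ enclosedRegion F ↔ q ∈ enclosedRegion F := by
  have : connectedComponentIn (range F)ᶜ p = connectedComponentIn (range F)ᶜ q :=
    connectedComponentIn_eq (hS.subset_connectedComponentIn hp hSF hq)
  simp only [mem_enclosedRegion_iff, this]

theorem isClosed_enclosedRegion (hF : IsClosed (range F)) : IsClosed (enclosedRegion F) := by
  rw [← isOpen_compl_iff, isOpen_iff_mem_nhds]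
  intro p hp
  have hpF : p ∈ (range F)ᶜ := fun h => hp (range_subset_enclosedRegion h)
  obtain ⟨ε, hε, hball⟩ := Metric.isOpen_iff.1 hF.isOpen_compl p hpF
  filter_upwards [Metric.ball_mem_nhds p hε] with q hq
  exact fun h => hp ((mem_enclosedRegion_iff_of_isPreconnected
    (convex_ball p ε).isPreconnected hball (Metric.mem_ball_self hε) hq).2 h)

theorem isBounded_enclosedRegion (hF : Bornology.IsBounded (range F)) :
    Bornology.IsBounded (enclosedRegion F) := by
  obtain ⟨R, hR, hFR⟩ := hF.subset_closedBall_lt 0 0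
  refine Metric.isBounded_closedBall (x := 0) (r := R) |>.subset fun p hp => ?_
  by_contra hpR
  have hpR : R < ‖p‖ := by simpa using hpR
  -- the points `s p`, `s ≥ 1`, form an unbounded connected set outside of the hypersurface
  have hsub : (fun s : ℝ => s • p) '' Ici 1 ⊆ connectedComponentIn (range F)ᶜ p := by
    refine ((isPreconnected_Ici.image _ (by fun_prop))).subset_connectedComponentIn
      ⟨1, self_mem_Ici, one_smul _ _⟩ ?_
    rintro _ ⟨s, hs, rfl⟩ hsF
    have h1 := hFR hsF
    simp only [mem_closedBall_zero_iff, norm_smul, Real.norm_eq_abs] at h1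
    have hs' : (1 : ℝ) ≤ s := hs
    rw [abs_of_nonneg (by linarith)] at h1
    nlinarith
  obtain ⟨C, hC⟩ := ((mem_enclosedRegion_iff.1 hp).subset hsub).exists_norm_le
  have hp0 : 0 < ‖p‖ := hR.trans hpR
  have h2 := hC _ ⟨max 1 ((C + 1) / ‖p‖), mem_Ici.2 (le_max_left _ _), rfl⟩
  simp only [norm_smul, Real.norm_eq_abs] at h2
  have h3 : (C + 1) / ‖p‖ ≤ |max 1 ((C + 1) / ‖p‖)| := (le_max_right _ _).trans (le_abs_self _)
  have h4 : (C + 1) / ‖p‖ * ‖p‖ = C + 1 := div_mul_cancel₀ _ hp0.ne'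
  nlinarith [mul_le_mul_of_nonneg_right h3 hp0.le]

/-- The enclosed region is carried along by homeomorphisms of the ambient space. -/
theorem image_enclosedRegion
    (Θ : EuclideanSpace ℝ (Fin (n + 1)) ≃ₜ EuclideanSpace ℝ (Fin (n + 1)))
    (F' : M → EuclideanSpace ℝ (Fin (n + 1))) (hΘ : ∀ x, Θ (F x) = F' x)
    (hb : ∀ s, Bornology.IsBounded (Θ '' s) ↔ Bornology.IsBounded s) :
    Θ '' enclosedRegion F = enclosedRegion F' := by
  have hrange : Θ '' (range F)ᶜ = (range F')ᶜ := by
    rw [image_compl_eq Θ.bijective, ← range_comp]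
    congr 2
    funext x
    exact hΘ x
  have key : ∀ p, Θ p ∈ enclosedRegion F' ↔ p ∈ enclosedRegion F := by
    intro p
    by_cases hp : p ∈ range F
    · obtain ⟨x, rfl⟩ := hp
      exact iff_of_true (range_subset_enclosedRegion ⟨x, (hΘ x).symm⟩)
        (range_subset_enclosedRegion ⟨x, rfl⟩)
    · have := Θ.image_connectedComponentIn (s := (range F)ᶜ) hp
      simp only [mem_enclosedRegion_iff]
      rw [← hrange, ← this, hb]
  ext q
  constructor
  · rintro ⟨p, hp, rfl⟩
    exact (key p).2 hp
  · intro hq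
    exact ⟨Θ.symm q, (key _).1 (by simpa using hq), by simp⟩

end EnclosedRegion

/-! ### Straightening the hypersurface along a transversal direction -/

section Straightening

variable {n : ℕ} {M : Type*} [TopologicalSpace M] [ChartedSpace (EuclideanSpace ℝ (Fin n)) M]
  {F ν : M → EuclideanSpace ℝ (Fin (n + 1))}

/-- The map `(r, u) ↦ r e + F(u)` in the preferred chart at `c`, which straightens the hypersurface
if the direction `e` is transversal to it. -/
def transversalMap (F : M → EuclideanSpace ℝ (Fin (n + 1))) (c : M)
    (e : EuclideanSpace ℝ (Fin (n + 1))) (q : ℝ × EuclideanSpace ℝ (Fin n)) :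
    EuclideanSpace ℝ (Fin (n + 1)) :=
  q.1 • e + coordMap F c q.2

variable [IsManifold (𝓡 n) ∞ M]

theorem hasStrictFDerivAt_transversalMap (hF : IsEmbeddedHypersurface 2 F) (c : M)
    (e : EuclideanSpace ℝ (Fin (n + 1))) {q : ℝ × EuclideanSpace ℝ (Fin n)}
    (hq : q.2 ∈ (chartAt (EuclideanSpace ℝ (Fin n)) c).target) :
    HasStrictFDerivAt (transversalMap F c e)
      ((ContinuousLinearMap.toSpanSingleton ℝ e).coprod (fderiv ℝ (coordMap F c) q.2)) q := by
  have h1 : HasStrictFDerivAt (coordMap F c) (fderiv ℝ (coordMap F c) q.2) q.2 :=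
    (contDiffAt_coordMap (by norm_cast) hF.contMDiff hq).hasStrictFDerivAt (by norm_num)
  have h2 : HasStrictFDerivAt (fun q : ℝ × EuclideanSpace ℝ (Fin n) => coordMap F c q.2)
      ((fderiv ℝ (coordMap F c) q.2).comp (ContinuousLinearMap.snd ℝ _ _)) q :=
    h1.comp q hasStrictFDerivAt_snd
  have h3 : HasStrictFDerivAt (fun q : ℝ × EuclideanSpace ℝ (Fin n) => q.1 • e)
      ((ContinuousLinearMap.toSpanSingleton ℝ e).comp (ContinuousLinearMap.fst ℝ _ _)) q :=
    ((ContinuousLinearMap.toSpanSingleton ℝ e).comp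
      (ContinuousLinearMap.fst ℝ ℝ (EuclideanSpace ℝ (Fin n)))).hasStrictFDerivAt
  refine HasStrictFDerivAt.congr_fderiv (f := transversalMap F c e) (h3.add h2) ?_
  ext <;> simp

/-- The differential of `transversalMap` is invertible for a transversal direction. -/
theorem exists_equiv_transversal (A : EuclideanSpace ℝ (Fin n) →L[ℝ] EuclideanSpace ℝ (Fin (n + 1)))
    (hA : Function.Injective A) (e w : EuclideanSpace ℝ (Fin (n + 1))) (he : inner ℝ w e ≠ 0)
    (hort : ∀ v, inner ℝ w (A v) = 0) :
    ∃ D : (ℝ × EuclideanSpace ℝ (Fin n)) ≃L[ℝ] EuclideanSpace ℝ (Fin (n + 1)),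
      (D : ℝ × EuclideanSpace ℝ (Fin n) →L[ℝ] EuclideanSpace ℝ (Fin (n + 1))) =
        (ContinuousLinearMap.toSpanSingleton ℝ e).coprod A := by
  set D0 := (ContinuousLinearMap.toSpanSingleton ℝ e).coprod A with hD0
  have hinj : Function.Injective D0 := by
    rw [injective_iff_map_eq_zero]
    rintro ⟨r, v⟩ h
    have h' : r • e + A v = 0 := by simpa [hD0] using h
    have h1 : r * inner ℝ w e = 0 := by
      have := congrArg (fun z => inner ℝ w z) h'
      simpa [inner_add_right, inner_smul_right, hort] using this
    have hr : r = 0 := by simpa [he] using h1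
    subst hr
    have hv : v = 0 := (injective_iff_map_eq_zero A).1 hA v (by simpa using h')
    simp [hv]
  refine ⟨(LinearEquiv.ofInjectiveOfFinrankEq (D0 : ℝ × EuclideanSpace ℝ (Fin n) →ₗ[ℝ] _) hinj
    (by simp [add_comm])).toContinuousLinearEquiv, ?_⟩
  ext q
  · rfl
  · rfl

/-- A box around a point of the hypersurface in which the enclosed region is the set `r ≤ 0` of the
coordinates `(r, u) ↦ r e + F(u)`. The half boxes `r < 0` and `r > 0` are connected and do not meet
the hypersurface, so each lies inside or outside; which of the two is decided by one point of the
normal line at `F(c)`, because the outer normal crosses from `r < 0` to `r > 0`. Embeddedness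
enters through the last property: no other part of the hypersurface meets the box. -/
theorem exists_straightening_box (hF : IsEmbeddedHypersurface 2 F) (hν : IsOuterUnitNormal F ν)
    (c : M) {e : EuclideanSpace ℝ (Fin (n + 1))} (he : 0 < inner ℝ (ν c) e) :
    ∃ ε > 0,
      Metric.closedBall (chartAt (EuclideanSpace ℝ (Fin n)) c c) ε ⊆
        (chartAt (EuclideanSpace ℝ (Fin n)) c).target ∧
      (∀ u ∈ Metric.closedBall (chartAt (EuclideanSpace ℝ (Fin n)) c c) ε,
        0 < inner ℝ (ν ((chartAt (EuclideanSpace ℝ (Fin n)) c).symm u)) e) ∧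
      InjOn (transversalMap F c e)
        (Icc (-ε) ε ×ˢ Metric.ball (chartAt (EuclideanSpace ℝ (Fin n)) c c) ε) ∧
      IsOpen (transversalMap F c e ''
        (Ioo (-ε) ε ×ˢ Metric.ball (chartAt (EuclideanSpace ℝ (Fin n)) c c) ε)) ∧
      (∀ q ∈ Ioo (-ε) ε ×ˢ Metric.ball (chartAt (EuclideanSpace ℝ (Fin n)) c c) ε,
        (transversalMap F c e q ∈ enclosedRegion F ↔ q.1 ≤ 0)) ∧
      (∀ x, F x ∈ transversalMap F c e ''
          (Ioo (-ε) ε ×ˢ Metric.ball (chartAt (EuclideanSpace ℝ (Fin n)) c c) ε) →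
        x ∈ (chartAt (EuclideanSpace ℝ (Fin n)) c).source ∧
        chartAt (EuclideanSpace ℝ (Fin n)) c x ∈
          Metric.ball (chartAt (EuclideanSpace ℝ (Fin n)) c c) ε) := by
  set χ := chartAt (EuclideanSpace ℝ (Fin n)) c with hχ
  set u₀ := χ c with hu₀
  set Ψ := transversalMap F c e with hΨ
  have hcs : c ∈ χ.source := mem_chart_source _ c
  have hut : u₀ ∈ χ.target := χ.map_source hcs
  have hsymm : χ.symm u₀ = c := χ.left_inv hcs
  have hort : ∀ v, inner ℝ (ν c) (fderiv ℝ (coordMap F c) u₀ v) = 0 := fun v => by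
    have := hν.inner_fderiv hF hut v
    rwa [hsymm] at this
  obtain ⟨D, hD⟩ := exists_equiv_transversal (fderiv ℝ (coordMap F c) u₀)
    (hF.injective_fderiv hut) e (ν c) he.ne' hort
  have hstrict : HasStrictFDerivAt Ψ
      (D : ℝ × EuclideanSpace ℝ (Fin n) →L[ℝ] EuclideanSpace ℝ (Fin (n + 1))) (0, u₀) := by
    rw [hD]
    exact hasStrictFDerivAt_transversalMap hF c e (q := (0, u₀)) hut
  set Φ := hstrict.toOpenPartialHomeomorph Ψ with hΦ
  have hΦcoe : ∀ q, Φ q = Ψ q := fun q => rfl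
  have hΦsrc : (0, u₀) ∈ Φ.source := hstrict.mem_toOpenPartialHomeomorph_source
  have hΨ0 : Ψ (0, u₀) = F c := by
    simp only [hΨ, transversalMap, coordMap, zero_smul, zero_add]
    rw [← hχ, hsymm]
  -- First choice of the size, which makes the map injective and the direction transversal
  have hnear : ∀ᶠ q : ℝ × EuclideanSpace ℝ (Fin n) in 𝓝 (0, u₀),
      q ∈ Φ.source ∧ q.2 ∈ χ.target ∧ 0 < inner ℝ (ν (χ.symm q.2)) e := by
    have h2 : ∀ᶠ u in 𝓝 u₀, u ∈ χ.target := χ.open_target.mem_nhds hut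
    have h3 : ∀ᶠ u in 𝓝 u₀, 0 < inner ℝ (ν (χ.symm u)) e := by
      have hc : ContinuousAt (fun u => inner ℝ (ν (χ.symm u)) e) u₀ :=
        ((hν.continuous.continuousAt.comp (χ.continuousAt_symm hut))).inner continuousAt_const
      refine hc.eventually (lt_mem_nhds ?_)
      simp only [hsymm]
      exact he
    filter_upwards [Φ.open_source.mem_nhds hΦsrc, continuousAt_snd.eventually h2,
      continuousAt_snd.eventually h3] with q hq1 hq2 hq3
    exact ⟨hq1, hq2, hq3⟩
  obtain ⟨δ, hδ, hball⟩ := Metric.eventually_nhds_iff_ball.1 hnear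
  have hball' : ∀ r u, |r| < δ → dist u u₀ < δ →
      (r, u) ∈ Φ.source ∧ u ∈ χ.target ∧ 0 < inner ℝ (ν (χ.symm u)) e := by
    intro r u hr hu
    refine hball (r, u) ?_
    rw [Metric.mem_ball, Prod.dist_eq, max_lt_iff, Real.dist_eq]
    simpa using ⟨hr, hu⟩
  -- Second choice, such that only points of the chart domain are mapped into the box
  have hpre : {x | x ∈ χ.source ∧ dist (χ x) u₀ < δ} ∈ 𝓝 c := by
    refine inter_mem (χ.open_source.mem_nhds hcs) ?_
    exact (χ.continuousAt hcs).preimage_mem_nhds (Metric.ball_mem_nhds u₀ hδ)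
  rw [hF.isEmbedding.nhds_eq_comap, mem_comap] at hpre
  obtain ⟨N, hN, hNsub⟩ := hpre
  have hΨN : ∀ᶠ q : ℝ × EuclideanSpace ℝ (Fin n) in 𝓝 (0, u₀), Ψ q ∈ N := by
    have := hstrict.continuousAt
    rw [ContinuousAt, hΨ0] at this
    exact this.eventually hN
  obtain ⟨δ', hδ', hball2⟩ := Metric.eventually_nhds_iff_ball.1 hΨN
  set ε := min δ δ' / 2 with hε
  have hεpos : 0 < ε := by positivity
  have hεδ : ε < δ := by
    have := min_le_left δ δ'
    rw [hε]; linarith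
  have hεδ' : ε < δ' := by
    have := min_le_right δ δ'
    rw [hε]; linarith
  have hsrc : ∀ q ∈ Icc (-ε) ε ×ˢ Metric.ball u₀ ε, q ∈ Φ.source := by
    rintro ⟨r, u⟩ ⟨hr, hu⟩
    exact (hball' r u ((abs_le.2 hr).trans_lt hεδ) (lt_trans hu hεδ)).1
  have hsub : Ioo (-ε) ε ×ˢ Metric.ball u₀ ε ⊆ Icc (-ε) ε ×ˢ Metric.ball u₀ ε :=
    prod_mono Ioo_subset_Icc_self Subset.rfl
  have hinj : InjOn Ψ (Icc (-ε) ε ×ˢ Metric.ball u₀ ε) := Φ.injOn.mono hsrc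
  have hopen : IsOpen (Ψ '' (Ioo (-ε) ε ×ˢ Metric.ball u₀ ε)) :=
    Φ.isOpen_image_of_subset_source (isOpen_Ioo.prod Metric.isOpen_ball)
      fun q hq => hsrc q (hsub hq)
  have hΨF : ∀ x ∈ χ.source, Ψ (0, χ x) = F x := by
    intro x hx
    simp only [hΨ, transversalMap, coordMap, zero_smul, zero_add]
    rw [← hχ, χ.left_inv hx]
  have hpreimage : ∀ x, ∀ q ∈ Ioo (-ε) ε ×ˢ Metric.ball u₀ ε, F x = Ψ q →
      x ∈ χ.source ∧ q = (0, χ x) := by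
    rintro x ⟨r, u⟩ hq hx
    have hxN : F x ∈ N := by
      rw [hx]
      refine hball2 _ ?_
      rw [Metric.mem_ball, Prod.dist_eq, max_lt_iff, Real.dist_eq]
      have h1 : |r| ≤ ε := abs_le.2 ⟨hq.1.1.le, hq.1.2.le⟩
      have h2 : dist u u₀ < ε := hq.2
      exact ⟨by simpa using h1.trans_lt hεδ', h2.trans hεδ'⟩
    obtain ⟨hxs, hxd⟩ := hNsub hxN
    refine ⟨hxs, ?_⟩
    have h3 : (0, χ x) ∈ Φ.source := (hball' 0 (χ x) (by simpa using hδ) hxd).1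
    exact Φ.injOn (hsrc _ (hsub hq)) h3 (by rw [hΦcoe, hΦcoe, hΨF x hxs, hx])
  have hcontΨ : ContinuousOn Ψ (Ioo (-ε) ε ×ˢ Metric.ball u₀ ε) :=
    Φ.continuousOn.mono fun q hq => hsrc q (hsub hq)
  have hsidePlus : ∀ q ∈ Ioo 0 ε ×ˢ Metric.ball u₀ ε, ∀ q' ∈ Ioo 0 ε ×ˢ Metric.ball u₀ ε,
      (Ψ q ∈ enclosedRegion F ↔ Ψ q' ∈ enclosedRegion F) := by
    intro q hq q' hq'
    have hss : Ioo 0 ε ×ˢ Metric.ball u₀ ε ⊆ Ioo (-ε) ε ×ˢ Metric.ball u₀ ε :=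
      prod_mono (Ioo_subset_Ioo_left (by linarith)) Subset.rfl
    refine mem_enclosedRegion_iff_of_isPreconnected
      ((isPreconnected_Ioo.prod (convex_ball u₀ ε).isPreconnected).image Ψ (hcontΨ.mono hss)) ?_
      (mem_image_of_mem Ψ hq) (mem_image_of_mem Ψ hq')
    rintro _ ⟨z, hz, rfl⟩ ⟨x, hx⟩
    have := (hpreimage x z (hss hz) hx).2
    rw [this] at hz
    exact lt_irrefl _ hz.1.1
  have hsideMinus : ∀ q ∈ Ioo (-ε) 0 ×ˢ Metric.ball u₀ ε, ∀ q' ∈ Ioo (-ε) 0 ×ˢ Metric.ball u₀ ε,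
      (Ψ q ∈ enclosedRegion F ↔ Ψ q' ∈ enclosedRegion F) := by
    intro q hq q' hq'
    have hss : Ioo (-ε) 0 ×ˢ Metric.ball u₀ ε ⊆ Ioo (-ε) ε ×ˢ Metric.ball u₀ ε :=
      prod_mono (Ioo_subset_Ioo_right (by linarith)) Subset.rfl
    refine mem_enclosedRegion_iff_of_isPreconnected
      ((isPreconnected_Ioo.prod (convex_ball u₀ ε).isPreconnected).image Ψ (hcontΨ.mono hss)) ?_
      (mem_image_of_mem Ψ hq) (mem_image_of_mem Ψ hq')
    rintro _ ⟨z, hz, rfl⟩ ⟨x, hx⟩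
    have := (hpreimage x z (hss hz) hx).2
    rw [this] at hz
    exact lt_irrefl _ hz.1.2
  -- The curve `s ↦ F(c) + s ν(c)` crosses the hypersurface from `r < 0` to `r > 0`
  set γ : ℝ → ℝ × EuclideanSpace ℝ (Fin n) :=
    fun s => hstrict.localInverse Ψ D (0, u₀) (F c + s • ν c) with hγ
  have hline : HasDerivAt (fun s : ℝ => F c + s • ν c) (ν c) 0 := by
    simpa using ((hasDerivAt_id (0 : ℝ)).smul_const (ν c)).const_add (F c)
  have hγ0 : γ 0 = (0, u₀) := by
    have := hstrict.localInverse_apply_image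
    rw [hΨ0] at this
    simpa [hγ] using this
  have hγder : HasDerivAt γ (D.symm (ν c)) 0 := by
    have h1 := hstrict.to_localInverse.hasFDerivAt
    have h2 : Ψ (0, u₀) = F c + (0 : ℝ) • ν c := by rw [hΨ0, zero_smul, add_zero]
    rw [h2] at h1
    exact h1.comp_hasDerivAt (f := fun s : ℝ => F c + s • ν c) 0 hline
  have hdpos : 0 < (D.symm (ν c)).1 := by
    have h1 : D (D.symm (ν c)) = ν c := D.apply_symm_apply _
    have h2 : (D.symm (ν c)).1 • e + fderiv ℝ (coordMap F c) u₀ (D.symm (ν c)).2 = ν c := by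
      rw [← ContinuousLinearEquiv.coe_coe, hD] at h1
      simpa using h1
    have h3 := congrArg (fun z => inner ℝ (ν c) z) h2
    simp only [inner_add_right, inner_smul_right, hort, add_zero, real_inner_self_eq_norm_sq,
      hν.norm_eq_one, one_pow] at h3
    by_contra hcon
    have := mul_nonpos_of_nonpos_of_nonneg (not_lt.1 hcon) he.le
    linarith
  have hγ1 : HasDerivAt (fun s => (γ s).1) (D.symm (ν c)).1 0 := by
    have := (ContinuousLinearMap.fst ℝ ℝ (EuclideanSpace ℝ (Fin n))).hasFDerivAt.comp_hasDerivAt 0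
      hγder
    exact this
  have hγc : ContinuousAt γ 0 := hγder.continuousAt
  have hboxnhds : Ioo (-ε) ε ×ˢ Metric.ball u₀ ε ∈ 𝓝 (γ 0) := by
    rw [hγ0]
    exact prod_mem_nhds (Ioo_mem_nhds (by linarith) hεpos) (Metric.ball_mem_nhds u₀ hεpos)
  have hev1 : ∀ᶠ s in 𝓝 (0 : ℝ), γ s ∈ Ioo (-ε) ε ×ˢ Metric.ball u₀ ε := hγc hboxnhds
  have hev2 : ∀ᶠ s in 𝓝 (0 : ℝ), Ψ (γ s) = F c + s • ν c := by
    have h1 := hstrict.eventually_right_inverse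
    rw [hΨ0] at h1
    have h2 : Tendsto (fun s : ℝ => F c + s • ν c) (𝓝 0) (𝓝 (F c)) := by
      have := hline.continuousAt
      rw [ContinuousAt] at this
      simpa using this
    exact h2.eventually h1
  have hslope := hasDerivAt_iff_tendsto_slope.1 hγ1
  have hev3 : ∀ᶠ s in 𝓝[≠] (0 : ℝ), 0 < slope (fun s => (γ s).1) 0 s :=
    hslope.eventually (lt_mem_nhds hdpos)
  have hneg : Tendsto (fun s : ℝ => -s) (𝓝[>] 0) (𝓝[≠] 0) := by
    refine tendsto_nhdsWithin_iff.2 ⟨?_, ?_⟩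
    · have : Tendsto (fun s : ℝ => -s) (𝓝 0) (𝓝 (-0)) := continuous_neg.tendsto 0
      rw [neg_zero] at this
      exact this.mono_left nhdsWithin_le_nhds
    · filter_upwards [self_mem_nhdsWithin] with s hs
      have hs' : (0 : ℝ) < s := hs
      exact fun h => by simp at h; linarith
  have hpos : (𝓝[>] (0 : ℝ)) ≤ 𝓝[≠] 0 := nhdsWithin_mono _ fun s hs => ne_of_gt hs
  have hevP : ∀ᶠ s in 𝓝[>] (0 : ℝ), (γ s ∈ Ioo 0 ε ×ˢ Metric.ball u₀ ε) ∧
      Ψ (γ s) ∉ enclosedRegion F := by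
    filter_upwards [nhdsWithin_le_nhds hev1, nhdsWithin_le_nhds hev2, hpos hev3,
      hν.outward c, self_mem_nhdsWithin] with s h1 h2 h3 h4 h5
    have h5' : (0 : ℝ) < s := h5
    refine ⟨⟨⟨?_, h1.1.2⟩, h1.2⟩, by rw [h2]; exact h4.1⟩
    rw [slope_def_field, hγ0] at h3
    simpa using (div_pos_iff_of_pos_right (by linarith)).1 h3
  have hevM : ∀ᶠ s in 𝓝[>] (0 : ℝ), (γ (-s) ∈ Ioo (-ε) 0 ×ˢ Metric.ball u₀ ε) ∧
      Ψ (γ (-s)) ∈ enclosedRegion F := by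
    filter_upwards [hneg.eventually (nhdsWithin_le_nhds hev1),
      hneg.eventually (nhdsWithin_le_nhds hev2), hneg.eventually hev3,
      hν.outward c, self_mem_nhdsWithin] with s h1 h2 h3 h4 h5
    have h5' : (0 : ℝ) < s := h5
    refine ⟨⟨⟨h1.1.1, ?_⟩, h1.2⟩, ?_⟩
    · rw [slope_def_field, hγ0] at h3
      have h6 : (-s - 0 : ℝ) < 0 := by linarith
      have := (div_pos_iff.1 h3)
      rcases this with h | h
      · linarith [h.2]
      · simpa using h.1
    · rw [h2, neg_smul, ← sub_eq_add_neg]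
      exact h4.2
  obtain ⟨sP, hsP, hsP'⟩ := hevP.exists
  obtain ⟨sM, hsM, hsM'⟩ := hevM.exists
  refine ⟨ε, hεpos, ?_, ?_, hinj, hopen, ?_, ?_⟩
  · intro u hu
    exact (hball' 0 u (by simpa using hδ) ((Metric.mem_closedBall.1 hu).trans_lt hεδ)).2.1
  · intro u hu
    exact (hball' 0 u (by simpa using hδ) ((Metric.mem_closedBall.1 hu).trans_lt hεδ)).2.2
  · rintro ⟨r, u⟩ ⟨hr, hu⟩
    rcases lt_trichotomy r 0 with h | h | h
    · exact iff_of_true ((hsideMinus _ ⟨⟨hr.1, h⟩, hu⟩ _ hsM).2 hsM') h.le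
    · refine iff_of_true (range_subset_enclosedRegion ?_) h.le
      refine ⟨χ.symm u, ?_⟩
      simp only [hΨ, transversalMap, coordMap, h, zero_smul, zero_add, hχ]
    · exact iff_of_false (fun hm => hsP' ((hsidePlus _ ⟨⟨h, hr.2⟩, hu⟩ _ hsP).1 hm)) (not_le.2 h)
  · rintro x ⟨q, hq, hqx⟩
    obtain ⟨hxs, rfl⟩ := hpreimage x q hq hqx.symm
    exact ⟨hxs, hq.2⟩

end Straightening

/-! ### The divergence theorem near the hypersurface -/

section LocalFlux

variable {n : ℕ} {M : Type*} [TopologicalSpace M] [ChartedSpace (EuclideanSpace ℝ (Fin n)) M]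
  {F ν : M → EuclideanSpace ℝ (Fin (n + 1))}
  [IsManifold (𝓡 n) ∞ M] [T2Space M] [CompactSpace M] [MeasurableSpace M] [BorelSpace M]

/-- The fundamental theorem of calculus for a Lipschitz function on a segment, in terms of line
derivatives. -/
theorem integral_lineDeriv_segment {E : Type*} [NormedAddCommGroup E] [NormedSpace ℝ E]
    {g : E → ℝ} {K : NNReal} (hg : LipschitzWith K g) (p e : E) (a b : ℝ) :
    ∫ r in a..b, lineDeriv ℝ g (r • e + p) e = g (b • e + p) - g (a • e + p) := by
  have hlip : LipschitzWith (K * ‖e‖₊) fun r : ℝ => g (r • e + p) := by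
    refine hg.comp (LipschitzWith.of_dist_le_mul fun r s => ?_)
    rw [dist_add_right, dist_eq_norm, ← sub_smul, norm_smul, mul_comm, dist_eq_norm, coe_nnnorm]
  have h := (hlip.lipschitzOnWith (s := uIcc a b)).absolutelyContinuousOnInterval.integral_deriv_eq_sub
  rw [← h]
  refine intervalIntegral.integral_congr fun r _ => ?_
  have h2 : (fun t : ℝ => g (r • e + p + t • e)) = fun t : ℝ => (fun s : ℝ => g (s • e + p)) (r + t) := by
    funext t
    simp only
    congr 1
    rw [add_smul]
    abel
  simp only [lineDeriv]
  rw [h2, deriv_comp_const_add (f := fun s : ℝ => g (s • e + p)), add_zero]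

theorem lineDeriv_eq_zero_of_notMem_tsupport {E : Type*} [NormedAddCommGroup E] [NormedSpace ℝ E]
    {g : E → ℝ} {p : E} (hp : p ∉ tsupport g) (e : E) : lineDeriv ℝ g p e = 0 := by
  have h : g =ᶠ[𝓝 p] fun _ => 0 := notMem_tsupport_iff_eventuallyEq.1 hp
  rw [h.lineDeriv_eq]
  simp [lineDeriv]

/-- Near a point of the hypersurface, the divergence theorem holds in transversal directions. In the
coordinates `(r, u) ↦ r e + F(u)` the derivative along `e` is `∂/∂r` and the Jacobian does not
depend on `r`, so that the integral in `r` is the fundamental theorem of calculus. Only `C²` charts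
and Lipschitz functions are needed. -/
theorem exists_nhds_integral_lineDeriv_of_transversal (hF : IsEmbeddedHypersurface 2 F)
    (hν : IsOuterUnitNormal F ν) (c : M) {e : EuclideanSpace ℝ (Fin (n + 1))}
    (he : 0 < inner ℝ (ν c) e) :
    ∃ U ∈ 𝓝 (F c), ∀ (g : EuclideanSpace ℝ (Fin (n + 1)) → ℝ) (K : NNReal), LipschitzWith K g →
      tsupport g ⊆ U →
      ∫ p in enclosedRegion F, lineDeriv ℝ g p e =
        ∫ x, g (F x) * inner ℝ (ν x) e ∂areaMeasure F := by
  obtain ⟨ε, hε, htarget, hpos, hinj, hopen, hside, hpre⟩ :=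
    exists_straightening_box hF hν c he
  set χ := chartAt (EuclideanSpace ℝ (Fin n)) c with hχ
  set u₀ := χ c with hu₀
  set Ψ := transversalMap F c e with hΨ
  set B := Metric.ball u₀ ε with hB
  set O := Ψ '' (Ioo (-ε) ε ×ˢ B) with hO
  have hBt : B ⊆ χ.target := Metric.ball_subset_closedBall.trans htarget
  have hu₀B : u₀ ∈ B := Metric.mem_ball_self hε
  have hFc : F c ∈ O := by
    refine ⟨(0, u₀), ⟨⟨by linarith, hε⟩, hu₀B⟩, ?_⟩
    simp only [hΨ, transversalMap, coordMap, zero_smul, zero_add]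
    rw [← hχ, χ.left_inv (mem_chart_source _ c)]
  refine ⟨O, hopen.mem_nhds hFc, fun g K hg hgO => ?_⟩
  have hgcont : Continuous g := hg.continuous
  set J : EuclideanSpace ℝ (Fin n) → ℝ := fun u =>
    √(gramDet (fderiv ℝ (coordMap F c) u)) * inner ℝ (ν (χ.symm u)) e with hJ
  have hJcont : ContinuousOn J (Metric.closedBall u₀ ε) := by
    refine ((continuousOn_gramDet hF.contMDiff c).mono htarget).sqrt.mul (ContinuousOn.inner ?_
      continuousOn_const)
    exact hν.continuous.comp_continuousOn (χ.continuousOn_symm.mono htarget)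
  have hsubOI : Ioc (-ε) 0 ×ˢ B ⊆ Ioo (-ε) ε ×ˢ B :=
    prod_mono (fun r hr => ⟨hr.1, hr.2.trans_lt hε⟩) Subset.rfl
  have hsubOC : Ioc (-ε) 0 ×ˢ B ⊆ Icc (-ε) ε ×ˢ B :=
    hsubOI.trans (prod_mono Ioo_subset_Icc_self Subset.rfl)
  set S : Set (ℝ × EuclideanSpace ℝ (Fin n)) := Ioc (-ε) 0 ×ˢ B with hS
  have hSm : MeasurableSet S := measurableSet_Ioc.prod Metric.isOpen_ball.measurableSet
  -- The part of the region in the box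
  have himage : enclosedRegion F ∩ O = Ψ '' S := by
    ext p
    constructor
    · rintro ⟨hp, q, hq, rfl⟩
      exact ⟨q, ⟨⟨hq.1.1, (hside q hq).1 hp⟩, hq.2⟩, rfl⟩
    · rintro ⟨q, hq, rfl⟩
      exact ⟨(hside q (hsubOI hq)).2 hq.1.2, mem_image_of_mem _ (hsubOI hq)⟩
  have hcl : IsClosed (range F) := (isCompact_range hF.isEmbedding.continuous).isClosed
  have step1 : ∫ p in enclosedRegion F, lineDeriv ℝ g p e = ∫ p in Ψ '' S, lineDeriv ℝ g p e := by
    rw [← himage]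
    refine setIntegral_eq_of_subset_of_forall_sdiff_eq_zero
      (isClosed_enclosedRegion hcl).measurableSet inter_subset_left fun p hp => ?_
    refine lineDeriv_eq_zero_of_notMem_tsupport (fun h => hp.2 ⟨hp.1, hgO h⟩) e
  -- Change of variables
  set S' : Set (EuclideanSpace ℝ (Fin (n + 1))) := splitCoord n ⁻¹' S with hS'
  have hS'm : MeasurableSet S' := (splitCoord n).continuous.measurable hSm
  have himage' : Ψ '' S = (fun p => Ψ (splitCoord n p)) '' S' := by
    rw [hS', ← Function.comp_def, image_comp, image_preimage_eq _ (splitCoord n).surjective]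
  have hder : ∀ p ∈ S', HasFDerivWithinAt (fun p => Ψ (splitCoord n p))
      (((ContinuousLinearMap.toSpanSingleton ℝ e).coprod
        (fderiv ℝ (coordMap F c) (splitCoord n p).2)).comp
      (splitCoord n : EuclideanSpace ℝ (Fin (n + 1)) →L[ℝ] ℝ × EuclideanSpace ℝ (Fin n))) S' p := by
    intro p hp
    have h1 := (hasStrictFDerivAt_transversalMap hF c e (hBt hp.2)).hasFDerivAt
    exact (h1.comp p (splitCoord n).hasFDerivAt).hasFDerivWithinAt
  have hinj' : InjOn (fun p => Ψ (splitCoord n p)) S' := by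
    intro p hp q hq hpq
    exact (splitCoord n).injective (hinj (hsubOC hp) (hsubOC hq) hpq)
  have hdet : ∀ p ∈ S', |(((ContinuousLinearMap.toSpanSingleton ℝ e).coprod
        (fderiv ℝ (coordMap F c) (splitCoord n p).2)).comp
      (splitCoord n : EuclideanSpace ℝ (Fin (n + 1)) →L[ℝ] ℝ × EuclideanSpace ℝ (Fin n))).det| =
      J (splitCoord n p).2 := by
    intro p hp
    rw [abs_det_transversal _ (hF.injective_fderiv (hBt hp.2)) e (ν (χ.symm (splitCoord n p).2))
      (hν.norm_eq_one _) (hν.inner_fderiv hF (hBt hp.2)), hJ, real_inner_comm,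
      abs_of_pos (hpos _ (Metric.ball_subset_closedBall hp.2))]
  have step2 : ∫ p in Ψ '' S, lineDeriv ℝ g p e =
      ∫ q in S, J q.2 * lineDeriv ℝ g (Ψ q) e := by
    rw [himage', integral_image_eq_integral_abs_det_fderiv_smul volume hS'm hder hinj',
      ← measurePreserving_splitCoord.setIntegral_preimage_emb
        (splitCoord n).toHomeomorph.measurableEmbedding]
    refine setIntegral_congr_fun hS'm fun p hp => ?_
    simp only [smul_eq_mul, hdet p hp]
  -- Fubini and the one-dimensional fundamental theorem of calculus
  have hSfin : volume S ≠ ⊤ := by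
    rw [hS, Measure.volume_eq_prod, Measure.prod_prod]
    exact ENNReal.mul_ne_top (by simp) (Metric.isBounded_ball.measure_lt_top).ne
  have hint : IntegrableOn (fun q : ℝ × EuclideanSpace ℝ (Fin n) =>
      J q.2 * lineDeriv ℝ g (Ψ q) e) S := by
    obtain ⟨C, hC⟩ := (isCompact_closedBall u₀ ε).exists_bound_of_continuousOn hJcont
    have hC0 : 0 ≤ C := (norm_nonneg _).trans (hC u₀ (Metric.mem_closedBall_self hε.le))
    have hΨc : ContinuousOn Ψ S := fun q hq =>
      (hasStrictFDerivAt_transversalMap hF c e (hBt hq.2)).continuousAt.continuousWithinAt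
    have hm1 : AEStronglyMeasurable (fun q : ℝ × EuclideanSpace ℝ (Fin n) =>
        lineDeriv ℝ g (Ψ q) e) (volume.restrict S) :=
      ((measurable_lineDeriv hgcont).comp_aemeasurable
        (hΨc.aemeasurable hSm)).aestronglyMeasurable
    have hm2 : AEStronglyMeasurable (fun q : ℝ × EuclideanSpace ℝ (Fin n) => J q.2)
        (volume.restrict S) :=
      (hJcont.comp continuousOn_snd fun q hq =>
        Metric.ball_subset_closedBall hq.2).aestronglyMeasurable hSm
    refine IntegrableOn.of_bound hSfin.lt_top (hm2.mul hm1) (C * (K * ‖e‖)) ?_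
    filter_upwards [ae_restrict_mem hSm] with q hq
    rw [norm_mul]
    exact mul_le_mul (hC _ (Metric.ball_subset_closedBall hq.2))
      (norm_lineDeriv_le_of_lipschitz ℝ hg) (norm_nonneg _) hC0
  have step3 : ∫ q in S, J q.2 * lineDeriv ℝ g (Ψ q) e = ∫ u in B, J u * g (coordMap F c u) := by
    have hrestr : (volume.restrict S : Measure (ℝ × EuclideanSpace ℝ (Fin n))) =
        (volume.restrict (Ioc (-ε) 0)).prod (volume.restrict B) := by
      rw [hS, Measure.volume_eq_prod, Measure.prod_restrict]
    rw [IntegrableOn, hrestr] at hint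
    rw [hrestr, integral_prod_symm _ hint]
    refine setIntegral_congr_fun Metric.isOpen_ball.measurableSet fun u hu => ?_
    simp only
    rw [integral_const_mul, ← intervalIntegral.integral_of_le (by linarith)]
    congr 1
    have h1 := integral_lineDeriv_segment hg (coordMap F c u) e (-ε) 0
    have h2 : g ((-ε) • e + coordMap F c u) = 0 := by
      by_contra h
      obtain ⟨q, hq, hq'⟩ := hgO (subset_tsupport _ h)
      have h3 : q = (-ε, u) := hinj ⟨Ioo_subset_Icc_self hq.1, hq.2⟩
        ⟨⟨le_rfl, by linarith⟩, hu⟩ hq'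
      rw [h3] at hq
      exact lt_irrefl _ hq.1.1
    rw [h2, sub_zero, zero_smul, zero_add] at h1
    exact h1
  -- The boundary integral
  have hkcont : Continuous fun x => g (F x) * inner ℝ (ν x) e :=
    (hgcont.comp hF.isEmbedding.continuous).mul (hν.continuous.inner continuous_const)
  have hksupp : tsupport (fun x => g (F x) * inner ℝ (ν x) e) ⊆ χ.source := by
    have h1 : tsupport (fun x => g (F x) * inner ℝ (ν x) e) ⊆ F ⁻¹' tsupport g := by
      refine closure_minimal (fun x hx => ?_)
        ((isClosed_tsupport g).preimage hF.isEmbedding.continuous)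
      exact subset_tsupport _ (left_ne_zero_of_mul hx)
    exact fun x hx => (hpre x (hgO (h1 hx))).1
  rw [step1, step2, step3, integral_areaMeasure_of_support_subset hF.contMDiff c hkcont hksupp]
  symm
  have h0 : ∀ u, √(gramDet (fderiv ℝ (coordMap F c) u)) *
      (g (F (χ.symm u)) * inner ℝ (ν (χ.symm u)) e) = J u * g (coordMap F c u) := by
    intro u
    simp only [hJ, coordMap, ← hχ]
    ring
  simp only [← hχ, h0]
  refine setIntegral_eq_of_subset_of_forall_sdiff_eq_zero χ.open_target.measurableSet hBt
    fun u hu => ?_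
  have : g (coordMap F c u) = 0 := by
    by_contra h
    have h1 := (hpre (χ.symm u) (hgO (subset_tsupport _ h))).2
    rw [χ.right_inv hu.1] at h1
    exact hu.2 h1
  rw [this, mul_zero]

theorem enclosedRegion_mem_nhds (hF : IsClosed (range F)) {p : EuclideanSpace ℝ (Fin (n + 1))}
    (hp : p ∈ enclosedRegion F) (hpF : p ∉ range F) : enclosedRegion F ∈ 𝓝 p := by
  obtain ⟨ε, hε, hball⟩ := Metric.isOpen_iff.1 hF.isOpen_compl p hpF
  filter_upwards [Metric.ball_mem_nhds p hε] with q hq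
  exact (mem_enclosedRegion_iff_of_isPreconnected
    (convex_ball p ε).isPreconnected hball (Metric.mem_ball_self hε) hq).1 hp

/-- A hypersurface encloses a set of positive volume. -/
theorem enclosedVolume_pos [Nonempty M] (hF : IsEmbeddedHypersurface 2 F)
    (hν : IsOuterUnitNormal F ν) : 0 < enclosedVolume F := by
  obtain ⟨c⟩ := ‹Nonempty M›
  have hcpt := isCompact_range hF.isEmbedding.continuous
  have he : 0 < inner ℝ (ν c) (ν c) := by
    rw [real_inner_self_eq_norm_sq, hν.norm_eq_one]; norm_num
  obtain ⟨ε, hε, htarget, -, hinj, -, hside, hpre⟩ := exists_straightening_box hF hν c he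
  set χ := chartAt (EuclideanSpace ℝ (Fin n)) c with hχ
  have hmem : ((-(ε / 2), χ c) : ℝ × EuclideanSpace ℝ (Fin n)) ∈
      Ioo (-ε) ε ×ˢ Metric.ball (χ c) ε :=
    ⟨⟨by simp only; linarith, by simp only; linarith⟩, Metric.mem_ball_self hε⟩
  have hp := (hside _ hmem).2 (by simp only; linarith)
  have hpF : transversalMap F c (ν c) (-(ε / 2), χ c) ∉ range F := by
    rintro ⟨x, hx⟩
    have hx' := hpre x (hx ▸ mem_image_of_mem _ hmem)
    have h0 : ((0, χ x) : ℝ × EuclideanSpace ℝ (Fin n)) ∈ Icc (-ε) ε ×ˢ Metric.ball (χ c) ε :=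
      ⟨⟨by simp only; linarith, hε.le⟩, hx'.2⟩
    have h1 : transversalMap F c (ν c) (0, χ x) = F x := by
      simp only [transversalMap, coordMap, zero_smul, zero_add]
      rw [← hχ, χ.left_inv hx'.1]
    have h2 := congrArg Prod.fst
      (hinj h0 (prod_mono Ioo_subset_Icc_self Subset.rfl hmem) (h1.trans hx))
    simp only at h2
    linarith
  have hpos := Measure.measure_pos_of_mem_nhds volume (enclosedRegion_mem_nhds hcpt.isClosed hp hpF)
  exact ENNReal.toReal_pos hpos.ne' (isBounded_enclosedRegion hcpt.isBounded).measure_lt_top.ne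

end LocalFlux

/-! ### Line derivatives of Lipschitz functions -/

section Lipschitz

variable {E : Type*} [NormedAddCommGroup E] [NormedSpace ℝ E] [FiniteDimensional ℝ E]

/-- The product of a `C¹` function and a Lipschitz function is Lipschitz if it has compact support. -/
theorem exists_lipschitzWith_mul_of_hasCompactSupport {f g : E → ℝ} {K : NNReal}
    (hf : ContDiff ℝ 1 f) (hg : LipschitzWith K g) (hfg : HasCompactSupport fun x => f x * g x) :
    ∃ L, LipschitzWith L fun x => f x * g x := by
  have : ProperSpace E := FiniteDimensional.proper ℝ E
  obtain ⟨R, hR, hsub⟩ := hfg.isCompact.isBounded.subset_closedBall_lt 0 0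
  have hcpt := isCompact_closedBall (0 : E) (R + 1)
  obtain ⟨A, hA⟩ := hcpt.exists_bound_of_continuousOn hf.continuous.continuousOn
  obtain ⟨B, hB⟩ := hcpt.exists_bound_of_continuousOn hg.continuous.continuousOn
  obtain ⟨D, hD⟩ := hcpt.exists_bound_of_continuousOn
    (hf.continuous_fderiv (by norm_num)).continuousOn
  obtain ⟨m, hm⟩ := hfg.exists_bound_of_continuous (hf.continuous.mul hg.continuous)
  have h0 : (0 : E) ∈ Metric.closedBall (0 : E) (R + 1) := Metric.mem_closedBall_self (by linarith)
  have hA0 := (norm_nonneg _).trans (hA 0 h0)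
  have hB0 := (norm_nonneg _).trans (hB 0 h0)
  have hD0 := (norm_nonneg _).trans (hD 0 h0)
  have hm0 := (norm_nonneg _).trans (hm 0)
  have hfar : ∀ x y, y ∉ Metric.closedBall (0 : E) (R + 1) →
      |f x * g x - f y * g y| ≤ m * dist x y := by
    intro x y hy
    have hy0 : f y * g y = 0 := by
      by_contra h
      exact hy (Metric.closedBall_subset_closedBall (by linarith) (hsub (subset_tsupport _ h)))
    rw [hy0, sub_zero]
    by_cases hx : x ∈ Metric.closedBall (0 : E) R
    · have h1 : 1 ≤ dist x y := by
        have h2 : R + 1 < dist y 0 := by simpa using hy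
        have h3 : dist x 0 ≤ R := hx
        have := dist_triangle_left y 0 x
        linarith
      calc |f x * g x| ≤ m * 1 := by rw [mul_one]; exact hm x
        _ ≤ m * dist x y := by gcongr
    · have hx0 : f x * g x = 0 := by
        by_contra h
        exact hx (hsub (subset_tsupport _ h))
      rw [hx0, abs_zero]
      positivity
  refine ⟨Real.toNNReal (A * K + B * D + m), LipschitzWith.of_dist_le_mul fun x y => ?_⟩
  rw [Real.coe_toNNReal _ (by positivity), Real.dist_eq]
  have hAK : 0 ≤ A * K := by positivity
  have hBD : 0 ≤ B * D := by positivity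
  have hd : 0 ≤ dist x y := dist_nonneg
  by_cases hy : y ∈ Metric.closedBall (0 : E) (R + 1)
  · by_cases hx : x ∈ Metric.closedBall (0 : E) (R + 1)
    · have h1 : |g x - g y| ≤ K * dist x y := hg.dist_le_mul x y
      have h2 : |f x - f y| ≤ D * dist x y := by
        rw [dist_eq_norm]
        exact (convex_closedBall (0 : E) (R + 1)).norm_image_sub_le_of_norm_fderiv_le (𝕜 := ℝ)
          (fun z _ => hf.differentiable (by norm_num) z) hD hy hx
      have h3 : f x * g x - f y * g y = f x * (g x - g y) + g y * (f x - f y) := by ring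
      calc |f x * g x - f y * g y| ≤ |f x| * |g x - g y| + |g y| * |f x - f y| := by
            rw [h3, ← abs_mul, ← abs_mul]
            exact abs_add_le _ _
        _ ≤ A * (K * dist x y) + B * (D * dist x y) := by
            gcongr
            · exact hA x hx
            · exact hB y hy
        _ ≤ (A * K + B * D + m) * dist x y := by nlinarith
    · rw [abs_sub_comm]
      refine (hfar y x hx).trans ?_
      rw [dist_comm]
      gcongr
      linarith
  · refine (hfar x y hy).trans ?_
    gcongr
    linarith

variable [MeasurableSpace E] [BorelSpace E]

theorem ae_lineDeriv_sub {g : E → ℝ} {K : NNReal} (hg : LipschitzWith K g) (μ : Measure E)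
    [μ.IsAddHaarMeasure] (v w : E) :
    ∀ᵐ p ∂μ, lineDeriv ℝ g p (v - w) = lineDeriv ℝ g p v - lineDeriv ℝ g p w := by
  filter_upwards [hg.ae_differentiableAt (μ := μ)] with p hp
  rw [hp.lineDeriv_eq_fderiv, hp.lineDeriv_eq_fderiv, hp.lineDeriv_eq_fderiv, map_sub]

theorem integrableOn_lineDeriv {g : E → ℝ} {K : NNReal} (hg : LipschitzWith K g) (μ : Measure E)
    {S : Set E} (hS : μ S < ⊤) (v : E) : IntegrableOn (fun p => lineDeriv ℝ g p v) S μ := by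
  refine IntegrableOn.of_bound hS
    (measurable_lineDeriv hg.continuous).aestronglyMeasurable (K * ‖v‖) ?_
  exact ae_of_all _ fun p => norm_lineDeriv_le_of_lipschitz ℝ hg

theorem integral_lineDeriv_eq_zero {g : E → ℝ} {K : NNReal} (hg : LipschitzWith K g)
    (hc : HasCompactSupport g) (μ : Measure E) [μ.IsAddHaarMeasure] (v : E) :
    ∫ p, lineDeriv ℝ g p v ∂μ = 0 := by
  have h := (LipschitzWith.const (α := E) (1 : ℝ)).integral_lineDeriv_mul_eq (μ := μ) hg hc (-v)
  simp only [neg_neg, mul_one] at h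
  rw [← h]
  simp [lineDeriv]

end Lipschitz

/-! ### The divergence theorem for Lipschitz vector fields -/

section Divergence

variable {n : ℕ} {M : Type*} [TopologicalSpace M] [ChartedSpace (EuclideanSpace ℝ (Fin n)) M]
  {F ν : M → EuclideanSpace ℝ (Fin (n + 1))}
  [IsManifold (𝓡 n) ∞ M] [T2Space M] [CompactSpace M] [MeasurableSpace M] [BorelSpace M]

theorem volume_enclosedRegion_lt_top (hF : IsEmbeddedHypersurface 2 F) :
    volume (enclosedRegion F) < ⊤ :=
  (isBounded_enclosedRegion
    (isCompact_range hF.isEmbedding.continuous).isBounded).measure_lt_top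

theorem measurableSet_enclosedRegion (hF : IsEmbeddedHypersurface 2 F) :
    MeasurableSet (enclosedRegion F) :=
  (isClosed_enclosedRegion
    (isCompact_range hF.isEmbedding.continuous).isClosed).measurableSet

/-- The divergence theorem holds locally. At a point of the hypersurface an arbitrary direction is
the difference of two transversal ones; away from the hypersurface both sides vanish. -/
theorem exists_nhds_integral_lineDeriv (hF : IsEmbeddedHypersurface 2 F)
    (hν : IsOuterUnitNormal F ν) (v p : EuclideanSpace ℝ (Fin (n + 1))) :
    ∃ U ∈ 𝓝 p, ∀ (g : EuclideanSpace ℝ (Fin (n + 1)) → ℝ) (K : NNReal), LipschitzWith K g →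
      tsupport g ⊆ U →
      ∫ p in enclosedRegion F, lineDeriv ℝ g p v =
        ∫ x, g (F x) * inner ℝ (ν x) v ∂areaMeasure F := by
  have hcl : IsClosed (range F) := (isCompact_range hF.isEmbedding.continuous).isClosed
  by_cases hp : p ∈ range F
  · obtain ⟨c, rfl⟩ := hp
    -- Both `v + κ ν(c)` and `κ ν(c)` point outwards at `F(c)`.
    set κ : ℝ := 1 + |inner ℝ (ν c) v| with hκ
    have hκpos : 0 < κ := by positivity
    have h1 : 0 < inner ℝ (ν c) (v + κ • ν c) := by
      rw [inner_add_right, inner_smul_right, real_inner_self_eq_norm_sq, hν.norm_eq_one]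
      have := neg_abs_le (inner ℝ (ν c) v)
      linarith
    have h2 : 0 < inner ℝ (ν c) (κ • ν c) := by
      rw [inner_smul_right, real_inner_self_eq_norm_sq, hν.norm_eq_one]
      linarith
    obtain ⟨U₁, hU₁, H₁⟩ := exists_nhds_integral_lineDeriv_of_transversal hF hν c h1
    obtain ⟨U₂, hU₂, H₂⟩ := exists_nhds_integral_lineDeriv_of_transversal hF hν c h2
    refine ⟨U₁ ∩ U₂, inter_mem hU₁ hU₂, fun g K hg hU => ?_⟩
    have e1 := H₁ g K hg (hU.trans inter_subset_left)
    have e2 := H₂ g K hg (hU.trans inter_subset_right)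
    have hv : v = (v + κ • ν c) - κ • ν c := by abel
    have hcont : ∀ w, Continuous fun x => g (F x) * inner ℝ (ν x) w := fun w =>
      (hg.continuous.comp hF.isEmbedding.continuous).mul (hν.continuous.inner continuous_const)
    have hfin := volume_enclosedRegion_lt_top hF
    rw [integral_congr_ae (ae_restrict_of_ae (by
        have := ae_lineDeriv_sub hg volume (v + κ • ν c) (κ • ν c)
        rwa [← hv] at this)),
      integral_sub (integrableOn_lineDeriv hg volume hfin _)
        (integrableOn_lineDeriv hg volume hfin _), e1, e2,
      ← integral_sub (integrable_areaMeasure hF.contMDiff (hcont _))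
        (integrable_areaMeasure hF.contMDiff (hcont _))]
    refine integral_congr_ae (ae_of_all _ fun x => ?_)
    simp only
    rw [← mul_sub, ← inner_sub_right, ← hv]
  · obtain ⟨ε, hε, hball⟩ := Metric.isOpen_iff.1 hcl.isOpen_compl p hp
    refine ⟨Metric.ball p ε, Metric.ball_mem_nhds p hε, fun g K hg hU => ?_⟩
    have hcs : HasCompactSupport g :=
      Metric.isCompact_of_isClosed_isBounded (isClosed_tsupport g)
        (Metric.isBounded_ball.subset hU)
    have hgF : ∀ x, g (F x) = 0 := by
      intro x
      by_contra h
      exact hball (hU (subset_tsupport _ h)) ⟨x, rfl⟩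
    have hside : ∀ q ∈ Metric.ball p ε, (p ∈ enclosedRegion F ↔ q ∈ enclosedRegion F) :=
      fun q hq => mem_enclosedRegion_iff_of_isPreconnected (convex_ball p ε).isPreconnected hball
        (Metric.mem_ball_self hε) hq
    simp only [hgF, zero_mul, integral_zero]
    by_cases hpΩ : p ∈ enclosedRegion F
    · rw [← integral_lineDeriv_eq_zero hg hcs volume v]
      refine setIntegral_eq_integral_of_forall_compl_eq_zero fun q hq => ?_
      exact lineDeriv_eq_zero_of_notMem_tsupport
        (fun h => hq ((hside q (hU h)).1 hpΩ)) v
    · refine setIntegral_eq_zero_of_forall_eq_zero fun q hq => ?_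
      exact lineDeriv_eq_zero_of_notMem_tsupport
        (fun h => hpΩ ((hside q (hU h)).2 hq)) v

/-- The divergence theorem for the vector field `g v` with a constant vector `v`. -/
theorem integral_lineDeriv_enclosedRegion (hF : IsEmbeddedHypersurface 2 F)
    (hν : IsOuterUnitNormal F ν) (v : EuclideanSpace ℝ (Fin (n + 1)))
    {g : EuclideanSpace ℝ (Fin (n + 1)) → ℝ} {K : NNReal} (hg : LipschitzWith K g)
    (hc : HasCompactSupport g) :
    ∫ p in enclosedRegion F, lineDeriv ℝ g p v =
      ∫ x, g (F x) * inner ℝ (ν x) v ∂areaMeasure F := by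
  choose U hU H using exists_nhds_integral_lineDeriv hF hν v
  obtain ⟨ρ, hρ⟩ := SmoothPartitionOfUnity.exists_isSubordinate
    (𝓘(ℝ, EuclideanSpace ℝ (Fin (n + 1)))) (isClosed_tsupport g) (fun p => interior (U p))
    (fun p => isOpen_interior)
    (fun p _ => mem_iUnion.2 ⟨p, mem_interior_iff_mem_nhds.2 (hU p)⟩)
  have hfin := ρ.locallyFinite.finite_nonempty_inter_compact hc.isCompact
  set s := hfin.toFinset with hs
  have hzero : ∀ i ∉ s, ∀ p, ρ i p * g p = 0 := by
    intro i hi p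
    by_contra h
    exact hi (hfin.mem_toFinset.2 ⟨p, left_ne_zero_of_mul h,
      subset_tsupport _ (right_ne_zero_of_mul h)⟩)
  have hsum : ∀ p, g p = ∑ i ∈ s, ρ i p * g p := by
    intro p
    by_cases hgp : g p = 0
    · simp [hgp]
    · have h1 := ρ.sum_eq_one (subset_tsupport _ hgp)
      have h2 : ∑ᶠ i, ρ i p = ∑ i ∈ s, ρ i p := by
        refine finsum_eq_sum_of_support_subset _ fun i hi => ?_
        by_contra h
        exact mul_ne_zero hi hgp (hzero i h p)
      rw [← Finset.sum_mul, ← h2, h1, one_mul]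
  have hsupp : ∀ i, tsupport (fun p => ρ i p * g p) ⊆ U i := fun i =>
    (tsupport_mul_subset_left).trans ((hρ i).trans interior_subset)
  have hcs : ∀ i, HasCompactSupport fun p => ρ i p * g p := fun i => hc.mul_left
  have hlip : ∀ i, ∃ L, LipschitzWith L fun p => ρ i p * g p := fun i =>
    exists_lipschitzWith_mul_of_hasCompactSupport
      ((ρ i).contMDiff.contDiff.of_le (by norm_cast)) hg (hcs i)
  choose L hL using hlip
  have hder : ∀ᵐ p ∂(volume.restrict (enclosedRegion F)),
      lineDeriv ℝ g p v = ∑ i ∈ s, lineDeriv ℝ (fun p => ρ i p * g p) p v := by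
    refine ae_restrict_of_ae ?_
    have h1 : ∀ᵐ p, ∀ i ∈ s, DifferentiableAt ℝ (fun p => ρ i p * g p) p :=
      (ae_ball_iff s.countable_toSet).2 fun i _ => (hL i).ae_differentiableAt
    filter_upwards [h1] with p hp
    have h2 : HasFDerivAt g (∑ i ∈ s, fderiv ℝ (fun p => ρ i p * g p) p) p := by
      have h3 := HasFDerivAt.fun_sum fun i hi => (hp i hi).hasFDerivAt
      exact h3.congr_of_eventuallyEq (Eventually.of_forall hsum)
    rw [h2.differentiableAt.lineDeriv_eq_fderiv, h2.fderiv, sum_apply]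
    exact Finset.sum_congr rfl fun i hi => ((hp i hi).lineDeriv_eq_fderiv).symm
  rw [integral_congr_ae hder, integral_finsetSum _ fun i _ =>
    integrableOn_lineDeriv (hL i) volume (volume_enclosedRegion_lt_top hF) v,
    Finset.sum_congr rfl fun i _ => H i _ _ (hL i) (hsupp i), ← integral_finsetSum]
  · refine integral_congr_ae (ae_of_all _ fun x => ?_)
    simp only
    rw [← Finset.sum_mul, ← hsum]
  · intro i _
    exact integrable_areaMeasure hF.contMDiff
      (((hL i).continuous.comp hF.isEmbedding.continuous).mul
        (hν.continuous.inner continuous_const))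

/-- The divergence theorem for Lipschitz vector fields on the region enclosed by a hypersurface. -/
theorem integral_trace_fderiv_enclosedRegion (hF : IsEmbeddedHypersurface 2 F)
    (hν : IsOuterUnitNormal F ν)
    {X : EuclideanSpace ℝ (Fin (n + 1)) → EuclideanSpace ℝ (Fin (n + 1))} {K : NNReal}
    (hX : LipschitzWith K X) :
    ∫ p in enclosedRegion F, traceCLM (n + 1) (fderiv ℝ X p) =
      ∫ x, inner ℝ (X (F x)) (ν x) ∂areaMeasure F := by
  have hFb := (isCompact_range hF.isEmbedding.continuous).isBounded
  obtain ⟨R, hR, hΩ⟩ := (isBounded_enclosedRegion hFb).subset_closedBall_lt 0 0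
  -- A cut-off function which is `1` near the region
  let η : ContDiffBump (0 : EuclideanSpace ℝ (Fin (n + 1))) :=
    ⟨R + 1, R + 2, by linarith, by linarith⟩
  set X' : Fin (n + 1) → EuclideanSpace ℝ (Fin (n + 1)) → ℝ := fun a p => η p * X p a with hX'
  have hXa : ∀ a, LipschitzWith K fun p => X p a := fun a => by
    refine LipschitzWith.of_dist_le_mul fun p q => le_trans ?_ (hX.dist_le_mul p q)
    rw [dist_eq_norm, dist_eq_norm]
    exact PiLp.norm_apply_le (X p - X q) a
  have hcs : ∀ a, HasCompactSupport (X' a) := fun a => η.hasCompactSupport.mul_right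
  have hlip : ∀ a, ∃ L, LipschitzWith L (X' a) := fun a =>
    exists_lipschitzWith_mul_of_hasCompactSupport η.contDiff (hXa a) (hcs a)
  choose L hL using hlip
  have hnear : ∀ a, ∀ p ∈ enclosedRegion F, X' a =ᶠ[𝓝 p] fun q => X q a := by
    intro a p hp
    have h1 : Metric.closedBall (0 : EuclideanSpace ℝ (Fin (n + 1))) (R + 1) ∈ 𝓝 p := by
      refine mem_of_superset (Metric.ball_mem_nhds p one_pos) fun q hq => ?_
      have h2 : dist p 0 ≤ R := hΩ hp
      have h3 : dist q p < 1 := hq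
      exact (dist_triangle q p 0).trans (by linarith)
    filter_upwards [h1] with q hq
    simp only [hX']
    rw [η.one_of_mem_closedBall hq, one_mul]
  have hder : ∀ᵐ p ∂(volume.restrict (enclosedRegion F)),
      traceCLM (n + 1) (fderiv ℝ X p) =
      ∑ a, lineDeriv ℝ (X' a) p (EuclideanSpace.single a 1) := by
    filter_upwards [ae_restrict_of_ae hX.ae_differentiableAt,
      ae_restrict_mem (measurableSet_enclosedRegion hF)] with p hp hpΩ
    rw [traceCLM_apply]
    refine Finset.sum_congr rfl fun a _ => ?_
    have h1 : HasFDerivAt (fun q => X q a)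
        ((EuclideanSpace.proj a : EuclideanSpace ℝ (Fin (n + 1)) →L[ℝ] ℝ).comp (fderiv ℝ X p)) p :=
      (EuclideanSpace.proj a : EuclideanSpace ℝ (Fin (n + 1)) →L[ℝ] ℝ).hasFDerivAt.comp p
        hp.hasFDerivAt
    rw [(hnear a p hpΩ).lineDeriv_eq, h1.differentiableAt.lineDeriv_eq_fderiv, h1.fderiv]
    rfl
  rw [integral_congr_ae hder, integral_finsetSum _ fun a _ =>
    integrableOn_lineDeriv (hL a) volume (volume_enclosedRegion_lt_top hF) _,
    Finset.sum_congr rfl fun a _ => integral_lineDeriv_enclosedRegion hF hν _ (hL a) (hcs a),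
    ← integral_finsetSum]
  · refine integral_congr_ae (ae_of_all _ fun x => ?_)
    simp only
    rw [PiLp.inner_apply]
    refine Finset.sum_congr rfl fun a _ => ?_
    rw [(hnear a (F x) (range_subset_enclosedRegion ⟨x, rfl⟩)).eq_of_nhds]
    rw [EuclideanSpace.inner_single_right]
    simp [mul_comm]
  · intro a _
    exact integrable_areaMeasure hF.contMDiff
      (((hL a).continuous.comp hF.isEmbedding.continuous).mul
        (hν.continuous.inner continuous_const))

end Divergence

/-! ### One-sided differentiation under the integral sign -/

section ParametricIntegral

/-- Differentiation under the integral sign, for one-sided derivatives. -/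
theorem hasDerivWithinAt_integral_of_lipschitz {α : Type*} [MeasurableSpace α] {μ : Measure α}
    {f : ℝ → α → ℝ} {f' bound : α → ℝ} {I : Set ℝ} {t₀ : ℝ}
    (hmeas : ∀ᶠ t in 𝓝[I] t₀, AEStronglyMeasurable (f t) μ) (hint : Integrable (f t₀) μ)
    (hbound : Integrable bound μ)
    (hlip : ∀ᶠ t in 𝓝[I] t₀, ∀ᵐ a ∂μ, |f t a - f t₀ a| ≤ bound a * |t - t₀|)
    (hder : ∀ᵐ a ∂μ, HasDerivWithinAt (fun t => f t a) (f' a) I t₀) :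
    HasDerivWithinAt (fun t => ∫ a, f t a ∂μ) (∫ a, f' a ∂μ) I t₀ := by
  rw [hasDerivWithinAt_iff_tendsto_slope]
  have hle : 𝓝[I \ {t₀}] t₀ ≤ 𝓝[I] t₀ := nhdsWithin_mono _ sdiff_subset
  have hfint : ∀ᶠ t in 𝓝[I \ {t₀}] t₀, Integrable (f t) μ := by
    filter_upwards [hle hmeas, hle hlip] with t h1 h2
    have h3 : Integrable (fun a => f t a - f t₀ a) μ :=
      (hbound.mul_const |t - t₀|).mono' (h1.sub hint.1) h2
    refine (h3.add hint).congr (ae_of_all _ fun a => ?_)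
    simp
  have key : Tendsto (fun t => ∫ a, slope (fun s => f s a) t₀ t ∂μ) (𝓝[I \ {t₀}] t₀)
      (𝓝 (∫ a, f' a ∂μ)) := by
    refine tendsto_integral_filter_of_dominated_convergence bound ?_ ?_ hbound ?_
    · filter_upwards [hle hmeas] with t h1
      simp only [slope_def_field]
      simp only [div_eq_mul_inv]
      exact (h1.sub hint.1).mul_const _
    · filter_upwards [hle hlip, self_mem_nhdsWithin] with t h2 ht
      filter_upwards [h2] with a ha
      have hne : 0 < |t - t₀| := abs_pos.2 (sub_ne_zero.2 ht.2)
      rw [slope_def_field, Real.norm_eq_abs, abs_div, div_le_iff₀ hne]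
      exact ha
    · filter_upwards [hder] with a ha
      exact hasDerivWithinAt_iff_tendsto_slope.1 ha
  refine key.congr' ?_
  filter_upwards [hfint] with t ht
  simp only [slope_def_field]
  rw [integral_div, integral_sub ht hint]

end ParametricIntegral

/-! ### The first variation of the enclosed volume -/

section Deformation

/-- Lipschitz maps preserve null sets, as is seen from the Hausdorff measure. -/
theorem volume_image_eq_zero_of_lipschitzWith {m : ℕ}
    {Θ : EuclideanSpace ℝ (Fin m) → EuclideanSpace ℝ (Fin m)} {K : NNReal}
    (hΘ : LipschitzWith K Θ) {S : Set (EuclideanSpace ℝ (Fin m))} (hS : volume S = 0) :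
    volume (Θ '' S) = 0 := by
  set μ : Measure (EuclideanSpace ℝ (Fin m)) :=
    Measure.hausdorffMeasure (Module.finrank ℝ (EuclideanSpace ℝ (Fin m))) with hμ
  have h1 : μ S = 0 := Measure.absolutelyContinuous_isAddHaarMeasure μ volume hS
  have h2 : μ (Θ '' S) = 0 := by
    refine le_antisymm ((hΘ.hausdorffMeasure_image_le (by positivity) S).trans ?_) bot_le
    rw [← hμ, h1, mul_zero]
  exact Measure.absolutelyContinuous_isAddHaarMeasure volume μ h2

/-- Change of variables for the volume of the image under an injective Lipschitz map, by
Rademacher's theorem. -/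
theorem volume_real_image_of_lipschitzWith {m : ℕ}
    {Θ : EuclideanSpace ℝ (Fin m) → EuclideanSpace ℝ (Fin m)} {K : NNReal}
    (hΘ : LipschitzWith K Θ) (hinj : Function.Injective Θ) {S : Set (EuclideanSpace ℝ (Fin m))}
    (hS : MeasurableSet S) :
    volume.real (Θ '' S) = ∫ p in S, |(fderiv ℝ Θ p).det| := by
  set A : Set (EuclideanSpace ℝ (Fin m)) := {p | DifferentiableAt ℝ Θ p} with hA
  have hAm : MeasurableSet A := measurableSet_of_differentiableAt ℝ Θ
  have hAae : ∀ᵐ p, p ∈ A := hΘ.ae_differentiableAt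
  have hnull : volume (S \ A) = 0 := measure_mono_null (fun p hp => hp.2) hAae
  have h1 : (Θ '' S : Set _) =ᵐ[volume] Θ '' (S ∩ A) := by
    have : Θ '' S = Θ '' (S ∩ A) ∪ Θ '' (S \ A) := by rw [← image_union, inter_union_sdiff]
    rw [this]
    exact union_ae_eq_left_of_ae_eq_empty
      (ae_eq_empty.2 (volume_image_eq_zero_of_lipschitzWith hΘ hnull))
  have h2 : (S ∩ A : Set _) =ᵐ[volume] S := by
    refine inter_ae_eq_left_of_ae_eq_univ ?_
    exact eventuallyEq_univ.2 hAae
  have h3 := integral_image_eq_integral_abs_det_fderiv_smul (volume : Measure _) (hS.inter hAm)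
    (fun p hp => (hp.2 : DifferentiableAt ℝ Θ p).hasFDerivAt.hasFDerivWithinAt) hinj.injOn
    (fun _ => (1 : ℝ))
  rw [measureReal_congr h1, ← setIntegral_congr_set h2]
  simpa using h3

/-- A Lipschitz perturbation of the identity with a small constant is a homeomorphism which
respects boundedness. -/
theorem exists_homeomorph_add_lipschitz {m : ℕ}
    {η : EuclideanSpace ℝ (Fin (m + 1)) → EuclideanSpace ℝ (Fin (m + 1))} {K : NNReal}
    (hη : LipschitzWith K η) (hK : K < 1) :
    ∃ Θ : EuclideanSpace ℝ (Fin (m + 1)) ≃ₜ EuclideanSpace ℝ (Fin (m + 1)),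
      (∀ p, Θ p = p + η p) ∧
      ∀ s, Bornology.IsBounded (Θ '' s) ↔ Bornology.IsBounded s := by
  set f : EuclideanSpace ℝ (Fin (m + 1)) → EuclideanSpace ℝ (Fin (m + 1)) :=
    fun p => p + η p with hf
  set ι := ContinuousLinearEquiv.refl ℝ (EuclideanSpace ℝ (Fin (m + 1))) with hι
  have happ : ApproximatesLinearOn f
      (ι : EuclideanSpace ℝ (Fin (m + 1)) →L[ℝ] EuclideanSpace ℝ (Fin (m + 1))) univ K := by
    intro p _ q _
    have h1 : f p - f q - ι (p - q) = η p - η q := by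
      simp only [hf, hι, ContinuousLinearEquiv.refl_apply]
      abel
    calc ‖f p - f q - ι (p - q)‖ = ‖η p - η q‖ := by rw [h1]
      _ ≤ K * ‖p - q‖ := by
          rw [← dist_eq_norm, ← dist_eq_norm]
          exact hη.dist_le_mul p q
  have hN : ‖(ι.symm : EuclideanSpace ℝ (Fin (m + 1)) →L[ℝ] EuclideanSpace ℝ (Fin (m + 1)))‖₊ = 1 := by
    ext
    exact ContinuousLinearMap.norm_id
  have hc : Subsingleton (EuclideanSpace ℝ (Fin (m + 1))) ∨
      K < ‖(ι.symm : EuclideanSpace ℝ (Fin (m + 1)) →L[ℝ]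
        EuclideanSpace ℝ (Fin (m + 1)))‖₊⁻¹ := by
    right
    rw [hN, inv_one]
    exact hK
  have hanti := happ.antilipschitz hc
  refine ⟨happ.toHomeomorph f hc, fun p => rfl, fun s => ⟨fun h => ?_, fun h => ?_⟩⟩
  · have hanti' : AntilipschitzWith (‖(ι.symm : EuclideanSpace ℝ (Fin (m + 1)) →L[ℝ]
        EuclideanSpace ℝ (Fin (m + 1)))‖₊⁻¹ - K)⁻¹ f := by
      intro p q
      exact hanti ⟨p, mem_univ p⟩ ⟨q, mem_univ q⟩
    exact (hanti'.isBounded_preimage h).subset (subset_preimage_image f s)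
  · exact (LipschitzWith.id.add hη).isBounded_image h

variable {n : ℕ} {M : Type*} [TopologicalSpace M] [ChartedSpace (EuclideanSpace ℝ (Fin n)) M]
  {F ν : M → EuclideanSpace ℝ (Fin (n + 1))}
  [IsManifold (𝓡 n) ∞ M] [T2Space M] [CompactSpace M] [MeasurableSpace M] [BorelSpace M]

/-- The first order expansion of the enclosed volume under deformations `F + D`, for which `D` is
Lipschitz with a small constant `K` with respect to the distance in the ambient space. Such a `D`
extends to a Lipschitz field `η` on the ambient space, `id + η` is a homeomorphism which carries the
enclosed region of `F` to that of `F + D`, its Jacobian is `1 + tr Dη + o(K)`, and `∫ tr Dη` is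
evaluated by the divergence theorem. -/
theorem enclosedVolume_add_expansion (hF : IsEmbeddedHypersurface 2 F)
    (hν : IsOuterUnitNormal F ν) {ε : ℝ} (hε : 0 < ε) :
    ∃ δ > 0, ∀ (D : M → EuclideanSpace ℝ (Fin (n + 1))) (K : ℝ), 0 ≤ K → K ≤ δ →
      (∀ x y, ‖D x - D y‖ ≤ K * ‖F x - F y‖) →
      |enclosedVolume (fun x => F x + D x) - enclosedVolume F -
        ∫ x, inner ℝ (D x) (ν x) ∂areaMeasure F| ≤ ε * K := by
  set b : NNReal := lipschitzExtensionConstant (EuclideanSpace ℝ (Fin (n + 1))) with hb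
  have hb0 : 0 < b := lipschitzExtensionConstant_pos _
  set v : ℝ := enclosedVolume F with hv
  have hv0 : 0 ≤ v := measureReal_nonneg
  set ε' : ℝ := ε / (b * (v + 1)) with hε'
  have hε'0 : 0 < ε' := by positivity
  -- `det (1 + A) = 1 + tr A + o(A)`
  have hdet1 := (hasFDerivAt_det_one (m := n + 1)).isLittleO.def hε'0
  have hdet2 : ∀ᶠ A in 𝓝 (1 : EuclideanSpace ℝ (Fin (n + 1)) →L[ℝ] EuclideanSpace ℝ (Fin (n + 1))),
      0 < A.det := by
    refine (ContinuousLinearMap.continuous_det.tendsto _).eventually (lt_mem_nhds ?_)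
    simp [ContinuousLinearMap.det]
  obtain ⟨r, hr, hball⟩ := Metric.eventually_nhds_iff_ball.1 (hdet1.and hdet2)
  have hdet : ∀ A : EuclideanSpace ℝ (Fin (n + 1)) →L[ℝ] EuclideanSpace ℝ (Fin (n + 1)), ‖A‖ < r →
      |(1 + A).det - 1 - traceCLM (n + 1) A| ≤ ε' * ‖A‖ ∧
      0 < (1 + A).det := by
    intro A hA
    have h := hball (1 + A) (by simpa [dist_eq_norm] using hA)
    refine ⟨?_, h.2⟩
    have h1 := h.1
    rw [add_sub_cancel_left, Real.norm_eq_abs] at h1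
    have h2 : (1 : EuclideanSpace ℝ (Fin (n + 1)) →L[ℝ] EuclideanSpace ℝ (Fin (n + 1))).det = 1 := by
      simp [ContinuousLinearMap.det]
    rw [h2] at h1
    exact h1
  refine ⟨min (r / 2) (1 / 2) / b, by positivity, fun D K hK0 hKδ hD => ?_⟩
  -- Extension of `D` to a Lipschitz vector field on the ambient space
  set D' : EuclideanSpace ℝ (Fin (n + 1)) → EuclideanSpace ℝ (Fin (n + 1)) :=
    Function.extend F D 0 with hD'
  have hD'F : ∀ x, D' (F x) = D x := fun x => hF.isEmbedding.injective.extend_apply D 0 x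
  have hlipOn : LipschitzOnWith (Real.toNNReal K) D' (range F) := by
    refine LipschitzOnWith.of_dist_le_mul ?_
    rintro _ ⟨x, rfl⟩ _ ⟨y, rfl⟩
    rw [hD'F, hD'F, Real.coe_toNNReal _ hK0, dist_eq_norm, dist_eq_norm]
    exact hD x y
  obtain ⟨η, hη, hηD⟩ := hlipOn.extend_finite_dimension
  have hηF : ∀ x, η (F x) = D x := fun x => by
    rw [← hηD ⟨x, rfl⟩, hD'F]
  rw [← hb] at hη
  set L : NNReal := b * Real.toNNReal K with hL
  have hLK : (L : ℝ) = b * K := by rw [hL, NNReal.coe_mul, Real.coe_toNNReal _ hK0]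
  have hLmin : (L : ℝ) ≤ min (r / 2) (1 / 2) := by
    rw [hLK, mul_comm]
    exact (le_div_iff₀ (by positivity)).1 hKδ
  have hLr : (L : ℝ) < r := by
    have := hLmin.trans (min_le_left _ _)
    linarith
  have hL1 : L < 1 := by
    have : (L : ℝ) < 1 := by
      have := hLmin.trans (min_le_right _ _)
      linarith
    exact_mod_cast this
  obtain ⟨Θ, hΘ, hΘb⟩ := exists_homeomorph_add_lipschitz hη hL1
  have hΩ' : Θ '' enclosedRegion F = enclosedRegion (fun x => F x + D x) :=
    image_enclosedRegion Θ _ (fun x => by rw [hΘ, hηF]) hΘb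
  have hΩm := measurableSet_enclosedRegion hF
  have hΩfin := volume_enclosedRegion_lt_top hF
  have hΘeq : (Θ : EuclideanSpace ℝ (Fin (n + 1)) → EuclideanSpace ℝ (Fin (n + 1))) =
      fun p => p + η p := funext hΘ
  have hΘlip : LipschitzWith (1 + L) Θ := by
    rw [hΘeq]
    exact LipschitzWith.id.add hη
  have hnorm : ∀ p, ‖fderiv ℝ η p‖ ≤ L := fun p => norm_fderiv_le_of_lipschitz ℝ hη
  have hvol : enclosedVolume (fun x => F x + D x) =
      ∫ p in enclosedRegion F, (1 + fderiv ℝ η p).det := by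
    rw [enclosedVolume, ← hΩ', volume_real_image_of_lipschitzWith hΘlip Θ.injective hΩm]
    refine integral_congr_ae (ae_restrict_of_ae ?_)
    filter_upwards [hη.ae_differentiableAt] with p hp
    have h1 : fderiv ℝ Θ p = 1 + fderiv ℝ η p := by
      rw [hΘeq]
      exact ((hasFDerivAt_id p).add hp.hasFDerivAt).fderiv
    rw [h1, abs_of_pos (hdet _ ((hnorm p).trans_lt hLr)).2]
  have hvol0 : v = ∫ p in enclosedRegion F, (1 : ℝ) := by
    rw [setIntegral_const, smul_eq_mul, mul_one, hv, enclosedVolume]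
  have hdiv := integral_trace_fderiv_enclosedRegion hF hν hη
  simp only [hηF] at hdiv
  have hcont_det : Measurable fun p => (1 + fderiv ℝ η p).det :=
    (ContinuousLinearMap.continuous_det.measurable).comp ((measurable_fderiv ℝ η).const_add 1)
  have hmeas_tr : Measurable fun p => traceCLM (n + 1) (fderiv ℝ η p) :=
    (traceCLM (n + 1)).continuous.measurable.comp (measurable_fderiv ℝ η)
  have hbd : ∀ p, |(1 + fderiv ℝ η p).det - 1 -
      traceCLM (n + 1) (fderiv ℝ η p)| ≤
      ε' * L := fun p =>
    (hdet _ ((hnorm p).trans_lt hLr)).1.trans (by gcongr; exact hnorm p)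
  have htrbd : ∀ p, ‖traceCLM (n + 1) (fderiv ℝ η p)‖ ≤ ‖traceCLM (n + 1)‖ * L := fun p =>
    ((traceCLM (n + 1)).le_opNorm _).trans (by gcongr; exact hnorm p)
  have hint_tr : IntegrableOn (fun p => traceCLM (n + 1) (fderiv ℝ η p))
      (enclosedRegion F) :=
    IntegrableOn.of_bound hΩfin hmeas_tr.aestronglyMeasurable _ (ae_of_all _ htrbd)
  have hint_one : IntegrableOn (fun _ : EuclideanSpace ℝ (Fin (n + 1)) => (1 : ℝ))
      (enclosedRegion F) := integrableOn_const hΩfin.ne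
  have hint_rem : IntegrableOn (fun p => (1 + fderiv ℝ η p).det - 1 -
      traceCLM (n + 1) (fderiv ℝ η p))
      (enclosedRegion F) :=
    IntegrableOn.of_bound hΩfin
      ((hcont_det.sub_const 1).sub hmeas_tr).aestronglyMeasurable _ (ae_of_all _ hbd)
  have hint_det : IntegrableOn (fun p => (1 + fderiv ℝ η p).det) (enclosedRegion F) := by
    refine ((hint_rem.add hint_tr).add hint_one).congr (ae_of_all _ fun p => ?_)
    simp
  have hint_sub : IntegrableOn (fun p => (1 + fderiv ℝ η p).det - 1) (enclosedRegion F) :=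
    hint_det.sub hint_one
  rw [hvol, hvol0, ← hdiv, ← integral_sub hint_det hint_one,
    ← integral_sub hint_sub hint_tr]
  have hfinal := norm_setIntegral_le_of_norm_le_const (C := ε' * L)
    (f := fun p => (1 + fderiv ℝ η p).det - 1 - traceCLM (n + 1) (fderiv ℝ η p))
    hΩfin fun p _ => hbd p
  rw [Real.norm_eq_abs] at hfinal
  refine hfinal.trans ?_
  have : volume.real (enclosedRegion F) = v := rfl
  rw [this, hLK, hε']
  have h1 : ε / (b * (v + 1)) * (b * K) * v = ε * K * (v / (v + 1)) := by
    field_simp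
  rw [h1]
  have h2 : v / (v + 1) ≤ 1 := (div_le_one (by linarith)).2 (by linarith)
  exact mul_le_of_le_one_right (by positivity) h2

/-- The first variation of the enclosed volume. -/
theorem hasDerivWithinAt_enclosedVolume {F : ℝ → M → EuclideanSpace ℝ (Fin (n + 1))} {I : Set ℝ}
    {t₀ C : ℝ} {w : M → EuclideanSpace ℝ (Fin (n + 1))} (hC : 0 ≤ C)
    (hF : IsEmbeddedHypersurface 2 (F t₀)) (hν : IsOuterUnitNormal (F t₀) ν)
    (hcont : ∀ᶠ t in 𝓝[I] t₀, Continuous (F t))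
    (hlip : ∀ᶠ t in 𝓝[I] t₀, ∀ x y, ‖(F t x - F t₀ x) - (F t y - F t₀ y)‖ ≤
      C * |t - t₀| * ‖F t₀ x - F t₀ y‖)
    (hbound : ∀ᶠ t in 𝓝[I] t₀, ∀ x, ‖F t x - F t₀ x‖ ≤ C * |t - t₀|)
    (hder : ∀ x, HasDerivWithinAt (fun t => F t x) (w x) I t₀) :
    HasDerivWithinAt (fun t => enclosedVolume (F t))
      (∫ x, inner ℝ (w x) (ν x) ∂areaMeasure (F t₀)) I t₀ := by
  have hfinite := isFiniteMeasure_areaMeasure hF.contMDiff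
  have hflux : HasDerivWithinAt
      (fun t => ∫ x, inner ℝ (F t x - F t₀ x) (ν x) ∂areaMeasure (F t₀))
      (∫ x, inner ℝ (w x) (ν x) ∂areaMeasure (F t₀)) I t₀ := by
    refine hasDerivWithinAt_integral_of_lipschitz (bound := fun _ => C) ?_ ?_
      (integrable_const C) ?_ (ae_of_all _ fun x => ?_)
    · filter_upwards [hcont] with t ht
      exact ((ht.sub hF.isEmbedding.continuous).inner hν.continuous).aestronglyMeasurable
    · simp
    · filter_upwards [hbound] with t ht
      refine ae_of_all _ fun x => ?_
      rw [sub_self, inner_zero_left, sub_zero]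
      refine (abs_real_inner_le_norm _ _).trans ?_
      rw [hν.norm_eq_one, mul_one]
      exact ht x
    · have h := (hder x).sub_const (F t₀ x)
      simpa using h.inner ℝ (hasDerivWithinAt_const t₀ I (ν x))
  have hrest : HasDerivWithinAt (fun t => enclosedVolume (F t) -
      ∫ x, inner ℝ (F t x - F t₀ x) (ν x) ∂areaMeasure (F t₀)) 0 I t₀ := by
    rw [hasDerivWithinAt_iff_isLittleO, Asymptotics.isLittleO_iff]
    intro ε hε
    obtain ⟨δ, hδ, hexp⟩ := enclosedVolume_add_expansion hF hν (ε := ε / (C + 1)) (by positivity)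
    have hnear : ∀ᶠ t in 𝓝[I] t₀, C * |t - t₀| ≤ δ := by
      have h1 : Tendsto (fun t => C * |t - t₀|) (𝓝 t₀) (𝓝 (C * |t₀ - t₀|)) :=
        (by fun_prop : Continuous fun t => C * |t - t₀|).tendsto t₀
      rw [sub_self, abs_zero, mul_zero] at h1
      exact nhdsWithin_le_nhds ((h1.eventually (gt_mem_nhds hδ)).mono fun t ht => ht.le)
    filter_upwards [hlip, hnear] with t h1 h2
    have h3 := hexp (fun x => F t x - F t₀ x) (C * |t - t₀|) (by positivity) h2 h1
    simp only [add_sub_cancel] at h3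
    simp only [sub_self, inner_zero_left, integral_zero, sub_zero, smul_zero, Real.norm_eq_abs]
    rw [sub_right_comm]
    refine h3.trans ?_
    have h4 : ε / (C + 1) * (C * |t - t₀|) = ε * |t - t₀| * (C / (C + 1)) := by
      field_simp
    rw [h4]
    exact mul_le_of_le_one_right (by positivity) ((div_le_one (by linarith)).2 (by linarith))
  have h := hrest.add hflux
  rw [zero_add] at h
  refine HasDerivWithinAt.congr_of_eventuallyEq h (Eventually.of_forall fun t => ?_) ?_ <;> simp

end Deformation

/-! ### Time derivatives of a flow in charts -/

section FlowRegularity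

variable {n : ℕ} {M : Type*} [TopologicalSpace M] [ChartedSpace (EuclideanSpace ℝ (Fin n)) M]
  {F w : ℝ → M → EuclideanSpace ℝ (Fin (n + 1))} {I : Set ℝ}

/-- A time-dependent map `F` in the coordinates `(t, u)`, where `u` are the coordinates of the
preferred chart at `c`. -/
def flowMap (F : ℝ → M → EuclideanSpace ℝ (Fin (n + 1))) (c : M)
    (q : ℝ × EuclideanSpace ℝ (Fin n)) : EuclideanSpace ℝ (Fin (n + 1)) :=
  coordMap (F q.1) c q.2

/-- The domain of `flowMap`. -/
def flowDomain (I : Set ℝ) (n : ℕ) {M : Type*} [TopologicalSpace M]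
    [ChartedSpace (EuclideanSpace ℝ (Fin n)) M] (c : M) : Set (ℝ × EuclideanSpace ℝ (Fin n)) :=
  I ×ˢ (chartAt (EuclideanSpace ℝ (Fin n)) c).target

theorem uniqueDiffOn_flowDomain (hI : Convex ℝ I) (hI' : (interior I).Nonempty) (c : M) :
    UniqueDiffOn ℝ (flowDomain I n c) :=
  (uniqueDiffOn_convex hI hI').prod
    (chartAt (EuclideanSpace ℝ (Fin n)) c).open_target.uniqueDiffOn

variable [IsManifold (𝓡 n) ∞ M]

theorem contDiffOn_flowMap
    (hF : ContMDiffOn (𝓘(ℝ, ℝ).prod (𝓡 n)) 𝓘(ℝ, EuclideanSpace ℝ (Fin (n + 1))) 2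
      (fun p : ℝ × M => F p.1 p.2) (I ×ˢ univ)) (c : M) :
    ContDiffOn ℝ 2 (flowMap F c) (flowDomain I n c) := by
  rw [← contMDiffOn_iff_contDiffOn, modelWithCornersSelf_prod, ← chartedSpaceSelf_prod]
  have h1 : ContMDiffOn (𝓘(ℝ, ℝ).prod (𝓡 n)) (𝓘(ℝ, ℝ).prod (𝓡 n)) 2
      (Prod.map id (chartAt (EuclideanSpace ℝ (Fin n)) c).symm) (flowDomain I n c) :=
    (contMDiffOn_id (s := I)).prodMap
      ((contMDiffOn_chart_symm (I := 𝓡 n) (n := ∞) (x := c)).of_le (by norm_cast))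
  exact hF.comp h1 fun q hq => ⟨hq.1, mem_univ _⟩

theorem hasFDerivWithinAt_flowMap
    (hF : ContMDiffOn (𝓘(ℝ, ℝ).prod (𝓡 n)) 𝓘(ℝ, EuclideanSpace ℝ (Fin (n + 1))) 2
      (fun p : ℝ × M => F p.1 p.2) (I ×ˢ univ)) {c : M} {q : ℝ × EuclideanSpace ℝ (Fin n)}
    (hq : q ∈ flowDomain I n c) :
    HasFDerivWithinAt (flowMap F c) (fderivWithin ℝ (flowMap F c) (flowDomain I n c) q)
      (flowDomain I n c) q :=
  ((contDiffOn_flowMap hF c).differentiableOn (by norm_num) q hq).hasFDerivWithinAt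

/-- Restriction of a derivative on `flowDomain` to the spatial directions. -/
theorem hasFDerivAt_slice_space {E : Type*} [NormedAddCommGroup E] [NormedSpace ℝ E]
    {G : ℝ × EuclideanSpace ℝ (Fin n) → E} {G' : ℝ × EuclideanSpace ℝ (Fin n) →L[ℝ] E}
    {c : M} {q : ℝ × EuclideanSpace ℝ (Fin n)}
    (hG : HasFDerivWithinAt G G' (flowDomain I n c) q) (hq : q ∈ flowDomain I n c) :
    HasFDerivAt (fun u => G (q.1, u)) (G'.comp (ContinuousLinearMap.inr ℝ ℝ _)) q.2 := by
  have h1 : HasFDerivWithinAt (fun u : EuclideanSpace ℝ (Fin n) => ((q.1, u) : ℝ × _))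
      (ContinuousLinearMap.inr ℝ ℝ (EuclideanSpace ℝ (Fin n)))
      (chartAt (EuclideanSpace ℝ (Fin n)) c).target q.2 :=
    (hasFDerivAt_prodMk_right q.1 q.2).hasFDerivWithinAt
  have hmaps : MapsTo (fun u : EuclideanSpace ℝ (Fin n) => ((q.1, u) : ℝ × _))
      (chartAt (EuclideanSpace ℝ (Fin n)) c).target (flowDomain I n c) := fun u hu => ⟨hq.1, hu⟩
  exact (HasFDerivWithinAt.comp q.2 hG h1 hmaps).hasFDerivAt
    ((chartAt (EuclideanSpace ℝ (Fin n)) c).open_target.mem_nhds hq.2)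

/-- Restriction of a derivative on `flowDomain` to the time direction. -/
theorem hasDerivWithinAt_slice_time {E : Type*} [NormedAddCommGroup E] [NormedSpace ℝ E]
    {G : ℝ × EuclideanSpace ℝ (Fin n) → E} {G' : ℝ × EuclideanSpace ℝ (Fin n) →L[ℝ] E}
    {c : M} {q : ℝ × EuclideanSpace ℝ (Fin n)}
    (hG : HasFDerivWithinAt G G' (flowDomain I n c) q) (hq : q ∈ flowDomain I n c) :
    HasDerivWithinAt (fun t => G (t, q.2)) (G' (1, 0)) I q.1 := by
  have h1 : HasDerivWithinAt (fun t : ℝ => ((t, q.2) : ℝ × EuclideanSpace ℝ (Fin n)))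
      (1, 0) I q.1 :=
    (hasDerivWithinAt_id q.1 I).prodMk (hasDerivWithinAt_const q.1 I q.2)
  exact HasFDerivWithinAt.comp_hasDerivWithinAt (t := flowDomain I n c) q.1 hG h1
    fun t ht => ⟨ht, hq.2⟩

theorem fderiv_coordMap_eq
    (hF : ContMDiffOn (𝓘(ℝ, ℝ).prod (𝓡 n)) 𝓘(ℝ, EuclideanSpace ℝ (Fin (n + 1))) 2
      (fun p : ℝ × M => F p.1 p.2) (I ×ˢ univ)) {c : M} {q : ℝ × EuclideanSpace ℝ (Fin n)}
    (hq : q ∈ flowDomain I n c) :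
    fderiv ℝ (coordMap (F q.1) c) q.2 =
      (fderivWithin ℝ (flowMap F c) (flowDomain I n c) q).comp
        (ContinuousLinearMap.inr ℝ ℝ (EuclideanSpace ℝ (Fin n))) :=
  (hasFDerivAt_slice_space (hasFDerivWithinAt_flowMap hF hq) hq).fderiv

theorem contDiffOn_fderiv_coordMap (hI : Convex ℝ I) (hI' : (interior I).Nonempty)
    (hF : ContMDiffOn (𝓘(ℝ, ℝ).prod (𝓡 n)) 𝓘(ℝ, EuclideanSpace ℝ (Fin (n + 1))) 2
      (fun p : ℝ × M => F p.1 p.2) (I ×ˢ univ)) (c : M) :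
    ContDiffOn ℝ 1 (fun q : ℝ × EuclideanSpace ℝ (Fin n) => fderiv ℝ (coordMap (F q.1) c) q.2)
      (flowDomain I n c) := by
  have h1 : ContDiffOn ℝ 1 (fderivWithin ℝ (flowMap F c) (flowDomain I n c))
      (flowDomain I n c) :=
    (contDiffOn_flowMap hF c).fderivWithin (uniqueDiffOn_flowDomain hI hI' c) (by norm_num)
  have h2 : ContDiffOn ℝ 1 (fun q => (fderivWithin ℝ (flowMap F c) (flowDomain I n c) q).comp
      (ContinuousLinearMap.inr ℝ ℝ (EuclideanSpace ℝ (Fin n)))) (flowDomain I n c) :=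
    h1.clm_comp contDiffOn_const
  exact h2.congr fun q hq => fderiv_coordMap_eq hF hq

theorem velocity_eq (hI : Convex ℝ I) (hI' : (interior I).Nonempty)
    (hF : ContMDiffOn (𝓘(ℝ, ℝ).prod (𝓡 n)) 𝓘(ℝ, EuclideanSpace ℝ (Fin (n + 1))) 2
      (fun p : ℝ × M => F p.1 p.2) (I ×ˢ univ))
    (hw : ∀ t ∈ I, ∀ x, HasDerivWithinAt (fun s => F s x) (w t x) I t)
    {c : M} {q : ℝ × EuclideanSpace ℝ (Fin n)} (hq : q ∈ flowDomain I n c) :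
    fderivWithin ℝ (flowMap F c) (flowDomain I n c) q (1, 0) =
      w q.1 ((chartAt (EuclideanSpace ℝ (Fin n)) c).symm q.2) := by
  have h1 := hasDerivWithinAt_slice_time (hasFDerivWithinAt_flowMap hF hq) hq
  exact (uniqueDiffOn_convex hI hI' q.1 hq.1).eq_deriv I h1
    (hw q.1 hq.1 ((chartAt (EuclideanSpace ℝ (Fin n)) c).symm q.2))

/-- The time derivative commutes with the spatial derivatives, also at the end points of the time
interval. -/
theorem hasDerivWithinAt_fderiv_coordMap (hI : Convex ℝ I) (hI' : (interior I).Nonempty)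
    (hF : ContMDiffOn (𝓘(ℝ, ℝ).prod (𝓡 n)) 𝓘(ℝ, EuclideanSpace ℝ (Fin (n + 1))) 2
      (fun p : ℝ × M => F p.1 p.2) (I ×ˢ univ))
    (hw : ∀ t ∈ I, ∀ x, HasDerivWithinAt (fun s => F s x) (w t x) I t)
    {c : M} {t : ℝ} {u : EuclideanSpace ℝ (Fin n)} (ht : t ∈ I)
    (hu : u ∈ (chartAt (EuclideanSpace ℝ (Fin n)) c).target) :
    DifferentiableAt ℝ (coordMap (w t) c) u ∧
    ∀ v, HasDerivWithinAt (fun s => fderiv ℝ (coordMap (F s) c) u v)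
      (fderiv ℝ (coordMap (w t) c) u v) I t := by
  set S := flowDomain I n c with hS
  set DG := fderivWithin ℝ (flowMap F c) S with hDG
  have hq : ((t, u) : ℝ × EuclideanSpace ℝ (Fin n)) ∈ S := ⟨ht, hu⟩
  have hUD := uniqueDiffOn_flowDomain (n := n) hI hI' c
  have hDGdiff : HasFDerivWithinAt DG (fderivWithin ℝ DG S (t, u)) S (t, u) :=
    (((contDiffOn_flowMap hF c).fderivWithin hUD (m := 1) (by norm_num)).differentiableOn
      (by norm_num) _ hq).hasFDerivWithinAt
  have hsymm : IsSymmSndFDerivWithinAt ℝ (flowMap F c) S (t, u) := by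
    refine ((contDiffOn_flowMap hF c) _ hq).isSymmSndFDerivWithinAt (by simp) hUD ?_ hq
    rw [flowDomain, interior_prod_eq, closure_prod_eq]
    refine ⟨?_, ?_⟩
    · rw [hI.closure_interior_eq_closure_of_nonempty_interior hI']
      exact subset_closure ht
    · rw [(chartAt (EuclideanSpace ℝ (Fin n)) c).open_target.interior_eq]
      exact subset_closure hu
  -- The velocity in coordinates
  have hvel : HasFDerivAt (coordMap (w t) c)
      (((ContinuousLinearMap.apply ℝ (EuclideanSpace ℝ (Fin (n + 1)))
        ((1, 0) : ℝ × EuclideanSpace ℝ (Fin n))).comp (fderivWithin ℝ DG S (t, u))).comp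
        (ContinuousLinearMap.inr ℝ ℝ (EuclideanSpace ℝ (Fin n)))) u := by
    have h1 : HasFDerivWithinAt (fun q => DG q (1, 0))
        ((ContinuousLinearMap.apply ℝ (EuclideanSpace ℝ (Fin (n + 1)))
        ((1, 0) : ℝ × EuclideanSpace ℝ (Fin n))).comp (fderivWithin ℝ DG S (t, u))) S (t, u) :=
      (ContinuousLinearMap.apply ℝ (EuclideanSpace ℝ (Fin (n + 1)))
        ((1, 0) : ℝ × EuclideanSpace ℝ (Fin n))).hasFDerivAt.comp_hasFDerivWithinAt _ hDGdiff
    refine (hasFDerivAt_slice_space h1 hq).congr_of_eventuallyEq ?_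
    filter_upwards [(chartAt (EuclideanSpace ℝ (Fin n)) c).open_target.mem_nhds hu] with u' hu'
    exact (velocity_eq hI hI' hF hw (q := (t, u')) ⟨ht, hu'⟩).symm
  refine ⟨hvel.differentiableAt, fun v => ?_⟩
  have h2 : HasFDerivWithinAt (fun q => DG q (0, v))
      ((ContinuousLinearMap.apply ℝ (EuclideanSpace ℝ (Fin (n + 1)))
      ((0, v) : ℝ × EuclideanSpace ℝ (Fin n))).comp (fderivWithin ℝ DG S (t, u))) S (t, u) :=
    (ContinuousLinearMap.apply ℝ (EuclideanSpace ℝ (Fin (n + 1)))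
      ((0, v) : ℝ × EuclideanSpace ℝ (Fin n))).hasFDerivAt.comp_hasFDerivWithinAt _ hDGdiff
  have h3 := hasDerivWithinAt_slice_time h2 hq
  have hval : ((ContinuousLinearMap.apply ℝ (EuclideanSpace ℝ (Fin (n + 1)))
      ((0, v) : ℝ × EuclideanSpace ℝ (Fin n))).comp (fderivWithin ℝ DG S (t, u))) (1, 0) =
      fderiv ℝ (coordMap (w t) c) u v := by
    rw [hvel.fderiv]
    exact hsymm (1, 0) (0, v)
  rw [hval] at h3
  refine h3.congr (fun s hs => ?_) ?_
  · rw [fderiv_coordMap_eq hF (q := (s, u)) ⟨hs, hu⟩]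
    rfl
  · rw [fderiv_coordMap_eq hF (q := (t, u)) ⟨ht, hu⟩]
    rfl

end FlowRegularity

/-! ### Uniform Lipschitz estimates for a flow -/

section FlowLipschitz

variable {n : ℕ} {M : Type*} [TopologicalSpace M] [ChartedSpace (EuclideanSpace ℝ (Fin n)) M]
  {F w : ℝ → M → EuclideanSpace ℝ (Fin (n + 1))} {I : Set ℝ}
  [IsManifold (𝓡 n) ∞ M]

/-- A `C¹` function of `(t, u)` is Lipschitz in `t`, locally uniformly in `u`. -/
theorem exists_local_lipschitz_time {E : Type*} [NormedAddCommGroup E] [NormedSpace ℝ E]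
    {G : ℝ × EuclideanSpace ℝ (Fin n) → E} {c : M} (hI : Convex ℝ I)
    (hG : ContDiffOn ℝ 1 G (flowDomain I n c)) {t₀ : ℝ} {u₀ : EuclideanSpace ℝ (Fin n)}
    (ht₀ : t₀ ∈ I) (hu₀ : u₀ ∈ (chartAt (EuclideanSpace ℝ (Fin n)) c).target) :
    ∃ K : ℝ, 0 ≤ K ∧ ∃ r > 0,
      Metric.ball u₀ r ⊆ (chartAt (EuclideanSpace ℝ (Fin n)) c).target ∧
      ∀ t ∈ I, |t - t₀| < r → ∀ u ∈ Metric.ball u₀ r,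
        ‖G (t, u) - G (t₀, u)‖ ≤ K * |t - t₀| := by
  obtain ⟨ρ, hρ, hball⟩ := Metric.isOpen_iff.1
    (chartAt (EuclideanSpace ℝ (Fin n)) c).open_target u₀ hu₀
  have hconv : Convex ℝ (I ×ˢ Metric.ball u₀ ρ) := hI.prod (convex_ball u₀ ρ)
  have hG' : ContDiffWithinAt ℝ 1 G (I ×ˢ Metric.ball u₀ ρ) (t₀, u₀) :=
    (hG.mono (prod_mono Subset.rfl hball)) _ ⟨ht₀, Metric.mem_ball_self hρ⟩
  obtain ⟨K, N, hN, hlip⟩ := hG'.exists_lipschitzOnWith hconv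
  obtain ⟨r, hr, hrN⟩ := Metric.mem_nhdsWithin_iff.1 hN
  refine ⟨K, K.2, min r ρ, lt_min hr hρ,
    (Metric.ball_subset_ball (min_le_right _ _)).trans hball, fun t ht htr u hu => ?_⟩
  have hmem : ∀ s ∈ I, |s - t₀| < min r ρ → ((s, u) : ℝ × EuclideanSpace ℝ (Fin n)) ∈ N := by
    intro s hs hsr
    refine hrN ⟨?_, hs, Metric.ball_subset_ball (min_le_right _ _) hu⟩
    rw [Metric.mem_ball, Prod.dist_eq, max_lt_iff, Real.dist_eq]
    exact ⟨hsr.trans_le (min_le_left _ _), lt_of_lt_of_le hu (min_le_left _ _)⟩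
  have h := hlip.dist_le_mul _ (hmem t ht htr) _ (hmem t₀ ht₀ (by simp [hr, hρ]))
  rw [dist_eq_norm, Prod.dist_eq, dist_self, max_eq_left dist_nonneg, Real.dist_eq] at h
  exact h

/-- A `C¹` map with injective derivative is locally bounded from below. -/
theorem exists_local_antilipschitz {f : EuclideanSpace ℝ (Fin n) → EuclideanSpace ℝ (Fin (n + 1))}
    {A : EuclideanSpace ℝ (Fin n) →L[ℝ] EuclideanSpace ℝ (Fin (n + 1))}
    {u₀ : EuclideanSpace ℝ (Fin n)} (hf : HasStrictFDerivAt f A u₀) (hA : Function.Injective A) :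
    ∃ κ > 0, ∃ r > 0, ∀ u ∈ Metric.ball u₀ r, ∀ v ∈ Metric.ball u₀ r,
      ‖u - v‖ ≤ κ * ‖f u - f v‖ := by
  obtain ⟨K, hK, hanti⟩ := LinearMap.exists_antilipschitzWith
    (A : EuclideanSpace ℝ (Fin n) →ₗ[ℝ] EuclideanSpace ℝ (Fin (n + 1)))
    (LinearMap.ker_eq_bot.2 hA)
  have hK' : (0 : ℝ) < K := hK
  have hlow : ∀ z, ‖z‖ ≤ K * ‖A z‖ := fun z => by
    have := hanti.le_mul_dist z 0
    simpa using this
  have hev := hf.isLittleO.def (c := 1 / (2 * K)) (by positivity)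
  obtain ⟨r, hr, hball⟩ := Metric.eventually_nhds_iff_ball.1 hev
  refine ⟨2 * K, by positivity, r, hr, fun u hu v hv => ?_⟩
  have h1 := hball (u, v) (by
    rw [Metric.mem_ball, Prod.dist_eq, max_lt_iff]
    exact ⟨hu, hv⟩)
  simp only at h1
  have h2 := hlow (u - v)
  have h3 : ‖A (u - v)‖ ≤ ‖f u - f v‖ + 1 / (2 * K) * ‖u - v‖ := by
    have := norm_sub_norm_le (A (u - v)) (f u - f v)
    rw [norm_sub_rev (A (u - v))] at this
    linarith
  have h4 : ‖u - v‖ ≤ K * ‖f u - f v‖ + 1 / 2 * ‖u - v‖ := by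
    calc ‖u - v‖ ≤ K * (‖f u - f v‖ + 1 / (2 * K) * ‖u - v‖) := h2.trans (by gcongr)
      _ = K * ‖f u - f v‖ + 1 / 2 * ‖u - v‖ := by field_simp
  linarith

variable [CompactSpace M]

/-- Uniform Lipschitz continuity in time of a `C²` flow on a compact manifold. -/
theorem exists_norm_sub_le_time (hI : Convex ℝ I)
    (hF : ContMDiffOn (𝓘(ℝ, ℝ).prod (𝓡 n)) 𝓘(ℝ, EuclideanSpace ℝ (Fin (n + 1))) 2
      (fun p : ℝ × M => F p.1 p.2) (I ×ˢ univ)) {t₀ : ℝ} (ht₀ : t₀ ∈ I) :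
    ∃ C : ℝ, 0 ≤ C ∧ ∃ δ > 0, ∀ t ∈ I, |t - t₀| < δ → ∀ x, ‖F t x - F t₀ x‖ ≤ C * |t - t₀| := by
  have key := isCompact_univ.induction_on (X := M)
    (p := fun s => ∃ C : ℝ, 0 ≤ C ∧ ∃ δ > 0, ∀ t ∈ I, |t - t₀| < δ → ∀ x ∈ s,
      ‖F t x - F t₀ x‖ ≤ C * |t - t₀|) ?_ ?_ ?_ ?_
  · obtain ⟨C, hC, δ, hδ, h⟩ := key
    exact ⟨C, hC, δ, hδ, fun t ht htδ x => h t ht htδ x (mem_univ x)⟩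
  · exact ⟨0, le_rfl, 1, one_pos, fun t _ _ x hx => absurd hx (notMem_empty x)⟩
  · rintro s s' hss ⟨C, hC, δ, hδ, h⟩
    exact ⟨C, hC, δ, hδ, fun t ht htδ x hx => h t ht htδ x (hss hx)⟩
  · rintro s s' ⟨C, hC, δ, hδ, h⟩ ⟨C', hC', δ', hδ', h'⟩
    refine ⟨max C C', le_max_of_le_left hC, min δ δ', lt_min hδ hδ', fun t ht htδ x hx => ?_⟩
    rcases hx with hx | hx
    · refine (h t ht (htδ.trans_le (min_le_left _ _)) x hx).trans ?_
      gcongr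
      exact le_max_left _ _
    · refine (h' t ht (htδ.trans_le (min_le_right _ _)) x hx).trans ?_
      gcongr
      exact le_max_right _ _
  · intro x₀ _
    set χ := chartAt (EuclideanSpace ℝ (Fin n)) x₀ with hχ
    have hx₀ : x₀ ∈ χ.source := mem_chart_source _ x₀
    obtain ⟨K, hK, r, hr, -, h⟩ := exists_local_lipschitz_time hI
      ((contDiffOn_flowMap hF x₀).of_le (by norm_num)) ht₀ (χ.map_source hx₀)
    refine ⟨χ.source ∩ χ ⁻¹' Metric.ball (χ x₀) r, mem_nhdsWithin_of_mem_nhds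
      (inter_mem (χ.open_source.mem_nhds hx₀)
        ((χ.continuousAt hx₀).preimage_mem_nhds (Metric.ball_mem_nhds _ hr))),
      K, hK, r, hr, fun t ht htr x hx => ?_⟩
    have h1 := h t ht htr (χ x) hx.2
    simp only [flowMap, coordMap] at h1
    rwa [← hχ, χ.left_inv hx.1] at h1

/-- The displacement `F_t - F_{t₀}` is Lipschitz with constant `O(|t - t₀|)` with respect to the
distance in the ambient space. Near the diagonal of `M × M` this follows in a chart, since the
spatial derivatives of `F` are Lipschitz in time and `F_{t₀}` is locally bounded from below; away
from the diagonal `‖F_{t₀} x - F_{t₀} y‖` is bounded from below. -/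
theorem exists_displacement_lipschitz (hI : Convex ℝ I) (hI' : (interior I).Nonempty)
    (hF : ContMDiffOn (𝓘(ℝ, ℝ).prod (𝓡 n)) 𝓘(ℝ, EuclideanSpace ℝ (Fin (n + 1))) 2
      (fun p : ℝ × M => F p.1 p.2) (I ×ˢ univ)) {t₀ : ℝ} (ht₀ : t₀ ∈ I)
    (hemb : IsEmbeddedHypersurface 2 (F t₀)) :
    ∃ C : ℝ, 0 ≤ C ∧ ∃ δ > 0, ∀ t ∈ I, |t - t₀| < δ → ∀ x y,
      ‖(F t x - F t₀ x) - (F t y - F t₀ y)‖ ≤ C * |t - t₀| * ‖F t₀ x - F t₀ y‖ := by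
  obtain ⟨C₀, hC₀, δ₀, hδ₀, hsup⟩ := exists_norm_sub_le_time hI hF ht₀
  have key := isCompact_univ.induction_on (X := M × M)
    (p := fun s => ∃ C : ℝ, 0 ≤ C ∧ ∃ δ > 0, ∀ t ∈ I, |t - t₀| < δ → ∀ z ∈ s,
      ‖(F t z.1 - F t₀ z.1) - (F t z.2 - F t₀ z.2)‖ ≤ C * |t - t₀| * ‖F t₀ z.1 - F t₀ z.2‖)
    ?_ ?_ ?_ ?_
  · obtain ⟨C, hC, δ, hδ, h⟩ := key
    exact ⟨C, hC, δ, hδ, fun t ht htδ x y => h t ht htδ (x, y) (mem_univ _)⟩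
  · exact ⟨0, le_rfl, 1, one_pos, fun t _ _ x hx => absurd hx (notMem_empty x)⟩
  · rintro s s' hss ⟨C, hC, δ, hδ, h⟩
    exact ⟨C, hC, δ, hδ, fun t ht htδ x hx => h t ht htδ x (hss hx)⟩
  · rintro s s' ⟨C, hC, δ, hδ, h⟩ ⟨C', hC', δ', hδ', h'⟩
    refine ⟨max C C', le_max_of_le_left hC, min δ δ', lt_min hδ hδ', fun t ht htδ x hx => ?_⟩
    rcases hx with hx | hx
    · refine (h t ht (htδ.trans_le (min_le_left _ _)) x hx).trans ?_
      gcongr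
      exact le_max_left _ _
    · refine (h' t ht (htδ.trans_le (min_le_right _ _)) x hx).trans ?_
      gcongr
      exact le_max_right _ _
  · rintro ⟨x₀, y₀⟩ -
    by_cases hxy : x₀ = y₀
    · subst hxy
      set χ := chartAt (EuclideanSpace ℝ (Fin n)) x₀ with hχ
      have hx₀ : x₀ ∈ χ.source := mem_chart_source _ x₀
      have hu₀ : χ x₀ ∈ χ.target := χ.map_source hx₀
      obtain ⟨K, hK, r, hr, hrt, h⟩ := exists_local_lipschitz_time hI
        (contDiffOn_fderiv_coordMap hI hI' hF x₀) ht₀ hu₀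
      obtain ⟨κ, hκ, r', hr', hanti⟩ := exists_local_antilipschitz
        ((contDiffAt_coordMap (by norm_cast) hemb.contMDiff hu₀).hasStrictFDerivAt (by norm_num))
        (hemb.injective_fderiv hu₀)
      set m := min r r' with hm
      have hm0 : 0 < m := lt_min hr hr'
      have hN : χ.source ∩ χ ⁻¹' Metric.ball (χ x₀) m ∈ 𝓝 x₀ :=
        inter_mem (χ.open_source.mem_nhds hx₀)
          ((χ.continuousAt hx₀).preimage_mem_nhds (Metric.ball_mem_nhds _ hm0))
      refine ⟨_, mem_nhdsWithin_of_mem_nhds (prod_mem_nhds hN hN), K * κ, by positivity, r, hr,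
        fun t ht htr z hz => ?_⟩
      obtain ⟨⟨hx1, hx2⟩, hy1, hy2⟩ := hz
      have hsubr := Metric.ball_subset_ball (x := χ x₀) (min_le_left r r')
      have hsubr' := Metric.ball_subset_ball (x := χ x₀) (min_le_right r r')
      have hdiff : ∀ s ∈ I, ∀ u ∈ Metric.ball (χ x₀) r,
          HasFDerivAt (coordMap (F s) x₀) (fderiv ℝ (coordMap (F s) x₀) u) u := fun s hs u hu =>
        (hasFDerivAt_slice_space (hasFDerivWithinAt_flowMap hF
          (q := (s, u)) ⟨hs, hrt hu⟩) ⟨hs, hrt hu⟩).differentiableAt.hasFDerivAt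
      have hmv := (convex_ball (χ x₀) r).norm_image_sub_le_of_norm_hasFDerivWithin_le
        (f := fun u => coordMap (F t) x₀ u - coordMap (F t₀) x₀ u)
        (fun u hu => ((hdiff t ht u hu).sub (hdiff t₀ ht₀ u hu)).hasFDerivWithinAt)
        (fun u hu => h t ht htr u hu) (hsubr hy2) (hsubr hx2)
      have hlow := hanti _ (hsubr' hx2) _ (hsubr' hy2)
      simp only [coordMap] at hmv hlow
      rw [← hχ, χ.left_inv hx1, χ.left_inv hy1] at hmv hlow
      calc ‖(F t z.1 - F t₀ z.1) - (F t z.2 - F t₀ z.2)‖ ≤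
            K * |t - t₀| * ‖χ z.1 - χ z.2‖ := hmv
        _ ≤ K * |t - t₀| * (κ * ‖F t₀ z.1 - F t₀ z.2‖) := by gcongr
        _ = K * κ * |t - t₀| * ‖F t₀ z.1 - F t₀ z.2‖ := by ring
    · have hne : 0 < ‖F t₀ x₀ - F t₀ y₀‖ :=
        norm_pos_iff.2 (sub_ne_zero.2 fun h => hxy (hemb.isEmbedding.injective h))
      set m := ‖F t₀ x₀ - F t₀ y₀‖ / 2 with hm
      have hm0 : 0 < m := by positivity
      have hcont : Continuous fun z : M × M => ‖F t₀ z.1 - F t₀ z.2‖ :=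
        ((hemb.isEmbedding.continuous.comp continuous_fst).sub
          (hemb.isEmbedding.continuous.comp continuous_snd)).norm
      have hN : {z : M × M | m < ‖F t₀ z.1 - F t₀ z.2‖} ∈ 𝓝 (x₀, y₀) :=
        hcont.continuousAt.preimage_mem_nhds (Ioi_mem_nhds (by simp only [hm]; linarith))
      refine ⟨_, mem_nhdsWithin_of_mem_nhds hN, 2 * C₀ / m, by positivity, δ₀, hδ₀,
        fun t ht htδ z hz => ?_⟩
      have hz' : m ≤ ‖F t₀ z.1 - F t₀ z.2‖ := le_of_lt hz
      have h1 := hsup t ht htδ z.1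
      have h2 := hsup t ht htδ z.2
      calc ‖(F t z.1 - F t₀ z.1) - (F t z.2 - F t₀ z.2)‖ ≤ C₀ * |t - t₀| + C₀ * |t - t₀| :=
            (norm_sub_le _ _).trans (add_le_add h1 h2)
        _ = 2 * C₀ / m * |t - t₀| * m := by field_simp; ring
        _ ≤ 2 * C₀ / m * |t - t₀| * ‖F t₀ z.1 - F t₀ z.2‖ := by gcongr

end FlowLipschitz

/-! ### The first variation of the area -/

section AreaVariation

variable {n : ℕ} {M : Type*} [TopologicalSpace M] [ChartedSpace (EuclideanSpace ℝ (Fin n)) M]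
  {F ν w : ℝ → M → EuclideanSpace ℝ (Fin (n + 1))} {f : ℝ → M → ℝ} {I : Set ℝ}
  [IsManifold (𝓡 n) ∞ M]

/-- The first variation of the area density for a flow with normal velocity `f ν`, at the base
point of the preferred chart. -/
theorem hasDerivWithinAt_sqrt_gramDet_base (hI : Convex ℝ I) (hI' : (interior I).Nonempty)
    (hF : ContMDiffOn (𝓘(ℝ, ℝ).prod (𝓡 n)) 𝓘(ℝ, EuclideanSpace ℝ (Fin (n + 1))) 2
      (fun p : ℝ × M => F p.1 p.2) (I ×ˢ univ))
    (hemb : ∀ t ∈ I, IsEmbeddedHypersurface 2 (F t))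
    (hν : ∀ t ∈ I, IsOuterUnitNormal (F t) (ν t))
    (hw : ∀ t ∈ I, ∀ x, HasDerivWithinAt (fun s => F s x) (f t x • ν t x) I t)
    {t : ℝ} (ht : t ∈ I) (x : M) :
    HasDerivWithinAt (fun s => √(gramDet (fderiv ℝ (coordMap (F s) x)
        (chartAt (EuclideanSpace ℝ (Fin n)) x x))))
      (f t x * meanCurvature (F t) (ν t) x * √(gramDet (fderiv ℝ (coordMap (F t) x)
        (chartAt (EuclideanSpace ℝ (Fin n)) x x)))) I t := by
  set χ := chartAt (EuclideanSpace ℝ (Fin n)) x with hχ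
  set u := χ x with hu
  have hut : u ∈ χ.target := χ.map_source (mem_chart_source _ x)
  have hsymm : χ.symm u = x := χ.left_inv (mem_chart_source _ x)
  set W : EuclideanSpace ℝ (Fin n) → EuclideanSpace ℝ (Fin (n + 1)) :=
    coordMap (fun y => f t y • ν t y) x with hW
  obtain ⟨hWdiff, hPder⟩ := hasDerivWithinAt_fderiv_coordMap (w := fun t y => f t y • ν t y)
    hI hI' hF hw ht hut
  have hWu : W u = f t x • ν t x := by
    simp only [hW, coordMap]
    rw [← hχ, hsymm]
  have hC2 : ContDiffAt ℝ 2 (coordMap (F t) x) u :=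
    contDiffAt_coordMap (by norm_cast) (hemb t ht).contMDiff hut
  have hPdiff : ∀ i, DifferentiableAt ℝ (coordDeriv (F t) x i) u := fun i => by
    have h1 : DifferentiableAt ℝ (fderiv ℝ (coordMap (F t) x)) u :=
      (hC2.fderiv_right (m := 1) (by norm_num)).differentiableAt (by norm_num)
    exact h1.clm_apply (differentiableAt_const _)
  -- differentiating `(∂ᵢF, f ν) = 0`
  have horth : ∀ i j, inner ℝ (coordDeriv (F t) x i u)
      (fderiv ℝ W u (EuclideanSpace.single j 1)) = f t x * secondForm (F t) (ν t) x u j i := by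
    intro i j
    have h0 : (fun u' => inner ℝ (coordDeriv (F t) x i u') (W u')) =ᶠ[𝓝 u] fun _ => 0 := by
      filter_upwards [χ.open_target.mem_nhds hut] with u' hu'
      have := (hν t ht).inner_fderiv (hemb t ht) hu' (EuclideanSpace.single i 1)
      simp only [hW, coordMap, inner_smul_right]
      rw [real_inner_comm]
      exact mul_eq_zero_of_right _ this
    have h1 := ((hPdiff i).hasFDerivAt.inner ℝ hWdiff.hasFDerivAt).unique
      ((hasFDerivAt_const (0 : ℝ) u).congr_of_eventuallyEq h0)
    have h2 := congrArg (fun L => L (EuclideanSpace.single j 1)) h1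
    simp only [ContinuousLinearMap.comp_apply, ContinuousLinearMap.prod_apply,
      fderivInnerCLM_apply, zero_apply] at h2
    have h3 : inner ℝ (fderiv ℝ (coordDeriv (F t) x i) u (EuclideanSpace.single j 1)) (W u) =
        -(f t x * secondForm (F t) (ν t) x u j i) := by
      rw [hWu, inner_smul_right]
      simp only [secondForm, Matrix.of_apply]
      rw [← hχ, hsymm]
      ring
    rw [← hW] at h2
    rw [h3] at h2
    linarith
  set g := metric (F t) x u with hg
  set b := secondForm (F t) (ν t) x u with hb
  have hentries : ∀ i j, HasDerivWithinAt (fun s => metric (F s) x u i j)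
      ((f t x • (b + b.transpose)) i j) I t := by
    intro i j
    have h1 := (hPder (EuclideanSpace.single i 1)).inner ℝ (hPder (EuclideanSpace.single j 1))
    have h2 : inner ℝ (fderiv ℝ (coordMap (F t) x) u (EuclideanSpace.single i 1))
          (fderiv ℝ W u (EuclideanSpace.single j 1)) +
        inner ℝ (fderiv ℝ W u (EuclideanSpace.single i 1))
          (fderiv ℝ (coordMap (F t) x) u (EuclideanSpace.single j 1)) =
        (f t x • (b + b.transpose)) i j := by
      have e1 := horth i j
      have e2 := horth j i
      rw [real_inner_comm] at e2
      simp only [coordDeriv] at e1 e2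
      rw [e1, e2, Matrix.smul_apply, Matrix.add_apply, Matrix.transpose_apply, smul_eq_mul]
      ring
    rw [← h2]
    exact h1
  have hGpos : 0 < g.det := by
    rw [hg, det_metric]
    exact gramDet_pos ((hemb t ht).injective_fderiv hut)
  have hdet := hasDerivWithinAt_matrix_det (A := fun s => metric (F s) x u)
    (isUnit_iff_ne_zero.2 hGpos.ne') hentries
  have hgsymm : g.transpose = g := by
    ext i j
    simp only [hg, metric, Matrix.transpose_apply, Matrix.of_apply]
    exact real_inner_comm _ _
  have htrace : (g⁻¹ * (f t x • (b + b.transpose))).trace =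
      2 * (f t x * meanCurvature (F t) (ν t) x) := by
    have h1 : (g⁻¹ * b.transpose).trace = (g⁻¹ * b).trace := by
      rw [← Matrix.trace_transpose, Matrix.transpose_mul, Matrix.transpose_transpose,
        Matrix.transpose_nonsing_inv, hgsymm, Matrix.trace_mul_comm]
    have h2 : meanCurvature (F t) (ν t) x = (g⁻¹ * b).trace := rfl
    rw [Matrix.mul_smul, Matrix.trace_smul, Matrix.mul_add, Matrix.trace_add, h1, h2, smul_eq_mul]
    ring
  rw [← hg, htrace] at hdet
  have hsqrt := hdet.sqrt hGpos.ne'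
  refine HasDerivWithinAt.congr_deriv
    (f := fun s => √(gramDet (fderiv ℝ (coordMap (F s) x) u))) hsqrt ?_
  have hs : 0 < √g.det := Real.sqrt_pos.2 hGpos
  have h3 : gramDet (fderiv ℝ (coordMap (F t) x) u) = g.det := rfl
  rw [h3, ← hg, div_eq_iff (by positivity)]
  have := Real.mul_self_sqrt hGpos.le
  linear_combination (-2 * f t x * meanCurvature (F t) (ν t) x) * this

/-- The first variation of the area density for a flow with normal velocity `f ν`. -/
theorem hasDerivWithinAt_sqrt_gramDet (hI : Convex ℝ I) (hI' : (interior I).Nonempty)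
    (hF : ContMDiffOn (𝓘(ℝ, ℝ).prod (𝓡 n)) 𝓘(ℝ, EuclideanSpace ℝ (Fin (n + 1))) 2
      (fun p : ℝ × M => F p.1 p.2) (I ×ˢ univ))
    (hemb : ∀ t ∈ I, IsEmbeddedHypersurface 2 (F t))
    (hν : ∀ t ∈ I, IsOuterUnitNormal (F t) (ν t))
    (hw : ∀ t ∈ I, ∀ x, HasDerivWithinAt (fun s => F s x) (f t x • ν t x) I t)
    {t : ℝ} (ht : t ∈ I) (c : M) {u : EuclideanSpace ℝ (Fin n)}
    (hu : u ∈ (chartAt (EuclideanSpace ℝ (Fin n)) c).target) :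
    HasDerivWithinAt (fun s => √(gramDet (fderiv ℝ (coordMap (F s) c) u)))
      (f t ((chartAt (EuclideanSpace ℝ (Fin n)) c).symm u) *
        meanCurvature (F t) (ν t) ((chartAt (EuclideanSpace ℝ (Fin n)) c).symm u) *
        √(gramDet (fderiv ℝ (coordMap (F t) c) u))) I t := by
  set x := (chartAt (EuclideanSpace ℝ (Fin n)) c).symm u with hx
  have hov : u ∈ chartOverlap n c x := ⟨hu, mem_chart_source _ x⟩
  have hτ : chartChange c x u = chartAt (EuclideanSpace ℝ (Fin n)) x x := rfl
  have h1 := (hasDerivWithinAt_sqrt_gramDet_base hI hI' hF hemb hν hw ht x).mul_const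
    |(fderiv ℝ (chartChange c x) u).det|
  rw [mul_assoc, ← hτ, ← gramDet_chartChange (hemb t ht).contMDiff hov] at h1
  refine h1.congr (fun s hs => ?_) ?_
  · exact gramDet_chartChange (hemb s hs).contMDiff hov
  · exact gramDet_chartChange (hemb t ht).contMDiff hov

variable [T2Space M] [CompactSpace M] [MeasurableSpace M] [BorelSpace M]

theorem area_eq_sum {F : M → EuclideanSpace ℝ (Fin (n + 1))} (hF : IsEmbeddedHypersurface 2 F) :
    area F = ∑ c ∈ activeCharts n M,
      ∫ u in (chartAt (EuclideanSpace ℝ (Fin n)) c).target, chartDensity F c u := by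
  have h := integral_areaMeasure hF.contMDiff (k := fun _ => 1) continuous_const
  simp only [mul_one] at h
  rw [← h, integral_const, smul_eq_mul, mul_one, area]

/-- Uniform Lipschitz continuity in time of the area density on the support of a partition
function. -/
theorem exists_chartDensity_lipschitz_time (hI : Convex ℝ I) (hI' : (interior I).Nonempty)
    (hF : ContMDiffOn (𝓘(ℝ, ℝ).prod (𝓡 n)) 𝓘(ℝ, EuclideanSpace ℝ (Fin (n + 1))) 2
      (fun p : ℝ × M => F p.1 p.2) (I ×ˢ univ))
    (hemb : ∀ t ∈ I, IsEmbeddedHypersurface 2 (F t)) {t₀ : ℝ} (ht₀ : t₀ ∈ I) (c : M) :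
    ∃ C : ℝ, 0 ≤ C ∧ ∃ δ > 0, ∀ t ∈ I, |t - t₀| < δ → ∀ u ∈ chartSupport n c,
      |√(gramDet (fderiv ℝ (coordMap (F t) c) u)) -
        √(gramDet (fderiv ℝ (coordMap (F t₀) c) u))| ≤ C * |t - t₀| := by
  have hG : ContDiffOn ℝ 1 (fun q : ℝ × EuclideanSpace ℝ (Fin n) =>
      √(gramDet (fderiv ℝ (coordMap (F q.1) c) q.2))) (flowDomain I n c) := by
    refine ContDiffOn.sqrt (contDiff_gramDet.comp_contDiffOn
      (contDiffOn_fderiv_coordMap hI hI' hF c)) fun q hq => ?_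
    exact (gramDet_pos ((hemb q.1 hq.1).injective_fderiv hq.2)).ne'
  refine (isCompact_chartSupport c).induction_on
    (p := fun s => ∃ C : ℝ, 0 ≤ C ∧ ∃ δ > 0, ∀ t ∈ I, |t - t₀| < δ → ∀ u ∈ s,
      |√(gramDet (fderiv ℝ (coordMap (F t) c) u)) -
        √(gramDet (fderiv ℝ (coordMap (F t₀) c) u))| ≤ C * |t - t₀|) ?_ ?_ ?_ ?_
  · exact ⟨0, le_rfl, 1, one_pos, fun t _ _ x hx => absurd hx (notMem_empty x)⟩
  · rintro s s' hss ⟨C, hC, δ, hδ, h⟩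
    exact ⟨C, hC, δ, hδ, fun t ht htδ x hx => h t ht htδ x (hss hx)⟩
  · rintro s s' ⟨C, hC, δ, hδ, h⟩ ⟨C', hC', δ', hδ', h'⟩
    refine ⟨max C C', le_max_of_le_left hC, min δ δ', lt_min hδ hδ', fun t ht htδ x hx => ?_⟩
    rcases hx with hx | hx
    · refine (h t ht (htδ.trans_le (min_le_left _ _)) x hx).trans ?_
      gcongr
      exact le_max_left _ _
    · refine (h' t ht (htδ.trans_le (min_le_right _ _)) x hx).trans ?_
      gcongr
      exact le_max_right _ _
  · intro u₀ hu₀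
    obtain ⟨K, hK, r, hr, -, h⟩ := exists_local_lipschitz_time hI hG ht₀
      (chartSupport_subset c hu₀)
    exact ⟨Metric.ball u₀ r, mem_nhdsWithin_of_mem_nhds (Metric.ball_mem_nhds _ hr), K, hK, r, hr,
      fun t ht htr u hu => h t ht htr u hu⟩

/-- The first variation of the area for a flow with normal velocity `f ν`. -/
theorem hasDerivWithinAt_area (hI : Convex ℝ I) (hI' : (interior I).Nonempty)
    (hF : ContMDiffOn (𝓘(ℝ, ℝ).prod (𝓡 n)) 𝓘(ℝ, EuclideanSpace ℝ (Fin (n + 1))) 2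
      (fun p : ℝ × M => F p.1 p.2) (I ×ˢ univ))
    (hemb : ∀ t ∈ I, IsEmbeddedHypersurface 2 (F t))
    (hν : ∀ t ∈ I, IsOuterUnitNormal (F t) (ν t))
    (hw : ∀ t ∈ I, ∀ x, HasDerivWithinAt (fun s => F s x) (f t x • ν t x) I t)
    {t : ℝ} (ht : t ∈ I)
    (hcont : Continuous fun x => f t x * meanCurvature (F t) (ν t) x) :
    HasDerivWithinAt (fun s => area (F s))
      (∫ x, f t x * meanCurvature (F t) (ν t) x ∂areaMeasure (F t)) I t := by
  rw [integral_areaMeasure (hemb t ht).contMDiff hcont]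
  have key : ∀ c ∈ activeCharts n M, HasDerivWithinAt
      (fun s => ∫ u in (chartAt (EuclideanSpace ℝ (Fin n)) c).target, chartDensity (F s) c u)
      (∫ u in (chartAt (EuclideanSpace ℝ (Fin n)) c).target, chartDensity (F t) c u *
        (f t ((chartAt (EuclideanSpace ℝ (Fin n)) c).symm u) *
        meanCurvature (F t) (ν t) ((chartAt (EuclideanSpace ℝ (Fin n)) c).symm u))) I t := by
    intro c _
    have htm := (chartAt (EuclideanSpace ℝ (Fin n)) c).open_target.measurableSet
    obtain ⟨C, hC, δ, hδ, hlip⟩ := exists_chartDensity_lipschitz_time hI hI' hF hemb ht c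
    have hKm : MeasurableSet (chartSupport n c) := (isCompact_chartSupport c).measurableSet
    refine hasDerivWithinAt_integral_of_lipschitz
      (bound := (chartSupport n c).indicator fun _ => C) ?_ ?_ ?_ ?_ ?_
    · filter_upwards [self_mem_nhdsWithin] with s hs
      exact (continuousOn_chartDensity (hemb s hs).contMDiff c).aestronglyMeasurable htm
    · have := integrableOn_chartDensity_mul (hemb t ht).contMDiff c (k := fun _ => 1)
        continuousOn_const
      simp only [mul_one] at this
      exact this
    · have h1 : Integrable ((chartSupport n c).indicator fun _ => C)
          (volume : Measure (EuclideanSpace ℝ (Fin n))) :=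
        (integrable_indicator_iff hKm).2
          (integrableOn_const (isCompact_chartSupport c).measure_lt_top.ne)
      exact h1.integrableOn
    · have hnear : ∀ᶠ s in 𝓝[I] t, |s - t| < δ :=
        nhdsWithin_le_nhds (Metric.ball_mem_nhds t hδ)
      filter_upwards [self_mem_nhdsWithin, hnear] with s hs hsδ
      filter_upwards [ae_restrict_mem htm] with u hu
      by_cases hK : u ∈ chartSupport n c
      · rw [indicator_of_mem hK, chartDensity, chartDensity, ← mul_sub, abs_mul,
          abs_of_nonneg ((chartPartition n M).nonneg c _)]
        calc _ ≤ 1 * |√(gramDet (fderiv ℝ (coordMap (F s) c) u)) -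
              √(gramDet (fderiv ℝ (coordMap (F t) c) u))| := by
              gcongr
              exact (chartPartition n M).le_one c _
          _ ≤ C * |s - t| := by rw [one_mul]; exact hlip s hs hsδ u hK
      · rw [indicator_of_notMem hK, chartDensity_eq_zero hu hK, chartDensity_eq_zero hu hK]
        simp
    · filter_upwards [ae_restrict_mem htm] with u hu
      have h1 := (hasDerivWithinAt_sqrt_gramDet hI hI' hF hemb hν hw ht c hu).const_mul
        (chartPartition n M c ((chartAt (EuclideanSpace ℝ (Fin n)) c).symm u))
      refine h1.congr_deriv ?_
      rw [chartDensity]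
      ring
  have hsum := HasDerivWithinAt.fun_sum key
  exact hsum.congr (fun s hs => area_eq_sum (hemb s hs)) (area_eq_sum (hemb t ht))

end AreaVariation

/-! ### Chebyshev's inequality for the speed function -/

section Speed

variable {φ : ℝ → ℝ}

theorem IsSpeed.strictMonoOn (hφ : IsSpeed φ) : StrictMonoOn φ (Ici 0) :=
  strictMonoOn_of_deriv_pos (convex_Ici 0) hφ.continuousOn fun a ha =>
    hφ.deriv_pos a (by simpa using ha)

theorem IsSpeed.nonneg (hφ : IsSpeed φ) {a : ℝ} (ha : 0 ≤ a) : 0 ≤ φ a := by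
  rw [← hφ.map_zero]
  exact hφ.strictMonoOn.monotoneOn self_mem_Ici ha ha

theorem IsSpeed.exists_eq (hφ : IsSpeed φ) {y : ℝ} (hy : 0 ≤ y) : ∃ c, 0 ≤ c ∧ φ c = y := by
  obtain ⟨b, hb, hb0⟩ :=
    ((hφ.tendsto_atTop.eventually_ge_atTop y).and (eventually_ge_atTop 0)).exists
  obtain ⟨c, hc, hcy⟩ := intermediate_value_Icc hb0
    (hφ.continuousOn.mono Icc_subset_Ici_self) ⟨hφ.map_zero.trans_le hy, hb⟩
  exact ⟨c, hc.1, hcy⟩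

theorem IsSpeed.mul_sub_nonpos (hφ : IsSpeed φ) {a c : ℝ} (ha : 0 ≤ a) (hc : 0 ≤ c) :
    (-φ a + φ c) * (a - c) ≤ 0 := by
  rcases le_total a c with h | h
  · have := hφ.strictMonoOn.monotoneOn ha hc h
    exact mul_nonpos_of_nonneg_of_nonpos (by linarith) (by linarith)
  · have := hφ.strictMonoOn.monotoneOn hc ha h
    exact mul_nonpos_of_nonpos_of_nonneg (by linarith) (by linarith)

/-- A nonnegative function is continuous as soon as its composition with `φ` is, since `φ` is
strictly increasing. -/
theorem IsSpeed.continuous_of_comp (hφ : IsSpeed φ) {X : Type*} [TopologicalSpace X] {k : X → ℝ}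
    (hk : ∀ x, 0 ≤ k x) (h : Continuous fun x => φ (k x)) : Continuous k := by
  refine continuous_iff_continuousAt.2 fun x => tendsto_order.2 ⟨fun a ha => ?_, fun b hb => ?_⟩
  · rcases lt_or_ge a 0 with ha0 | ha0
    · exact Eventually.of_forall fun y => ha0.trans_le (hk y)
    · filter_upwards [h.continuousAt.eventually_const_lt (hφ.strictMonoOn ha0 (hk x) ha)] with y hy
      exact (hφ.strictMonoOn.lt_iff_lt ha0 (hk y)).1 hy
  · have hb0 : 0 ≤ b := (hk x).trans hb.le
    filter_upwards [h.continuousAt.eventually_lt_const (hφ.strictMonoOn (hk x) hb0 hb)] with y hy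
    exact (hφ.strictMonoOn.lt_iff_lt (hk y) hb0).1 hy

variable {X : Type*} [MeasurableSpace X] {μ : Measure X} [IsFiniteMeasure μ] {k : X → ℝ}

/-- Chebyshev's inequality for the monotone function `φ`: the integral of
`(φ(c) - φ(k)) (k - c) ≤ 0`. -/
theorem IsSpeed.integral_mul_le (hφ : IsSpeed φ) (hk : ∀ x, 0 ≤ k x) {c : ℝ} (hc : 0 ≤ c)
    (hφk : Integrable (fun x => φ (k x)) μ)
    (hkφk : Integrable (fun x => (-φ (k x) + φ c) * k x) μ) :
    ∫ x, (-φ (k x) + φ c) * k x ∂μ ≤ c * ∫ x, (-φ (k x) + φ c) ∂μ := by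
  have hint : Integrable (fun x => -φ (k x) + φ c) μ := hφk.neg.add (integrable_const _)
  rw [← integral_const_mul]
  refine integral_mono hkφk (hint.const_mul c) fun x => ?_
  have := hφ.mul_sub_nonpos (hk x) hc
  simp only
  linarith

/-- If `h` is the mean of `φ(k)`, then `h - φ(k)` has integral zero, and its integral with weight `k`
is nonpositive by Chebyshev's inequality. -/
theorem IsSpeed.variation_of_mean (hφ : IsSpeed φ) (hk : ∀ x, 0 ≤ k x) {h : ℝ}
    (hφk : Integrable (fun x => φ (k x)) μ)
    (hkφk : Integrable (fun x => (-φ (k x) + h) * k x) μ)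
    (hh : h = (1 / μ.real univ) * ∫ x, φ (k x) ∂μ) :
    ∫ x, (-φ (k x) + h) ∂μ = 0 ∧ ∫ x, (-φ (k x) + h) * k x ∂μ ≤ 0 := by
  have h0 : ∫ x, (-φ (k x) + h) ∂μ = 0 := by
    have h2 := integral_add hφk.neg (integrable_const (μ := μ) h)
    simp only [Pi.neg_apply, integral_neg, integral_const, smul_eq_mul] at h2
    rw [h2, hh]
    rcases eq_or_ne (μ.real univ) 0 with h1 | h1
    · have : μ = 0 := by simpa [measureReal_def, ENNReal.toReal_eq_zero_iff] using h1
      simp [this]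
    · field_simp
      ring
  have hh0 : 0 ≤ h := by
    rw [hh]
    exact mul_nonneg (by positivity) (integral_nonneg fun x => hφ.nonneg (hk x))
  obtain ⟨c, hc, rfl⟩ := hφ.exists_eq hh0
  have := hφ.integral_mul_le hk hc hφk hkφk
  exact ⟨h0, by rwa [h0, mul_zero] at this⟩

/-- If `h` is the mean of `φ(k)` with weight `k`, then `h - φ(k)` has integral zero with weight `k`,
and its integral is nonnegative by Chebyshev's inequality. This includes the case `∫ k = 0`, in
which `h` is the junk value `0`. -/
theorem IsSpeed.variation_of_weighted_mean (hφ : IsSpeed φ) (hk : ∀ x, 0 ≤ k x) {h : ℝ}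
    (hφk : Integrable (fun x => φ (k x)) μ) (hki : Integrable k μ)
    (hkφ : Integrable (fun x => k x * φ (k x)) μ)
    (hh : h = (∫ x, k x * φ (k x) ∂μ) / ∫ x, k x ∂μ) :
    ∫ x, (-φ (k x) + h) * k x ∂μ = 0 ∧ 0 ≤ ∫ x, (-φ (k x) + h) ∂μ := by
  have hsplit : ∀ x, (-φ (k x) + h) * k x = h * k x - k x * φ (k x) := fun x => by ring
  have hnn : 0 ≤ fun x => k x * φ (k x) := fun x => mul_nonneg (hk x) (hφ.nonneg (hk x))
  have hh0 : 0 ≤ h := by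
    rw [hh]
    exact div_nonneg (integral_nonneg hnn) (integral_nonneg hk)
  -- If `k φ(k)` has integral zero, then `k = 0` almost everywhere, hence `φ(k) = 0`.
  have hzero : ∫ x, k x * φ (k x) ∂μ = 0 → k =ᵐ[μ] 0 := fun hz => by
    filter_upwards [(integral_eq_zero_iff_of_nonneg hnn hkφ).1 hz] with x hx
    by_contra hne
    have hpos : 0 < k x := (hk x).lt_of_ne' hne
    have h1 := hφ.strictMonoOn self_mem_Ici (hk x) hpos
    rw [hφ.map_zero] at h1
    exact (mul_pos hpos h1).ne' hx
  have hfirst : ∫ x, (-φ (k x) + h) * k x ∂μ = 0 := by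
    simp only [hsplit]
    rw [integral_sub (hki.const_mul h) hkφ, integral_const_mul]
    rcases eq_or_ne (∫ x, k x ∂μ) 0 with h1 | h1
    · have h2 : ∫ x, k x * φ (k x) ∂μ = 0 := by
        rw [← integral_zero X ℝ]
        refine integral_congr_ae ?_
        filter_upwards [(integral_eq_zero_iff_of_nonneg hk hki).1 h1] with x hx
        simp only [Pi.zero_apply] at hx
        simp [hx]
      rw [h1, h2]
      ring
    · rw [hh]
      field_simp
      ring
  refine ⟨hfirst, ?_⟩
  obtain ⟨c, hc, rfl⟩ := hφ.exists_eq hh0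
  have hkφk : Integrable (fun x => (-φ (k x) + φ c) * k x) μ := by
    simp only [hsplit]
    exact (hki.const_mul _).sub hkφ
  rcases hc.eq_or_lt with rfl | hc
  · -- Here the Chebyshev inequality is void, but `h = 0` forces `k = 0`.
    rw [hφ.map_zero] at hfirst
    have hz : ∫ x, k x * φ (k x) ∂μ = 0 := by
      rw [← neg_eq_zero, ← integral_neg, ← hfirst]
      exact integral_congr_ae (ae_of_all _ fun x => by ring)
    refine (integral_eq_zero_of_ae ?_).ge
    filter_upwards [hzero hz] with x hx
    simp only [Pi.zero_apply] at hx
    simp [hx]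
  · have := hφ.integral_mul_le hk hc.le hφk hkφk
    rw [hfirst] at this
    exact nonneg_of_mul_nonneg_right this hc

end Speed

/-! ### Functions on the time interval -/

section Interval

theorem convex_timeInterval (T : EReal) : Convex ℝ (timeInterval T) := by
  refine OrdConnected.convex ⟨fun a ha b hb c hc => ⟨ha.1.trans hc.1, ?_⟩⟩
  exact (EReal.coe_le_coe_iff.2 hc.2).trans_lt hb.2

theorem interior_timeInterval_nonempty {T : EReal} (hT : 0 < T) :
    (interior (timeInterval T)).Nonempty := by
  obtain ⟨s, hs0, hsT⟩ := EReal.lt_iff_exists_real_btwn.1 hT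
  have hs : 0 < s := by exact_mod_cast hs0
  have hsub : Ioo 0 s ⊆ timeInterval T := fun t ht =>
    ⟨ht.1.le, (EReal.coe_lt_coe_iff.2 ht.2).trans hsT⟩
  exact ⟨s / 2, interior_maximal hsub isOpen_Ioo ⟨by linarith, by linarith⟩⟩

variable {I : Set ℝ} {g g' : ℝ → ℝ}

theorem monotoneOn_of_hasDerivWithinAt (hI : Convex ℝ I)
    (hg : ∀ t ∈ I, HasDerivWithinAt g (g' t) I t) (h : ∀ t ∈ I, 0 ≤ g' t) : MonotoneOn g I :=
  monotoneOn_of_hasDerivWithinAt_nonneg hI (fun t ht => (hg t ht).continuousWithinAt)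
    (fun t ht => (hg t (interior_subset ht)).mono interior_subset)
    fun t ht => h t (interior_subset ht)

theorem antitoneOn_of_hasDerivWithinAt (hI : Convex ℝ I)
    (hg : ∀ t ∈ I, HasDerivWithinAt g (g' t) I t) (h : ∀ t ∈ I, g' t ≤ 0) : AntitoneOn g I :=
  antitoneOn_of_hasDerivWithinAt_nonpos hI (fun t ht => (hg t ht).continuousWithinAt)
    (fun t ht => (hg t (interior_subset ht)).mono interior_subset)
    fun t ht => h t (interior_subset ht)

end Interval

/-! ### Variations of area and volume along the flow -/

section Flow

variable {n : ℕ} {M : Type*} [TopologicalSpace M] [ChartedSpace (EuclideanSpace ℝ (Fin n)) M]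
  [IsManifold (𝓡 n) ∞ M] {φ h : ℝ → ℝ} {T : EReal} {F₀ : M → EuclideanSpace ℝ (Fin (n + 1))}
  {F ν : ℝ → M → EuclideanSpace ℝ (Fin (n + 1))}

/-- The speed is continuous in space, because the velocity is `∂F/∂t` with `F` of class `C²`. -/
theorem IsFlow.continuous_speed (hT : 0 < T) (hflow : IsFlow φ h T F₀ F ν) {t : ℝ}
    (ht : t ∈ timeInterval T) :
    Continuous fun x => -φ (meanCurvature (F t) (ν t) x) + h t := by
  set f := fun x => -φ (meanCurvature (F t) (ν t) x) + h t with hf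
  have hvel : Continuous fun x => f x • ν t x := by
    refine continuous_iff_continuousAt.2 fun x => ?_
    set χ := chartAt (EuclideanSpace ℝ (Fin n)) x with hχ
    have h1 := (hasDerivWithinAt_fderiv_coordMap
      (w := fun t x => (-φ (meanCurvature (F t) (ν t) x) + h t) • ν t x)
      (convex_timeInterval T) (interior_timeInterval_nonempty hT) hflow.contMDiffOn hflow.equation
      ht (χ.map_source (mem_chart_source _ x))).1.continuousAt
    have h2 := ContinuousAt.comp (f := χ) (x := x) h1
      (χ.continuousAt (mem_chart_source _ x))
    refine h2.congr ?_
    filter_upwards [χ.open_source.mem_nhds (mem_chart_source _ x)] with y hy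
    simp only [Function.comp_apply, coordMap, ← hχ, χ.left_inv hy, hf]
  have hνt := hflow.outerNormal t ht
  refine (hvel.inner hνt.continuous (𝕜 := ℝ)).congr fun x => ?_
  rw [real_inner_smul_left, real_inner_self_eq_norm_sq, hνt.norm_eq_one]
  ring

theorem IsFlow.continuous_speed_meanCurvature (hT : 0 < T) (hflow : IsFlow φ h T F₀ F ν) {t : ℝ}
    (ht : t ∈ timeInterval T) : Continuous fun x => φ (meanCurvature (F t) (ν t) x) := by
  have h1 : Continuous fun x => h t - (-φ (meanCurvature (F t) (ν t) x) + h t) :=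
    continuous_const.sub (hflow.continuous_speed hT ht)
  exact h1.congr fun x => by ring

/-- The mean curvature is recovered from the speed by inverting `φ`. -/
theorem IsFlow.continuous_meanCurvature (hφ : IsSpeed φ) (hT : 0 < T)
    (hflow : IsFlow φ h T F₀ F ν) {t : ℝ} (ht : t ∈ timeInterval T) :
    Continuous (meanCurvature (F t) (ν t)) :=
  hφ.continuous_of_comp (hflow.meanCurvature_nonneg t ht)
    (hflow.continuous_speed_meanCurvature hT ht)

variable [T2Space M] [CompactSpace M] [MeasurableSpace M] [BorelSpace M]

theorem IsFlow.hasDerivWithinAt_area (hφ : IsSpeed φ) (hT : 0 < T) (hflow : IsFlow φ h T F₀ F ν)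
    {t : ℝ} (ht : t ∈ timeInterval T) :
    HasDerivWithinAt (fun s => area (F s))
      (∫ x, (-φ (meanCurvature (F t) (ν t) x) + h t) * meanCurvature (F t) (ν t) x
        ∂areaMeasure (F t)) (timeInterval T) t :=
  ConstrainedFlow.hasDerivWithinAt_area
    (f := fun t x => -φ (meanCurvature (F t) (ν t) x) + h t) (convex_timeInterval T)
    (interior_timeInterval_nonempty hT) hflow.contMDiffOn hflow.embedded hflow.outerNormal
    hflow.equation ht
    ((hflow.continuous_speed hT ht).mul (hflow.continuous_meanCurvature hφ hT ht))

theorem IsFlow.hasDerivWithinAt_enclosedVolume [Nonempty M] (hT : 0 < T)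
    (hflow : IsFlow φ h T F₀ F ν) {t : ℝ} (ht : t ∈ timeInterval T) :
    HasDerivWithinAt (fun s => enclosedVolume (F s))
      (∫ x, (-φ (meanCurvature (F t) (ν t) x) + h t) ∂areaMeasure (F t)) (timeInterval T) t := by
  have hI := convex_timeInterval T
  obtain ⟨C, hC, δ, hδ, hlip⟩ := exists_displacement_lipschitz hI
    (interior_timeInterval_nonempty hT) hflow.contMDiffOn ht (hflow.embedded t ht)
  obtain ⟨C', -, δ', hδ', hbound⟩ := exists_norm_sub_le_time hI hflow.contMDiffOn ht
  have hnear : ∀ {r : ℝ}, 0 < r → ∀ᶠ s in 𝓝[timeInterval T] t, |s - t| < r := fun hr =>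
    nhdsWithin_le_nhds (Metric.ball_mem_nhds t hr)
  have hνt := hflow.outerNormal t ht
  have key := ConstrainedFlow.hasDerivWithinAt_enclosedVolume (C := max C C')
    (le_max_of_le_left hC) (hflow.embedded t ht) hνt ?_ ?_ ?_ (hflow.equation t ht)
  · refine key.congr_deriv (integral_congr_ae (ae_of_all _ fun x => ?_))
    simp only [real_inner_smul_left, real_inner_self_eq_norm_sq, hνt.norm_eq_one]
    ring
  · filter_upwards [self_mem_nhdsWithin] with s hs
    exact (hflow.embedded s hs).contMDiff.continuous
  · filter_upwards [self_mem_nhdsWithin, hnear hδ] with s hs hsδ x y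
    refine (hlip s hs hsδ x y).trans ?_
    gcongr
    exact le_max_left _ _
  · filter_upwards [self_mem_nhdsWithin, hnear hδ'] with s hs hsδ x
    refine (hbound s hs hsδ x).trans ?_
    gcongr
    exact le_max_right _ _

/-- In the volume preserving case the volume is stationary and the area does not increase. -/
theorem IsFlow.variation_of_volumePreserving (hφ : IsSpeed φ) (hT : 0 < T)
    (hflow : IsFlow φ h T F₀ F ν) {t : ℝ} (ht : t ∈ timeInterval T)
    (hh : h t = volumePreservingTerm φ (F t) (ν t)) :
    ∫ x, (-φ (meanCurvature (F t) (ν t) x) + h t) ∂areaMeasure (F t) = 0 ∧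
    ∫ x, (-φ (meanCurvature (F t) (ν t) x) + h t) * meanCurvature (F t) (ν t) x
      ∂areaMeasure (F t) ≤ 0 := by
  have hF := (hflow.embedded t ht).contMDiff
  have := isFiniteMeasure_areaMeasure hF
  exact hφ.variation_of_mean (hflow.meanCurvature_nonneg t ht)
    (integrable_areaMeasure hF (hflow.continuous_speed_meanCurvature hT ht))
    (integrable_areaMeasure hF ((hflow.continuous_speed hT ht).mul
      (hflow.continuous_meanCurvature hφ hT ht))) hh

/-- In the area preserving case the area is stationary and the volume does not decrease. -/
theorem IsFlow.variation_of_areaPreserving (hφ : IsSpeed φ) (hT : 0 < T)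
    (hflow : IsFlow φ h T F₀ F ν) {t : ℝ} (ht : t ∈ timeInterval T)
    (hh : h t = areaPreservingTerm φ (F t) (ν t)) :
    ∫ x, (-φ (meanCurvature (F t) (ν t) x) + h t) * meanCurvature (F t) (ν t) x
      ∂areaMeasure (F t) = 0 ∧
    0 ≤ ∫ x, (-φ (meanCurvature (F t) (ν t) x) + h t) ∂areaMeasure (F t) := by
  have hF := (hflow.embedded t ht).contMDiff
  have := isFiniteMeasure_areaMeasure hF
  have hH := hflow.continuous_meanCurvature hφ hT ht
  have hφH := hflow.continuous_speed_meanCurvature hT ht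
  exact hφ.variation_of_weighted_mean (hflow.meanCurvature_nonneg t ht)
    (integrable_areaMeasure hF hφH) (integrable_areaMeasure hF hH)
    (integrable_areaMeasure hF (hH.mul hφH)) hh

end Flow

end ConstrainedFlow

end

theorem lemma3p1 {n : ℕ} (hn : 1 ≤ n)
    {M : Type*} [TopologicalSpace M] [ChartedSpace (EuclideanSpace ℝ (Fin n)) M]
    [IsManifold (𝓡 n) ∞ M] [T2Space M] [CompactSpace M] [Nonempty M]
    [MeasurableSpace M] [BorelSpace M]
    (φ h : ℝ → ℝ) (hφ : ConstrainedFlow.IsSpeed φ)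
    (T : EReal) (hT : 0 < T)
    (F₀ : M → EuclideanSpace ℝ (Fin (n + 1)))
    (hF₀ : ConstrainedFlow.IsEmbeddedHypersurface ∞ F₀)
    (F ν : ℝ → M → EuclideanSpace ℝ (Fin (n + 1)))
    (hconv : ConstrainedFlow.IsStrictlyConvex F₀ (ν 0))
    (hflow : ConstrainedFlow.IsFlow φ h T F₀ F ν) :
    ((∀ t ∈ ConstrainedFlow.timeInterval T,
        h t = ConstrainedFlow.volumePreservingTerm φ (F t) (ν t)) →
      (∀ t ∈ ConstrainedFlow.timeInterval T,
        DifferentiableWithinAt ℝ (fun s => ConstrainedFlow.area (F s))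
          (ConstrainedFlow.timeInterval T) t ∧
        derivWithin (fun s => ConstrainedFlow.area (F s))
          (ConstrainedFlow.timeInterval T) t ≤ 0) ∧
      AntitoneOn (fun t => ConstrainedFlow.isoperimetricRatio (F t))
        (ConstrainedFlow.timeInterval T)) ∧
    ((∀ t ∈ ConstrainedFlow.timeInterval T,
        h t = ConstrainedFlow.areaPreservingTerm φ (F t) (ν t)) →
      (∀ t ∈ ConstrainedFlow.timeInterval T,
        DifferentiableWithinAt ℝ (fun s => ConstrainedFlow.enclosedVolume (F s))
          (ConstrainedFlow.timeInterval T) t ∧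
        0 ≤ derivWithin (fun s => ConstrainedFlow.enclosedVolume (F s))
          (ConstrainedFlow.timeInterval T) t) ∧
      AntitoneOn (fun t => ConstrainedFlow.isoperimetricRatio (F t))
        (ConstrainedFlow.timeInterval T)) := by
  have hI := ConstrainedFlow.convex_timeInterval T
  have hud : UniqueDiffOn ℝ (ConstrainedFlow.timeInterval T) :=
    uniqueDiffOn_convex hI (ConstrainedFlow.interior_timeInterval_nonempty hT)
  have hA := fun t (ht : t ∈ ConstrainedFlow.timeInterval T) => hflow.hasDerivWithinAt_area hφ hT ht
  have hV := fun t (ht : t ∈ ConstrainedFlow.timeInterval T) =>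
    hflow.hasDerivWithinAt_enclosedVolume hT ht
  have hApos : ∀ t, 0 ≤ ConstrainedFlow.area (F t) := fun t => measureReal_nonneg
  have hVpos := fun t (ht : t ∈ ConstrainedFlow.timeInterval T) =>
    ConstrainedFlow.enclosedVolume_pos (hflow.embedded t ht) (hflow.outerNormal t ht)
  -- It suffices that the area is nonincreasing and the volume is nondecreasing.
  have hratio (hA' : AntitoneOn (fun t => ConstrainedFlow.area (F t))
        (ConstrainedFlow.timeInterval T))
      (hV' : MonotoneOn (fun t => ConstrainedFlow.enclosedVolume (F t))
        (ConstrainedFlow.timeInterval T)) :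
      AntitoneOn (fun t => ConstrainedFlow.isoperimetricRatio (F t))
        (ConstrainedFlow.timeInterval T) := fun s hs t ht hst =>
    div_le_div₀ (pow_nonneg (hApos s) _) (pow_le_pow_left₀ (hApos t) (hA' hs ht hst) _)
      (pow_pos (hVpos s hs) _) (pow_le_pow_left₀ (hVpos s hs).le (hV' hs ht hst) _)
  refine ⟨fun hh => ?_, fun hh => ?_⟩
  · have hvar := fun t ht => hflow.variation_of_volumePreserving hφ hT ht (hh t ht)
    refine ⟨fun t ht => ⟨(hA t ht).differentiableWithinAt, ?_⟩, hratio
      (ConstrainedFlow.antitoneOn_of_hasDerivWithinAt hI hA fun t ht => (hvar t ht).2)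
      (ConstrainedFlow.monotoneOn_of_hasDerivWithinAt hI hV fun t ht => (hvar t ht).1.ge)⟩
    rw [(hA t ht).derivWithin (hud t ht)]
    exact (hvar t ht).2
  · have hvar := fun t ht => hflow.variation_of_areaPreserving hφ hT ht (hh t ht)
    refine ⟨fun t ht => ⟨(hV t ht).differentiableWithinAt, ?_⟩, hratio
      (ConstrainedFlow.antitoneOn_of_hasDerivWithinAt hI hA fun t ht => (hvar t ht).1.le)
      (ConstrainedFlow.monotoneOn_of_hasDerivWithinAt hI hV fun t ht => (hvar t ht).2)⟩
    rw [(hV t ht).derivWithin (hud t ht)]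
    exact (hvar t ht).2
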